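/- **Conventions.** $T_{\rm ord}$ is the theory of dense linear orders without first or last element. $T_{\rm feq}$ is the theory in the vocabulary $\{P,Q,E,R,F\}$ saying: $P,Q$ are disjoint unary predicates covering the universe; $E$ is an equivalence relation on $Q$; $R\subseteq Q\times P$ and ($x\,R\,z$, $y\,R\,z$, $x\,E\,y$ imply $x=y$); $F$ is a partial function from $Q\times P$ to $Q$ (given by its graph) with $F(x,z)\,R\,z$ and $x\,E\,F(x,z)$. $T^+_{\rm feq}$ adds that $F$ is total on $Q\times P$. $T^*_{\rm feq}$ is the model completion of $T^+_{\rm feq}$; it exists and is a complete theory. For a theory $T_0$, a (one-dimensional) interpretation of $T_0$ in a complete first-order theory $T$ is a family $\bar\varphi$ of formulas of $T$, one formula $\varphi_R$ for each predicate or function symbol $R$ of $T_0$ and one formula $\varphi_=$ for equality, such that for every $M\models T$ the structure $M^{[\bar\varphi]}$ with universe $\{a\in M: M\models\varphi_=(a,a)\}$, with predicates defined by the $\varphi_R$ and functions whose graphs are defined by the $\varphi_f$, is (well defined and) a model of $T_0$. An interpretation of $T_0$ in $M$ with parameters is a family of formulas with parameters from $M$ such that the resulting structure is a model of $T_0$.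 A $(T_0,T_1)$-superior is a triple $(T,\bar\varphi_0,\bar\varphi_1)$ where $T$ is a complete first-order theory and $\bar\varphi_l$ is an interpretation of $T_l$ in $T$ for $l<2$; it is $\kappa$-relevant if $|T|<\kappa$, where $|T|$ is the number of symbols of $T$ plus $\aleph_0$. For regular $\kappa$, $T_0\triangleleft^*_\kappa T_1$ means that there is a $\kappa$-relevant $(T_0,T_1)$-superior $(T,\bar\varphi_0,\bar\varphi_1)$ such that for every $M\models T$, if $M^{[\bar\varphi_1]}$ is $\kappa$-saturated then $M^{[\bar\varphi_0]}$ is $\kappa$-saturated. $T_0$ is strictly $\triangleleft^*_\kappa$-below $T_1$ if $T_0\triangleleft^*_\kappa T_1$ and not $T_1\triangleleft^*_\kappa T_0$. **Theorem.** Let $\lambda$ be an uncountable cardinal with $\lambda^{<\lambda}=\lambda$ and $2^\lambda=\lambda^+$. (0) $T^+_{\rm feq}$ has a model completion $T^*_{\rm feq}$, and it is complete. (1) For every $\lambda$-relevant $(T_{\rm ord},T^*_{\rm feq})$-superior $(T,\bar\varphi,\bar\psi)$ there is a model $M^*$ of $T$ of cardinality $\lambda^+$ such that $(M^*)^{[\bar\varphi]}$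 is not $\lambda^+$-saturated and $(M^*)^{[\bar\psi]}$ is $\lambda^+$-saturated. (2) Moreover, for every such superior there is a model $M^*$ of $T$ of cardinality $\lambda^+$ such that for every interpretation $\bar\varphi'$ of $T_{\rm ord}$ in $M^*$ with parameters, $(M^*)^{[\bar\varphi']}$ is not $\lambda^+$-saturated, and for every interpretation $\bar\psi'$ of $T^*_{\rm feq}$ in $M^*$ with parameters, $(M^*)^{[\bar\psi']}$ is $\lambda^+$-saturated. (3) $T^*_{\rm feq}$ is strictly $\triangleleft^*_{\lambda^+}$-below $T_{\rm ord}$. -/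

import Mathlib

open FirstOrder FirstOrder.Language
open scoped Cardinal

universe u u₀ v₀ u₁ v₁

namespace FeqOrd

/-! ### Saturation -/

/-- `M` is `κ`-saturated: for every set `A` of fewer than `κ` elements of `M`, every set of formulas
in one free variable with parameters from `A` that is finitely satisfiable in `M`
(i.e. every 1-type over `A`) is realised in `M`. -/
def IsSaturated (L : FirstOrder.Language.{u₀, v₀}) (κ : Cardinal.{u}) (M : Type u) [L.Structure M] : Prop :=
  ∀ A : Set M, #A < κ → ∀ p : Set (L[[A]].Formula (Fin 1)),
    (∀ p₀ : Finset (L[[A]].Formula (Fin 1)), (∀ φ ∈ p₀, φ ∈ p) →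
      ∃ a : M, ∀ φ ∈ p₀, φ.Realize (fun _ => a)) →
    ∃ a : M, ∀ φ ∈ p, φ.Realize (fun _ => a)

/-! ### Interpretations -/

/-- A family of `L`-formulas indexed by equality and by the symbols of `L₀`: an `n`-ary predicate
gets a formula in `n` variables, and an `n`-ary function symbol `f` gets a formula in `n + 1`
variables, which is to define the graph of `f` (the value is the last variable). -/
structure Interpretation (L₀ : FirstOrder.Language.{u₀, v₀}) (L : FirstOrder.Language.{u₁, v₁}) where
  /-- the formula for equality; its diagonal defines the universe -/
  eq : L.Formula (Fin 2)
  /-- the formulas for the predicates -/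
  rel : ∀ {n : ℕ}, L₀.Relations n → L.Formula (Fin n)
  /-- the formulas for the function symbols -/
  func : ∀ {n : ℕ}, L₀.Functions n → L.Formula (Fin (n + 1))

namespace Interpretation

variable {L₀ : FirstOrder.Language.{u₀, v₀}} {L : FirstOrder.Language.{u₁, v₁}} (φ : Interpretation L₀ L)

/-- The universe of `M^[φ]`: the elements `a` of `M` with `M ⊨ φ₌(a, a)`. -/
def dom (M : Type u) [L.Structure M] : Set M :=
  {a | φ.eq.Realize ![a, a]}

/-- `φ` defines an `L₀`-structure in `M`: the universe is non-empty, and the formula of each function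
symbol defines the graph of a function on the universe. -/
structure DefinesStructure (M : Type u) [L.Structure M] : Prop where
  nonempty : (φ.dom M).Nonempty
  functional : ∀ {n : ℕ} (f : L₀.Functions n) (a : Fin n → φ.dom M),
    ∃! b : φ.dom M, (φ.func f).Realize (Fin.snoc (fun i => (a i : M)) (b : M))

/-- The `L₀`-structure `M^[φ]`. -/
@[reducible]
noncomputable def toStructure (M : Type u) [L.Structure M] (h : φ.DefinesStructure M) :
    L₀.Structure (φ.dom M) where
  funMap f a := (h.functional f a).choose
  RelMap R a := (φ.rel R).Realize (fun i => (a i : M))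

/-- `M^[φ]` is a model of `T₀`. -/
def ModelIn (T₀ : L₀.Theory) (M : Type u) [L.Structure M] : Prop :=
  ∃ h : φ.DefinesStructure M, @Theory.Model L₀ (φ.dom M) (φ.toStructure M h) T₀

/-- `M^[φ]` is `κ`-saturated. -/
def SaturatedIn (κ : Cardinal.{u}) (M : Type u) [L.Structure M] : Prop :=
  ∃ h : φ.DefinesStructure M, @IsSaturated L₀ κ (φ.dom M) (φ.toStructure M h)

end Interpretation

/-- `φ` is an interpretation of `T₀` in `T`: `M^[φ]` is a model of `T₀` for every model `M` of `T`. -/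
def Interprets {L₀ : FirstOrder.Language.{u₀, v₀}} {L : FirstOrder.Language.{u, u}} (φ : Interpretation L₀ L)
    (T₀ : L₀.Theory) (T : L.Theory) : Prop :=
  ∀ M : Theory.ModelType.{u, u, u} T, φ.ModelIn T₀ M

/-! ### The order `◁*` -/

/-- `(T, φ₀, φ₁)` is a `(T₀, T₁)`-superior. -/
structure IsSuperior {L₀ : FirstOrder.Language.{u₀, v₀}} {L₁ : FirstOrder.Language.{u₁, v₁}} {L : FirstOrder.Language.{u, u}}
    (T₀ : L₀.Theory) (T₁ : L₁.Theory) (T : L.Theory)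
    (φ₀ : Interpretation L₀ L) (φ₁ : Interpretation L₁ L) : Prop where
  complete : T.IsComplete
  interprets₀ : Interprets φ₀ T₀ T
  interprets₁ : Interprets φ₁ T₁ T

/-- `T` is `κ`-relevant: `|T| < κ`, where `|T|` is the number of symbols of the language of `T`
plus `ℵ₀` (this is also the number of sentences in the deductive closure of `T`). -/
def IsRelevant {L : FirstOrder.Language.{u, u}} (_T : L.Theory) (κ : Cardinal.{u}) : Prop :=
  max L.card ℵ₀ < κ

/-- `T₀ ◁*_{κ,μ} T₁`: some `min(μ, κ)`-relevant `(T₀, T₁)`-superior `(T, φ₀, φ₁)` is such that in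
every model `M` of `T` in which `M^[φ₁]` is `μ`-saturated, `M^[φ₀]` is `κ`-saturated. -/
def TriangleStar₂ {L₀ : FirstOrder.Language.{u₀, v₀}} {L₁ : FirstOrder.Language.{u₁, v₁}} (κ μ : Cardinal.{u})
    (T₀ : L₀.Theory) (T₁ : L₁.Theory) : Prop :=
  ∃ (L : FirstOrder.Language.{u, u}) (T : L.Theory) (φ₀ : Interpretation L₀ L) (φ₁ : Interpretation L₁ L),
    IsSuperior T₀ T₁ T φ₀ φ₁ ∧ IsRelevant T (min μ κ) ∧
      ∀ M : Theory.ModelType.{u, u, u} T, φ₁.SaturatedIn μ M → φ₀.SaturatedIn κ M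

/-- `T₀ ◁*_κ T₁`. -/
def TriangleStar {L₀ : FirstOrder.Language.{u₀, v₀}} {L₁ : FirstOrder.Language.{u₁, v₁}} (κ : Cardinal.{u})
    (T₀ : L₀.Theory) (T₁ : L₁.Theory) : Prop :=
  TriangleStar₂ κ κ T₀ T₁

/-- `T₀` is strictly `◁*_κ`-below `T₁`. -/
def StrictTriangleStar {L₀ : FirstOrder.Language.{u₀, v₀}} {L₁ : FirstOrder.Language.{u₁, v₁}} (κ : Cardinal.{u})
    (T₀ : L₀.Theory) (T₁ : L₁.Theory) : Prop :=
  TriangleStar κ T₀ T₁ ∧ ¬ TriangleStar κ T₁ T₀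

/-! ### Model completions -/

/-- `M` is an existentially closed model of `T`: a system of quantifier-free conditions with
parameters in `M` that is solvable in a model of `T` extending `M` is solvable in `M`. -/
def IsExistentiallyClosed {L : FirstOrder.Language.{0, 0}} {T : L.Theory}
    (M : Theory.ModelType.{0, 0, 0} T) : Prop :=
  ∀ (N : Theory.ModelType.{0, 0, 0} T) (f : M ↪[L] N) (m : ℕ) (φ : L.Formula (M ⊕ Fin m)),
    BoundedFormula.IsQF φ →
    (∃ b : Fin m → N, φ.Realize (Sum.elim f b)) → ∃ b : Fin m → M, φ.Realize (Sum.elim id b)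

/-- The theory of the existentially closed models of `T`. It is the model completion of `T`
whenever `T` has one. -/
def theoryOfExistentiallyClosed {L : FirstOrder.Language.{0, 0}} (T : L.Theory) : L.Theory :=
  {σ | ∀ M : Theory.ModelType.{0, 0, 0} T, IsExistentiallyClosed M → M ⊨ σ}

/-- `T'` is a model completion of `T`: models of `T'` are models of `T`, every model of `T` extends
to a model of `T'`, and any two models of `T'` extending the same model `A` of `T` satisfy the same
formulas with parameters in `A`. -/
structure IsModelCompletion {L : FirstOrder.Language.{0, 0}} (T T' : L.Theory) : Prop where
  model_of_model : ∀ M : Theory.ModelType.{0, 0, 0} T', M ⊨ T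
  extends_to_model : ∀ A : Theory.ModelType.{0, 0, 0} T,
    ∃ M : Theory.ModelType.{0, 0, 0} T', Nonempty (A ↪[L] M)
  complete_over : ∀ (A : Theory.ModelType.{0, 0, 0} T) (M N : Theory.ModelType.{0, 0, 0} T')
    (f : A ↪[L] M) (g : A ↪[L] N) (φ : L.Formula A), φ.Realize f ↔ φ.Realize g

/-! ### The theories `T_ord`, `T_feq`, `T_feq⁺`, `T*_feq` -/

/-- The theory of dense linear orders without endpoints. -/
abbrev Tord : FirstOrder.Language.order.Theory := FirstOrder.Language.order.dlo

/-- The predicates `P, Q, E, R` and the graph `F` of a partial binary function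
(`F x z y` says that `F(x, z)` is defined and equal to `y`). -/
inductive feqRel : ℕ → Type
  | P : feqRel 1
  | Q : feqRel 1
  | E : feqRel 2
  | R : feqRel 2
  | F : feqRel 3

/-- The language `{P, Q, E, R, F}`. -/
def Lfeq : FirstOrder.Language.{0, 0} := ⟨fun _ => Empty, feqRel⟩

/-- the symbol `P` -/
def relP : Lfeq.Relations 1 := feqRel.P
/-- the symbol `Q` -/
def relQ : Lfeq.Relations 1 := feqRel.Q
/-- the symbol `E` -/
def relE : Lfeq.Relations 2 := feqRel.E
/-- the symbol `R` -/
def relR : Lfeq.Relations 2 := feqRel.R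
/-- the symbol `F` -/
def relF : Lfeq.Relations 3 := feqRel.F

section Axioms

variable {n : ℕ}

/-- the atomic formula `P t` -/
def fP (t : Lfeq.Term (Empty ⊕ Fin n)) : Lfeq.BoundedFormula Empty n :=
  relP.boundedFormula₁ t

/-- the atomic formula `Q t` -/
def fQ (t : Lfeq.Term (Empty ⊕ Fin n)) : Lfeq.BoundedFormula Empty n :=
  relQ.boundedFormula₁ t

/-- the atomic formula `s E t` -/
def fE (s t : Lfeq.Term (Empty ⊕ Fin n)) : Lfeq.BoundedFormula Empty n :=
  relE.boundedFormula₂ s t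

/-- the atomic formula `s R t` -/
def fR (s t : Lfeq.Term (Empty ⊕ Fin n)) : Lfeq.BoundedFormula Empty n :=
  relR.boundedFormula₂ s t

/-- the atomic formula `F(r, s) = t` -/
def fF (r s t : Lfeq.Term (Empty ⊕ Fin n)) : Lfeq.BoundedFormula Empty n :=
  relF.boundedFormula ![r, s, t]

end Axioms

/-- The theory `T_feq`. -/
def Tfeq : Lfeq.Theory :=
  { -- `P` and `Q` are disjoint and cover everything
    ∀' ∼(fP &0 ⊓ fQ &0),
    ∀' (fP &0 ⊔ fQ &0),
    -- `E` is an equivalence relation on `Q`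
    ∀' ∀' (fE &0 &1 ⟹ fQ &0 ⊓ fQ &1),
    ∀' (fQ &0 ⟹ fE &0 &0),
    ∀' ∀' (fE &0 &1 ⟹ fE &1 &0),
    ∀' ∀' ∀' (fE &0 &1 ⊓ fE &1 &2 ⟹ fE &0 &2),
    -- `R` is a relation on `Q × P` picking at most one element of each class
    ∀' ∀' (fR &0 &1 ⟹ fQ &0 ⊓ fP &1),
    ∀' ∀' ∀' (fR &0 &2 ⊓ fR &1 &2 ⊓ fE &0 &1 ⟹ &0 =' &1),
    -- `F` is a partial function from `Q × P` to `Q`, with `F(x, z) R z` and `x E F(x, z)`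
    ∀' ∀' ∀' (fF &0 &1 &2 ⟹ fQ &0 ⊓ fP &1 ⊓ fQ &2),
    ∀' ∀' ∀' ∀' (fF &0 &1 &2 ⊓ fF &0 &1 &3 ⟹ &2 =' &3),
    ∀' ∀' ∀' (fF &0 &1 &2 ⟹ fR &2 &1 ⊓ fE &0 &2) }

/-- The theory `T_feq⁺`: `T_feq` together with the requirement that `F` is total on `Q × P`. -/
def TfeqPlus : Lfeq.Theory :=
  Tfeq ∪ {∀' ∀' (fQ &0 ⊓ fP &1 ⟹ ∃' fF &0 &1 &2)}

/-- The models of `T_feq⁺`, spelled out. -/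
theorem model_TfeqPlus_iff {M : Type u} [Lfeq.Structure M] :
    M ⊨ TfeqPlus ↔
      let P : M → Prop := fun x => Structure.RelMap relP ![x]
      let Q : M → Prop := fun x => Structure.RelMap relQ ![x]
      let E : M → M → Prop := fun x y => Structure.RelMap relE ![x, y]
      let R : M → M → Prop := fun x y => Structure.RelMap relR ![x, y]
      let F : M → M → M → Prop := fun x y z => Structure.RelMap relF ![x, y, z]
      (∀ x, ¬ (P x ∧ Q x)) ∧ (∀ x, P x ∨ Q x) ∧
      (∀ x y, E x y → Q x ∧ Q y) ∧ (∀ x, Q x → E x x) ∧ (∀ x y, E x y → E y x) ∧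
      (∀ x y z, E x y ∧ E y z → E x z) ∧
      (∀ x z, R x z → Q x ∧ P z) ∧ (∀ x y z, (R x z ∧ R y z) ∧ E x y → x = y) ∧
      (∀ x z y, F x z y → (Q x ∧ P z) ∧ Q y) ∧ (∀ x z y y', F x z y ∧ F x z y' → y = y') ∧
      (∀ x z y, F x z y → R y z ∧ E x y) ∧ (∀ x z, Q x ∧ P z → ∃ y, F x z y) := by
  have key : ∀ (k : ℕ) (v : Fin k → M) (r s t : Lfeq.Term (Empty ⊕ Fin k)),
      (fF r s t).Realize default v ↔ Structure.RelMap relF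
        ![r.realize (Sum.elim default v), s.realize (Sum.elim default v),
          t.realize (Sum.elim default v)] := by
    intro k v r s t
    rw [fF, BoundedFormula.realize_rel]
    apply iff_of_eq
    congr 1
    funext i
    fin_cases i <;> rfl
  simp only [TfeqPlus, Tfeq, Theory.model_union_iff, Theory.model_insert_iff,
    Theory.model_singleton_iff, Sentence.Realize, Formula.Realize, BoundedFormula.realize_all,
    BoundedFormula.realize_imp, BoundedFormula.realize_inf, BoundedFormula.realize_sup,
    BoundedFormula.realize_not, BoundedFormula.realize_ex, fP, fQ, fE, fR, key,
    BoundedFormula.realize_rel₁, BoundedFormula.realize_rel₂, BoundedFormula.realize_bdEqual,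
    and_assoc]
  rfl

/-- The theory `T*_feq`, the model completion of `T_feq⁺`. -/
def TfeqStar : Lfeq.Theory := theoryOfExistentiallyClosed TfeqPlus

end FeqOrd

/-!
**The theory `T*_feq`.** The models of `T*_feq` are the generic models of `T_feq⁺` (`IsFeqGeneric`):
some element of `P` makes any prescribed choices from finitely many classes, the classes are infinite,
and some new class makes any prescribed choices for finitely many elements of `P`. A partial map into a
generic model that preserves the diagram extends to one further point (`FeqSim.exists_option`), so
generic models eliminate quantifiers, and every model of `T_feq⁺` embeds into a generic one
(`exists_feqGeneric_extension`). Hence `T*_feq` is a complete model completion. The same one-point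
extension shows that `lam⁺`-generic models, in which "finitely many" is replaced by "at most `lam`",
are `lam⁺`-saturated (`isSaturated_of_isFeqGeneric`).

**The model of cardinality `lam⁺`.** It is the union of a chain of length `lam⁺` of models of
cardinality at most `lam` (`exists_model_arrays_cuts`), with `2 ^ lam = lam⁺` providing an enumeration
of all tasks. There are two kinds of tasks. One kind fills a definable array: `ρ(z, d)` is a definable
relation between elements and codes with a definable equivalence relation on the codes such that any
finitely many inequivalent codes are simultaneously satisfied by some `z`; the task is to satisfy at
most `lam` given inequivalent codes (`exists_extension_array`). The other kind adds, for a definable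
order, an increasing and a decreasing `lam`-sequence that no definable set separates
(`exists_extension_cut`). An element filling such a cut would define a separating set, so it suffices
that all the cuts remain unseparated by sets definable in later models.

Each step is a Henkin construction (`exists_extension`). A set of formulas about the elements to be
added is good if its finite subsets have solution sets that are not small, in a sense of smallness
adapted to the task. Given a formula that is to define a set separating a cut of the old model, one
finds indices such that the failure of the separation of `a i` from `b j` can be added to a good set of
fewer than `lam` formulas. Otherwise the separation would be forced on all solutions outside a small
set, and the elements forced into the set would form a definable set that separates the cut in the old
model. For arrays, this needs the separation to be forced by choices of bounded size with a common
stem (`exists_stem`, `keepsCut_arrayPositive`).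

In the resulting model, the three conditions of `lam⁺`-genericity of an interpretation of `T*_feq` are
instances of filling an array (`isFeqGeneric_succ_of_realizesArrays`), while every interpreted dense
linear order has an unfilled cut and is therefore not `lam⁺`-saturated
(`Interpretation.not_saturatedIn_of_cuts`). This also refutes that the theory of dense linear orders is
below `T*_feq`.

**`T*_feq` lies below the theory of dense linear orders.** The witness is the theory of the set of
finitely supported sequences of integers with the lexicographic order, a tree of height `ℕ`, which also
carries a countable model of `T*_feq` and a coding of the definable sets of that model by its elements
(`exists_codeTree`). A type over at most `lam` parameters is coded by a directed family of codes. In a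
model whose order is `lam⁺`-saturated, these codes are put one after the other on a branch consistent
with all of them; at limit stages, filling a cut gives a branch through the initial segments already
constructed, and filling a second cut gives a nonstandard level beyond them up to which this branch is
still consistent. An element that satisfies all entries of the final branch realises the type
(`IsCodeTree.exists_rho`, `isSaturated_of_codeTree`, `triangleStar_TfeqStar_Tord`).
-/


namespace FeqOrd

/-! ### Monotone sequences meeting dense sets -/

/-- In a preorder in which every monotone family indexed by a proper initial segment of the
well-order `ι` is bounded, there is a monotone `ι`-sequence that enters the `i`-th dense set at `i`. -/
theorem exists_monotone_meeting {ι : Type*} [LinearOrder ι] [WellFoundedLT ι] {P : Type*}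
    [Preorder P] (ub : ∀ (i : ι) (f : Set.Iio i → P), Monotone f → ∃ p, ∀ j, f j ≤ p)
    (D : ι → P → Prop) (hD : ∀ i p, ∃ q, p ≤ q ∧ D i q) :
    ∃ f : ι → P, Monotone f ∧ ∀ i, D i (f i) := by
  classical
  rcases isEmpty_or_nonempty ι with hι | ⟨⟨i₀⟩⟩
  · exact ⟨fun i => (hι.false i).elim, fun i => (hι.false i).elim, fun i => (hι.false i).elim⟩
  have hne : Nonempty P := by
    obtain ⟨m, -, hm⟩ := (wellFounded_lt (α := ι)).has_min Set.univ ⟨i₀, trivial⟩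
    have : IsEmpty (Set.Iio m) := ⟨fun j => hm j trivial j.2⟩
    exact ⟨(ub m (fun j => isEmptyElim j) (fun j => isEmptyElim j)).choose⟩
  let F : ∀ i : ι, (∀ j, j < i → P) → P := fun i g =>
    Classical.epsilon fun q => (∀ j (hj : j < i), g j hj ≤ q) ∧ D i q
  let f : ι → P := (wellFounded_lt (α := ι)).fix F
  have hf : ∀ i, f i = Classical.epsilon fun q => (∀ j, j < i → f j ≤ q) ∧ D i q := fun i =>
    (wellFounded_lt (α := ι)).fix_eq F i
  have key : ∀ i, (∀ j, j < i → f j ≤ f i) ∧ D i (f i) := by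
    intro i
    induction i using (wellFounded_lt (α := ι)).induction with
    | _ i ih =>
      have hmono : Monotone fun j : Set.Iio i => f j := by
        intro j k hjk
        rcases hjk.lt_or_eq with h | h
        · exact (ih k k.2).1 j h
        · rw [h]
      obtain ⟨p, hp⟩ := ub i _ hmono
      obtain ⟨q, hpq, hq⟩ := hD i p
      have hex : ∃ q, (∀ j, j < i → f j ≤ q) ∧ D i q :=
        ⟨q, fun j hj => (hp ⟨j, hj⟩).trans hpq, hq⟩
      have := Classical.epsilon_spec hex
      rw [← hf i] at this
      exact this
  refine ⟨f, fun i j hij => ?_, fun i => (key i).2⟩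
  rcases hij.lt_or_eq with h | h
  · exact (key j).1 i h
  · rw [h]

/-- A property antitone in an index that is directed for families indexed by `Y` has a uniform
witness in `Y` if it has a witness at every index. -/
theorem exists_uniform_witness {I Y : Type*} [Preorder I] (hdir : ∀ g : Y → I, ∃ i, ∀ y, g y ≤ i)
    {p : I → Y → Prop} (hp : ∀ i j y, i ≤ j → p j y → p i y) (h : ∀ i, ∃ y, p i y) :
    ∃ y, ∀ i, p i y := by
  by_contra hcon
  push Not at hcon
  choose g hg using hcon
  obtain ⟨i, hi⟩ := hdir g
  obtain ⟨y, hy⟩ := h i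
  exact hg y (hp _ _ y (hi y) hy)

/-! ### Formulas and definable sets -/

section Formulas

variable {L : FirstOrder.Language.{u₀, v₀}} {M : Type*} [L.Structure M] {α β γ : Type*}

open Classical in
/-- The free variables of a formula, independently of any choice of decidable equality. -/
noncomputable def fv (φ : L.Formula α) : Finset α := φ.freeVarFinset

theorem realize_congr_of_eqOn {φ : L.Formula α} {v w : α → M}
    (h : ∀ a ∈ fv φ, v a = w a) : φ.Realize v ↔ φ.Realize w := by
  classical
  have e : ∀ x : α → M, φ.Realize x ↔
      (BoundedFormula.restrictFreeVar φ id).Realize (fun a : φ.freeVarFinset => x a) default :=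
    fun x => (BoundedFormula.realize_restrictFreeVar (f := id) x (fun _ => rfl)).symm
  rw [e v, e w]
  have : (fun a : φ.freeVarFinset => v a) = fun a : φ.freeVarFinset => w a :=
    funext fun a => h a (by unfold fv; convert a.2)
  rw [this]

theorem realize_congr {φ : L.Formula α} {v w : α → M} (h : ∀ a, v a = w a) :
    φ.Realize v ↔ φ.Realize w := by
  rw [funext h]

open Classical in
instance finite_inr_freeVar (φ : L.Formula (α ⊕ β)) :
    Finite {b : β // Sum.inr b ∈ φ.freeVarFinset} :=
  Finite.of_injective (fun b => (⟨Sum.inr b.1, b.2⟩ : φ.freeVarFinset)) fun a b h => by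
    simpa [Subtype.ext_iff] using h

open Classical in
/-- Existential quantification over an arbitrary set of variables; only finitely many of them
occur. -/
noncomputable def exOver (φ : L.Formula (α ⊕ β)) : L.Formula α :=
  Formula.iExs {b : β // Sum.inr b ∈ φ.freeVarFinset}
    (BoundedFormula.restrictFreeVar φ (fun x : φ.freeVarFinset => match x with
      | ⟨Sum.inl a, _⟩ => Sum.inl a
      | ⟨Sum.inr b, h⟩ => Sum.inr (⟨b, h⟩ : {b : β // Sum.inr b ∈ φ.freeVarFinset})) :
      L.Formula (α ⊕ {b : β // Sum.inr b ∈ φ.freeVarFinset}))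

open Classical in
theorem realize_exOver [Nonempty M] {φ : L.Formula (α ⊕ β)} {v : α → M} :
    (exOver φ).Realize v ↔ ∃ w : β → M, φ.Realize (Sum.elim v w) := by
  have key : ∀ (w : β → M) (u : {b : β // Sum.inr b ∈ φ.freeVarFinset} → M),
      (∀ b, u b = w b) →
      (Formula.Realize (BoundedFormula.restrictFreeVar φ (fun x : φ.freeVarFinset => match x with
      | ⟨Sum.inl a, _⟩ => Sum.inl a
      | ⟨Sum.inr b, h⟩ => Sum.inr (⟨b, h⟩ : {b : β // Sum.inr b ∈ φ.freeVarFinset})) :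
      L.Formula (α ⊕ {b : β // Sum.inr b ∈ φ.freeVarFinset})) (Sum.elim v u) ↔
        φ.Realize (Sum.elim v w)) := by
    intro w u h
    refine BoundedFormula.realize_restrictFreeVar (Sum.elim v w) ?_
    rintro ⟨a | b, hab⟩
    · rfl
    · exact h ⟨b, hab⟩
  rw [exOver, Formula.realize_iExs]
  constructor
  · rintro ⟨u, hu⟩
    refine ⟨fun b => if h : Sum.inr b ∈ φ.freeVarFinset then u ⟨b, h⟩ else Classical.arbitrary M,
      (key _ u fun b => ?_).1 hu⟩
    rw [dif_pos b.2]
  · rintro ⟨w, hw⟩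
    exact ⟨fun b => w b, (key w _ fun _ => rfl).2 hw⟩

/-- A predicate on assignments `γ → M` (with `γ` arbitrary) is definable with parameters. -/
def Dfn (L : FirstOrder.Language.{u₀, v₀}) {M : Type*} [L.Structure M] {γ : Type*}
    (P : (γ → M) → Prop) : Prop :=
  ∃ φ : L.Formula (M ⊕ γ), ∀ v, φ.Realize (Sum.elim id v) ↔ P v

namespace Dfn

variable {P Q : (γ → M) → Prop}

theorem congr (h : Dfn L P) (hPQ : ∀ v, P v ↔ Q v) : Dfn L Q :=
  h.imp fun _ hφ v => (hφ v).trans (hPQ v)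

theorem of_formula {X : Type*} (φ : L.Formula (X ⊕ γ)) (c : X → M) :
    Dfn L fun v : γ → M => φ.Realize (Sum.elim c v) := by
  refine ⟨φ.relabel (Sum.map c id), fun v => ?_⟩
  rw [Formula.realize_relabel, Sum.elim_comp_map]
  simp

theorem const (p : Prop) : Dfn L fun _ : γ → M => p := by
  by_cases hp : p
  · exact ⟨⊤, fun v => by simp [hp]⟩
  · exact ⟨⊥, fun v => by simp [hp]⟩

theorem not (h : Dfn L P) : Dfn L fun v => ¬ P v := by
  obtain ⟨φ, hφ⟩ := h
  exact ⟨φ.not, fun v => by rw [Formula.realize_not, hφ]⟩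

theorem and (h : Dfn L P) (h' : Dfn L Q) : Dfn L fun v => P v ∧ Q v := by
  obtain ⟨φ, hφ⟩ := h
  obtain ⟨ψ, hψ⟩ := h'
  exact ⟨φ ⊓ ψ, fun v => by rw [Formula.realize_inf, hφ, hψ]⟩

theorem or (h : Dfn L P) (h' : Dfn L Q) : Dfn L fun v => P v ∨ Q v :=
  (h.not.and h'.not).not.congr fun v => by tauto

theorem imp (h : Dfn L P) (h' : Dfn L Q) : Dfn L fun v => P v → Q v :=
  (h.and h'.not).not.congr fun v => by tauto

/-- Substitution of variables and parameters for variables. -/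
theorem subst {γ' : Type*} (h : Dfn L P) (f : γ → M ⊕ γ') :
    Dfn L fun v : γ' → M => P fun g => Sum.elim id v (f g) := by
  obtain ⟨φ, hφ⟩ := h
  refine ⟨φ.relabel (Sum.elim Sum.inl f), fun v => ?_⟩
  refine Formula.realize_relabel.trans (Iff.trans ?_ (hφ _))
  apply iff_of_eq
  congr 1
  funext x
  cases x <;> rfl

theorem comp {γ' : Type*} (h : Dfn L P) (f : γ → γ') : Dfn L fun v : γ' → M => P (v ∘ f) :=
  h.subst fun g => Sum.inr (f g)

theorem eq (a b : M ⊕ γ) : Dfn L fun v : γ → M => Sum.elim id v a = Sum.elim id v b :=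
  ⟨Term.equal (Term.var a) (Term.var b), fun v => by simp [Formula.realize_equal]⟩

theorem exists_fin {ι : Type*} [Finite ι] {P : ι → (γ → M) → Prop} (h : ∀ i, Dfn L (P i)) :
    Dfn L fun v => ∃ i, P i v := by
  choose φ hφ using h
  exact ⟨Formula.iSup φ, fun v => by simp [hφ]⟩

theorem forall_fin {ι : Type*} [Finite ι] {P : ι → (γ → M) → Prop} (h : ∀ i, Dfn L (P i)) :
    Dfn L fun v => ∀ i, P i v :=
  (exists_fin fun i => (h i).not).not.congr fun v => by simp

theorem ball {ι : Type*} (s : Finset ι) {P : ι → (γ → M) → Prop} (h : ∀ i ∈ s, Dfn L (P i)) :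
    Dfn L fun v => ∀ i ∈ s, P i v :=
  (forall_fin (ι := s) fun i => h i i.2).congr fun v => by simp

/-- Definable predicates are closed under quantification over assignments of arbitrarily many
variables. -/
theorem ex [Nonempty M] {P : (γ ⊕ β → M) → Prop} (h : Dfn L P) :
    Dfn L fun v : γ → M => ∃ w : β → M, P (Sum.elim v w) := by
  obtain ⟨φ, hφ⟩ := h
  refine ⟨exOver (φ.relabel (Equiv.sumAssoc M γ β).symm), fun v => ?_⟩
  rw [realize_exOver]
  refine exists_congr fun w => ?_
  rw [Formula.realize_relabel, ← hφ]
  apply iff_of_eq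
  congr 1
  funext x
  rcases x with _ | _ | _ <;> rfl

theorem all [Nonempty M] {P : (γ ⊕ β → M) → Prop} (h : Dfn L P) :
    Dfn L fun v : γ → M => ∀ w : β → M, P (Sum.elim v w) :=
  h.not.ex.not.congr fun v => by simp

theorem exE [Nonempty M] {P : (γ ⊕ Unit → M) → Prop} (h : Dfn L P) :
    Dfn L fun v : γ → M => ∃ a : M, P (Sum.elim v fun _ => a) :=
  h.ex.congr fun _ => ⟨fun ⟨w, hw⟩ => ⟨w (), hw⟩, fun ⟨a, ha⟩ => ⟨fun _ => a, ha⟩⟩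

open Classical in
/-- The parameters of a definable predicate can be listed by `ℕ`. -/
theorem exists_nat [Nonempty M] (h : Dfn L P) :
    ∃ (φ : L.Formula (ℕ ⊕ γ)) (c : ℕ → M), ∀ v, φ.Realize (Sum.elim c v) ↔ P v := by
  obtain ⟨φ, hφ⟩ := h
  let S := {m : M // Sum.inl m ∈ φ.freeVarFinset}
  have : Finite S := Finite.of_injective (fun b : S => (⟨Sum.inl b.1, b.2⟩ : φ.freeVarFinset))
    fun _ _ h => Subtype.ext (Sum.inl.inj (congrArg Subtype.val h))
  obtain ⟨e, he⟩ := exists_injective_nat S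
  refine ⟨BoundedFormula.restrictFreeVar φ (fun x : φ.freeVarFinset => match x with
      | ⟨Sum.inl a, h⟩ => Sum.inl (e ⟨a, h⟩)
      | ⟨Sum.inr b, _⟩ => Sum.inr b),
    fun n => if h : ∃ s, e s = n then h.choose.1 else Classical.arbitrary M, fun v => ?_⟩
  rw [← hφ]
  refine BoundedFormula.realize_restrictFreeVar (Sum.elim id v) ?_
  rintro ⟨a | b, hab⟩
  · have hex : ∃ s, e s = e ⟨a, hab⟩ := ⟨_, rfl⟩
    simp only [Sum.elim_inl, id]
    rw [dif_pos hex, he hex.choose_spec]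
  · rfl

end Dfn

end Formulas

/-! ### Structures generated by Henkin sets -/

section TermModel

variable {L : FirstOrder.Language.{u, u}} {X : Type u}

/-- Compactness for sets of formulas in arbitrarily many free variables. -/
theorem exists_realize_of_finite {L : FirstOrder.Language.{u₀, v₀}} {X : Type u₁}
    (G : Set (L.Formula X))
    (hfin : ∀ θ : Finset (L.Formula X), (∀ φ ∈ θ, φ ∈ G) →
      ∃ (M : Type v₁) (_ : Nonempty M) (_ : L.Structure M) (v : X → M), ∀ φ ∈ θ, φ.Realize v) :
    ∃ (K : Type (max u₀ v₀ u₁)) (_ : Nonempty K) (_ : L.Structure K) (x : X → K),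
      ∀ φ ∈ G, φ.Realize x := by
  classical
  let Γ : L[[X]].Theory := Formula.equivSentence '' G
  have hΓ : Γ.IsSatisfiable := by
    rw [Theory.isSatisfiable_iff_isFinitelySatisfiable]
    intro T₀ hT₀
    obtain ⟨M, hM, hS, v, hv⟩ := hfin (T₀.image Formula.equivSentence.symm) (by
      intro φ hφ
      obtain ⟨σ, hσ, rfl⟩ := Finset.mem_image.1 hφ
      obtain ⟨ψ, hψ, rfl⟩ := hT₀ hσ
      simpa using hψ)
    let := constantsOn.structure v
    have : M ⊨ (T₀ : L[[X]].Theory) := by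
      refine Theory.model_iff _ |>.2 fun σ hσ => ?_
      rw [← Formula.realize_equivSentence_symm]
      exact hv _ (Finset.mem_image_of_mem _ hσ)
    exact Theory.Model.isSatisfiable M
  obtain ⟨K⟩ := hΓ
  let : L.Structure K := (L.lhomWithConstants X).reduct K
  have : (L.lhomWithConstants X).IsExpansionOn K := LHom.isExpansionOn_reduct _ _
  refine ⟨K, inferInstance, inferInstance, fun a => (L.con a : K), fun φ hφ => ?_⟩
  rw [← Formula.realize_equivSentence]
  exact Theory.realize_sentence_of_mem Γ (Set.mem_image_of_mem _ hφ)

/-- A set of formulas in the variables `X` that is finitely satisfiable, complete and has Henkin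
witnesses is the type of a surjective enumeration of some structure. -/
theorem exists_term_model (G : Set (L.Formula X))
    (hfin : ∀ θ : Finset (L.Formula X), (∀ φ ∈ θ, φ ∈ G) →
      ∃ (M : Type u) (_ : Nonempty M) (_ : L.Structure M) (v : X → M), ∀ φ ∈ θ, φ.Realize v)
    (hcomp : ∀ φ : L.Formula X, φ ∈ G ∨ φ.not ∈ G)
    (hH : ∀ φ : L.Formula (X ⊕ Unit), φ.iExs Unit ∈ G →
      ∃ x : X, φ.relabel (Sum.elim id fun _ => x) ∈ G) :
    ∃ (N : Type u) (_ : Nonempty N) (_ : L.Structure N) (v : X → N), Function.Surjective v ∧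
      ∀ φ, φ ∈ G ↔ φ.Realize v := by
  classical
  obtain ⟨K, hKne, hKstr, x, hx⟩ := exists_realize_of_finite G hfin
  have hiff : ∀ φ, φ ∈ G ↔ φ.Realize x := fun φ =>
    ⟨hx φ, fun h => (hcomp φ).resolve_right fun hn => (Formula.realize_not.1 (hx _ hn)) h⟩
  have hwit : ∀ φ : L.Formula (X ⊕ Unit), (∃ a : K, φ.Realize (Sum.elim x fun _ => a)) →
      ∃ y : X, φ.Realize (Sum.elim x fun _ => x y) := by
    rintro φ ⟨a, ha⟩
    obtain ⟨y, hy⟩ := hH φ ((hiff _).2 (Formula.realize_iExs.2 ⟨fun _ => a, ha⟩))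
    refine ⟨y, ?_⟩
    have := hx _ hy
    rw [Formula.realize_relabel] at this
    convert this using 1
    funext z
    rcases z with _ | _ <;> rfl
  obtain ⟨hX, -⟩ := hwit ⊤ ⟨Classical.arbitrary K, by simp⟩
  -- the values of the variables form an elementary substructure, by the Tarski–Vaught test
  let S : L.Substructure K :=
    { carrier := Set.range x
      fun_mem := by
        intro n f a ha
        choose b hb using ha
        obtain ⟨y, hy⟩ := hwit (Term.equal ((Term.func f fun i => Term.var (Sum.inl (b i))))
          (Term.var (Sum.inr ()))) ⟨Structure.funMap f a, by
            simp [Formula.realize_equal, hb]⟩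
        refine ⟨y, ?_⟩
        simpa [Formula.realize_equal, hb] using hy.symm }
  have hS : S.IsElementary := by
    refine S.isElementary_of_exists fun n φ a k hk => ?_
    have ha : ∀ i, ∃ y, x y = a i := fun i => (a i).2
    choose b hb using ha
    have e : ∀ k' : K, (φ.toFormula.relabel (Sum.elim Empty.elim
        (fun i : Fin (n + 1) => Fin.lastCases (Sum.inr ()) (fun i => Sum.inl (b i)) i)) :
        L.Formula (X ⊕ Unit)).Realize (Sum.elim x fun _ => k') ↔
        φ.Realize default (Fin.snoc ((↑) ∘ a) k' : _ → K) := by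
      intro k'
      rw [Formula.realize_relabel, BoundedFormula.realize_toFormula]
      apply iff_of_eq
      congr 1
      · funext i; exact i.elim
      · funext i
        refine Fin.lastCases ?_ (fun i => ?_) i
        · simp
        · simp [hb]
    obtain ⟨y, hy⟩ := hwit _ ⟨k, (e k).2 hk⟩
    exact ⟨⟨x y, y, rfl⟩, (e _).1 hy⟩
  refine ⟨S, ⟨⟨x hX, hX, rfl⟩⟩, inferInstance, fun y => ⟨x y, y, rfl⟩, ?_, fun φ => ?_⟩
  · rintro ⟨_, y, rfl⟩
    exact ⟨y, rfl⟩
  · rw [hiff]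
    exact (ElementaryEmbedding.map_formula (ElementarySubstructure.subtype ⟨S, hS⟩) φ
      (fun y => ⟨x y, y, rfl⟩))

end TermModel

/-! ### Cardinal arithmetic -/

section Cardinals

open Cardinal

theorem exists_surjective_of_mk_le {A B : Type u} [Nonempty A] (h : #A ≤ #B) :
    ∃ f : B → A, Function.Surjective f := by
  obtain ⟨e⟩ := h
  exact ⟨Function.invFun e, Function.invFun_surjective e.injective⟩

theorem mk_Iio_ord_toType_lt {κ : Cardinal.{u}} (i : κ.ord.ToType) : #(Set.Iio i) < κ := by
  simpa using mk_Iio_lt i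

theorem exists_forall_lt_of_isRegular {κ : Cardinal.{u}} (hκ : κ.IsRegular) {Y : Type u}
    (hY : #Y < κ) (g : Y → κ.ord.ToType) : ∃ i, ∀ y, g y < i := by
  by_contra! hcon
  have h1 : #(⋃ y, Set.Iic (g y)) < κ := by
    rw [card_iUnion_lt_iff_forall_of_isRegular hκ hY]
    intro y
    rw [← Set.Iio_insert]
    exact (mk_insert_le).trans_lt (add_lt_of_lt hκ.aleph0_le (mk_Iio_ord_toType_lt _)
      (one_lt_aleph0.trans_le hκ.aleph0_le))
  have h2 : (⋃ y, Set.Iic (g y)) = Set.univ :=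
    Set.eq_univ_of_forall fun i => by simpa using hcon i
  rw [h2, mk_univ, mk_ord_toType] at h1
  exact h1.false

theorem exists_notMem_of_finsets {κ : Cardinal.{u}} (hκ : ℵ₀ < κ) {I X : Type u} (hI : #I < κ)
    (hX : κ ≤ #X) (f : I → Finset X) : ∃ x, ∀ i, x ∉ f i := by
  by_contra! hcon
  have h2 : (⋃ i, (f i : Set X)) = Set.univ :=
    Set.eq_univ_of_forall fun i => by simpa using hcon i
  have h1 : #(⋃ i, (f i : Set X)) < κ := by
    refine (mk_iUnion_le_sum_mk.trans (sum_le_sum _ (fun _ => ℵ₀) fun i =>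
      (mk_le_aleph0 (α := (f i : Set X))))).trans_lt ?_
    rw [sum_const, lift_id, lift_aleph0]
    exact mul_lt_of_lt hκ.le hI hκ
  rw [h2, mk_univ] at h1
  exact absurd h1 hX.not_gt

theorem mk_formula_le {L : FirstOrder.Language.{u, u}} {κ : Cardinal.{u}} (hκ : ℵ₀ ≤ κ)
    (hL : L.card ≤ κ) {Y : Type u} (hY : #Y ≤ κ) : #(L.Formula Y) ≤ κ := by
  have h : #(L.Formula Y) ≤ #(Σ n, L.BoundedFormula Y n) :=
    mk_le_of_injective (f := fun φ => (⟨0, φ⟩ : Σ n, L.BoundedFormula Y n))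
      fun φ ψ h => by simpa using h
  refine h.trans (BoundedFormula.card_le.trans (max_le hκ ?_))
  rw [lift_id, lift_id]
  exact add_le_of_le hκ hY hL

theorem mk_sum_le_of_le {κ : Cardinal.{u}} (hκ : ℵ₀ ≤ κ) {A B : Type u} (hA : #A ≤ κ)
    (hB : #B ≤ κ) : #(A ⊕ B) ≤ κ := by
  rw [mk_sum, lift_id, lift_id]
  exact add_le_of_le hκ hA hB

theorem mk_prod_le_of_le {κ : Cardinal.{u}} (hκ : ℵ₀ ≤ κ) {A B : Type u} (hA : #A ≤ κ)
    (hB : #B ≤ κ) : #(A × B) ≤ κ := by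
  rw [mk_prod, lift_id, lift_id]
  exact mul_le_of_le hκ hA hB

end Cardinals

/-! ### Cuts and the separation of their sides by definable sets -/

section Cuts

variable {L : FirstOrder.Language.{u, u}} {J X Y Z : Type u} {M : Type u} [L.Structure M]

/-- A pair of families `a`, `b` (the left and right side of a cut) together with a binary relation
`R`, given by a formula with parameters `c`, that is to order them. -/
structure Cut (L : FirstOrder.Language.{u, u}) (J X : Type u) where
  /-- the formula for the order relation -/
  R : L.Formula (ℕ ⊕ Fin 2)
  /-- its parameters -/
  c : ℕ → X
  /-- the left side -/
  a : J → X
  /-- the right side -/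
  b : J → X

namespace Cut

/-- The image of a cut under a map of its parameters. -/
def map (f : X → Y) (k : Cut L J X) : Cut L J Y :=
  ⟨k.R, f ∘ k.c, f ∘ k.a, f ∘ k.b⟩

theorem map_map (f : X → Y) (g : Y → Z) (k : Cut L J X) : (k.map f).map g = k.map (g ∘ f) := rfl

/-- The relation of a cut in a structure. -/
def rel (k : Cut L J M) (x y : M) : Prop :=
  k.R.Realize (Sum.elim k.c ![x, y])

/-- `D` is closed downwards, contains `a i` and omits `b j`. -/
def Separates (k : Cut L J M) (D : M → Prop) (i j : J) : Prop :=
  (∀ x y, k.rel x y → D y → D x) ∧ D (k.a i) ∧ ¬ D (k.b j)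

/-- No definable set separates the two sides of the cut. In particular no element of `M` fills
the cut. -/
def Unseparated (k : Cut L J M) : Prop :=
  ∀ D : M → Prop, Dfn L (fun v : Unit → M => D (v ())) → ∃ i j, ¬ k.Separates D i j

/-- The formula saying that `δ` separates `a i` from `b j`. -/
noncomputable def sepForm (k : Cut L J Y) (δ : L.Formula (Y ⊕ Unit)) (i j : J) : L.Formula Y :=
  (Formula.iAlls (Fin 2) ((k.R.relabel (Sum.map k.c id)).imp
    ((δ.relabel (Sum.map id fun _ => 1)).imp (δ.relabel (Sum.map id fun _ => 0))))) ⊓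
  (δ.relabel (Sum.elim id fun _ => k.a i) ⊓ (δ.relabel (Sum.elim id fun _ => k.b j)).not)

theorem realize_sepForm {k : Cut L J Y} {δ : L.Formula (Y ⊕ Unit)} {i j : J} {w : Y → M} :
    (k.sepForm δ i j).Realize w ↔
      (k.map w).Separates (fun x => δ.Realize (Sum.elim w fun _ => x)) i j := by
  have h1 : ∀ (u : Fin 2 → M) (t : Fin 2), (δ.relabel (Sum.map id fun _ => t)).Realize
      (Sum.elim w u) ↔ δ.Realize (Sum.elim w fun _ => u t) := by
    intro u t
    rw [Formula.realize_relabel, Sum.elim_comp_map]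
    rfl
  have h2 : ∀ (u : Fin 2 → M), (k.R.relabel (Sum.map k.c id)).Realize
      (Sum.elim w u) ↔ (k.map w).rel (u 0) (u 1) := by
    intro u
    rw [Formula.realize_relabel, Sum.elim_comp_map, rel]
    have : u = ![u 0, u 1] := by
      funext i; fin_cases i <;> rfl
    rw [Function.comp_id, ← this]
    rfl
  have h3 : ∀ y : Y, (δ.relabel (Sum.elim id fun _ => y)).Realize w ↔
      δ.Realize (Sum.elim w fun _ => w y) := by
    intro y
    rw [Formula.realize_relabel]
    apply iff_of_eq
    congr 1
    funext x
    rcases x with _ | _ <;> rfl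
  rw [sepForm, Formula.realize_inf, Formula.realize_inf, Formula.realize_not,
    Formula.realize_iAlls, h3, h3, Separates]
  refine and_congr ?_ Iff.rfl
  constructor
  · intro h x y
    have := h ![x, y]
    rw [Formula.realize_imp, Formula.realize_imp] at this
    exact fun hr hy => (h1 ![x, y] 0).1 (this ((h2 ![x, y]).2 hr) ((h1 ![x, y] 1).2 hy))
  · intro h u
    rw [Formula.realize_imp, Formula.realize_imp]
    exact fun hr hy => (h1 u 0).2 (h _ _ ((h2 u).1 hr) ((h1 u 1).1 hy))

end Cut

end Cuts

/-! ### Elementary extensions that keep cuts unseparated -/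

section Extension

open Cardinal

variable {L : FirstOrder.Language.{u, u}} {M : Type u} [L.Structure M] {A J Sp H : Type u}

/-- The complement of a proper ideal of sets. -/
structure IsPositive (S : Set (Set A)) : Prop where
  univ_mem : Set.univ ∈ S
  empty_notMem : ∅ ∉ S
  mono : ∀ {s t}, s ⊆ t → s ∈ S → t ∈ S
  prime : ∀ {s t}, s ∪ t ∈ S → s ∈ S ∨ t ∈ S

/-- The assignments of the special variables that extend, by some assignment of the Henkin
variables, to a solution of `θ`. -/
def sol (θ : Set (L.Formula (M ⊕ (Sp ⊕ H)))) : Set (Sp → M) :=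
  {s | ∃ t : H → M, ∀ φ ∈ θ, φ.Realize (Sum.elim id (Sum.elim s t))}

/-- A set of formulas is good for a family `S` of positive sets if the solution set of each finite
part is positive. -/
def Good (S : Set (Set (Sp → M))) (q : Set (L.Formula (M ⊕ (Sp ⊕ H)))) : Prop :=
  ∀ θ : Finset (L.Formula (M ⊕ (Sp ⊕ H))), (θ : Set (L.Formula (M ⊕ (Sp ⊕ H)))) ⊆ q →
    sol (θ : Set (L.Formula (M ⊕ (Sp ⊕ H)))) ∈ S

variable {S : Set (Set (Sp → M))} {q : Set (L.Formula (M ⊕ (Sp ⊕ H)))}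

theorem sol_anti {θ θ' : Set (L.Formula (M ⊕ (Sp ⊕ H)))} (h : θ ⊆ θ') : sol θ' ⊆ sol θ :=
  fun _ ⟨t, ht⟩ => ⟨t, fun φ hφ => ht φ (h hφ)⟩

theorem Good.insert_or_insert_not (hS : IsPositive S) (hq : Good S q)
    (φ : L.Formula (M ⊕ (Sp ⊕ H))) : Good S (insert φ q) ∨ Good S (insert φ.not q) := by
  classical
  by_contra! hcon
  simp only [Good, not_forall] at hcon
  obtain ⟨⟨θ₁, h₁, h₁'⟩, θ₂, h₂, h₂'⟩ := hcon
  have hθ : sol ((θ₁.erase φ ∪ θ₂.erase φ.not : Finset _) : Set (L.Formula (M ⊕ (Sp ⊕ H)))) ∈ S := by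
    refine hq _ ?_
    intro ψ hψ
    simp only [Finset.coe_union, Finset.coe_erase, Set.mem_union, Set.mem_sdiff,
      Set.mem_singleton_iff] at hψ
    rcases hψ with h | h
    · exact (h₁ h.1).resolve_left h.2
    · exact (h₂ h.1).resolve_left h.2
  have hsub : sol ((θ₁.erase φ ∪ θ₂.erase φ.not : Finset _) : Set (L.Formula (M ⊕ (Sp ⊕ H)))) ⊆
      sol (θ₁ : Set (L.Formula (M ⊕ (Sp ⊕ H)))) ∪ sol (θ₂ : Set (L.Formula (M ⊕ (Sp ⊕ H)))) := by
    rintro s ⟨t, ht⟩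
    by_cases hφ : φ.Realize (Sum.elim id (Sum.elim s t))
    · refine Or.inl ⟨t, fun ψ hψ => ?_⟩
      by_cases h : ψ = φ
      · rwa [h]
      · exact ht _ (Finset.mem_coe.2 (by simp [h, Finset.mem_coe.1 hψ]))
    · refine Or.inr ⟨t, fun ψ hψ => ?_⟩
      by_cases h : ψ = φ.not
      · rwa [h, Formula.realize_not]
      · exact ht _ (Finset.mem_coe.2 (by simp [h, Finset.mem_coe.1 hψ]))
  rcases hS.prime (hS.mono hsub hθ) with h | h
  exacts [h₁' h, h₂' h]

theorem Good.insert_witness (hS : IsPositive S) (hq : Good S q)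
    {φ : L.Formula ((M ⊕ (Sp ⊕ H)) ⊕ Unit)} (hφ : φ.iExs Unit ∈ q) {h : H}
    (hhq : ∀ ψ ∈ q, Sum.inr (Sum.inr h) ∉ fv ψ)
    (hhφ : Sum.inl (Sum.inr (Sum.inr h)) ∉ fv φ) :
    Good S (insert (φ.relabel (Sum.elim id fun _ => Sum.inr (Sum.inr h))) q) := by
  classical
  intro θ hθ
  set ψ := φ.relabel (Sum.elim id fun _ => (Sum.inr (Sum.inr h) : M ⊕ (Sp ⊕ H))) with hψ
  have h1 : sol ((insert (φ.iExs Unit) (θ.erase ψ) : Finset _) : Set (L.Formula (M ⊕ (Sp ⊕ H)))) ∈ S := by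
    refine hq _ ?_
    intro χ hχ
    simp only [Finset.coe_insert, Finset.coe_erase, Set.mem_insert_iff, Set.mem_sdiff,
      Set.mem_singleton_iff] at hχ
    rcases hχ with rfl | hχ
    · exact hφ
    · exact (hθ hχ.1).resolve_left hχ.2
  refine hS.mono ?_ h1
  rintro s ⟨t, ht⟩
  have h2 := ht (φ.iExs Unit) (by simp)
  rw [Formula.realize_iExs] at h2
  obtain ⟨a, ha⟩ := h2
  refine ⟨Function.update t h (a ()), fun χ hχ => ?_⟩
  have hupd : ∀ x : M ⊕ (Sp ⊕ H), x ≠ Sum.inr (Sum.inr h) →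
      Sum.elim id (Sum.elim s (Function.update t h (a ()))) x =
        Sum.elim (id : M → M) (Sum.elim s t) x := by
    rintro (x | x | x) hx
    · rfl
    · rfl
    · have : x ≠ h := fun e => hx (by rw [e])
      exact Function.update_of_ne this _ _
  by_cases hχψ : χ = ψ
  · rw [hχψ, hψ, Formula.realize_relabel]
    refine (realize_congr_of_eqOn ?_).1 ha
    rintro (x | x) hx
    · exact (hupd x fun e => hhφ (e ▸ hx)).symm
    · exact (Function.update_self h (a ()) t).symm
  · have hχq : χ ∈ q := (hθ hχ).resolve_left hχψ
    refine (realize_congr_of_eqOn ?_).1 (ht χ (Finset.mem_coe.2 (by simp [hχψ, Finset.mem_coe.1 hχ])))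
    intro x hx
    exact (hupd x fun e => hhq χ hχq (e ▸ hx)).symm

/-- The extension theorem: if every small good set of formulas can be enlarged so as to violate any
given separation of any given cut, then `M` has an elementary extension of cardinality at most `κ`,
with an assignment of the special variables in it, in which the formulas of full measure hold and
the cuts are unseparated. -/
theorem exists_extension {κ : Cardinal.{u}} (hκ : κ.IsRegular) (hκ' : ℵ₀ < κ) (hL : L.card ≤ κ)
    [Nonempty M] (hM : #M ≤ κ) (hSp : #Sp ≤ κ) (hH : #H = κ) (hS : IsPositive S)
    (K : Set (Cut L J (M ⊕ Sp))) (hKcard : #K ≤ κ)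
    (hK : ∀ k ∈ K, ∀ (δ : L.Formula ((M ⊕ (Sp ⊕ H)) ⊕ Unit)) (q : Set (L.Formula (M ⊕ (Sp ⊕ H)))),
      #q < κ → Good S q →
        ∃ i j, Good S (insert ((k.map (Sum.map id Sum.inl)).sepForm δ i j).not q)) :
    ∃ (N : Type u) (_ : L.Structure N) (f : M ↪ₑ[L] N) (s : Sp → N), #N ≤ κ ∧
      (∀ φ : L.Formula (M ⊕ Sp), {s : Sp → M | ¬ φ.Realize (Sum.elim id s)} ∉ S →
        φ.Realize (Sum.elim f s)) ∧
      ∀ k ∈ K, (k.map (Sum.elim f s)).Unseparated := by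
  classical
  have hκ0 := hκ.aleph0_le
  have : Nonempty H := by rw [← mk_ne_zero_iff, hH]; exact (aleph0_pos.trans hκ').ne'
  let Φ := L.Formula (M ⊕ (Sp ⊕ H))
  let Φ' := L.Formula ((M ⊕ (Sp ⊕ H)) ⊕ Unit)
  have hX : #(M ⊕ (Sp ⊕ H)) ≤ κ :=
    mk_sum_le_of_le hκ0 hM (mk_sum_le_of_le hκ0 hSp hH.le)
  have hΦ : #Φ ≤ κ := mk_formula_le hκ0 hL hX
  have hΦ' : #Φ' ≤ κ :=
    mk_formula_le hκ0 hL (by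
      rw [mk_sum, lift_uzero, mk_unit, lift_one]
      exact add_le_of_le hκ0 hX (one_lt_aleph0.trans hκ').le)
  -- the requirements: completeness, Henkin witnesses, and violated separations of the cuts
  let Req := Φ ⊕ (Φ' ⊕ (K × Φ'))
  have hReq : #Req ≤ #κ.ord.ToType := by
    rw [mk_ord_toType]
    exact mk_sum_le_of_le hκ0 hΦ (mk_sum_le_of_le hκ0 hΦ' (mk_prod_le_of_le hκ0 hKcard hΦ'))
  have : Nonempty Req := ⟨Sum.inl (⊥ : Φ)⟩
  obtain ⟨e, he⟩ := exists_surjective_of_mk_le hReq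
  let P := {q : Set Φ // #q < κ ∧ Good S q}
  let D' : Req → P → Prop := fun r q => match r with
    | Sum.inl φ => φ ∈ q.1 ∨ φ.not ∈ q.1
    | Sum.inr (Sum.inl φ) => (φ.iExs Unit).not ∈ q.1 ∨ ∃ x, φ.relabel (Sum.elim id fun _ => x) ∈ q.1
    | Sum.inr (Sum.inr ⟨k, δ⟩) =>
        ∃ i j, ((k.1.map (Sum.map id Sum.inl)).sepForm δ i j).not ∈ q.1
  have hins : ∀ (q : P) (φ : Φ), Good S (insert φ q.1) → ∃ q' : P, q ≤ q' ∧ φ ∈ q'.1 :=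
    fun q φ h => ⟨⟨insert φ q.1, mk_insert_le.trans_lt (add_lt_of_lt hκ0 q.2.1
      (one_lt_aleph0.trans hκ')), h⟩, Set.subset_insert _ _, Set.mem_insert _ _⟩
  have hD : ∀ r (q : P), ∃ q' : P, q ≤ q' ∧ D' r q' := by
    rintro (φ | φ | ⟨k, δ⟩) q
    · rcases q.2.2.insert_or_insert_not hS φ with h | h
      · exact (hins q _ h).imp fun q' h => ⟨h.1, Or.inl h.2⟩
      · exact (hins q _ h).imp fun q' h => ⟨h.1, Or.inr h.2⟩
    · rcases q.2.2.insert_or_insert_not hS (φ.iExs Unit) with h | h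
      · obtain ⟨q', hq', hφ⟩ := hins q _ h
        -- a Henkin variable that does not occur yet
        obtain ⟨x, hx⟩ := exists_notMem_of_finsets hκ' (I := Option q'.1) (X := H)
          (by rw [mk_option]; exact add_lt_of_lt hκ0 q'.2.1 (one_lt_aleph0.trans hκ')) hH.ge
          (fun o => match o with
            | none => (fv φ).preimage (fun h : H => Sum.inl (Sum.inr (Sum.inr h)))
                (fun a _ b _ h => by simpa using h)
            | some ψ => (fv ψ.1).preimage (fun h : H => Sum.inr (Sum.inr h))
                (fun a _ b _ h => by simpa using h))
        obtain ⟨q'', hq'', h''⟩ := hins q' _ (q'.2.2.insert_witness hS hφ (h := x)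
          (fun ψ hψ hx' => hx (some ⟨ψ, hψ⟩) (Finset.mem_preimage.2 hx'))
          (fun hx' => hx none (Finset.mem_preimage.2 hx')))
        exact ⟨q'', hq'.trans hq'', Or.inr ⟨_, h''⟩⟩
      · exact (hins q _ h).imp fun q' h => ⟨h.1, Or.inl h.2⟩
    · obtain ⟨i, j, h⟩ := hK k.1 k.2 δ q.1 q.2.1 q.2.2
      exact (hins q _ h).imp fun q' h => ⟨h.1, i, j, h.2⟩
  have hub : ∀ (i : κ.ord.ToType) (f : Set.Iio i → P), Monotone f → ∃ p, ∀ j, f j ≤ p := by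
    intro i f hf
    refine ⟨⟨⋃ j, (f j).1, (card_iUnion_lt_iff_forall_of_isRegular hκ
      (mk_Iio_ord_toType_lt i)).2 fun j => (f j).2.1, fun θ hθ => ?_⟩,
      fun j => Set.subset_iUnion (fun j => (f j).1) j⟩
    rcases isEmpty_or_nonempty (Set.Iio i) with hi | hi
    · have : θ = ∅ := by
        rw [← Finset.coe_eq_empty, ← Set.subset_empty_iff]
        simpa using hθ
      rw [this]
      convert hS.univ_mem
      refine Set.eq_univ_of_forall fun s => ⟨Classical.arbitrary _, by simp⟩
    · obtain ⟨j, hj⟩ := Directed.exists_mem_subset_of_finset_subset_biUnion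
        (f := fun j => (f j).1) (hf.directed_le) hθ
      exact (f j).2.2 θ hj
  obtain ⟨f, hf, hfD⟩ := exists_monotone_meeting hub (fun i => D' (e i)) (fun i => hD (e i))
  have : Nonempty κ.ord.ToType := by
    rw [← mk_ne_zero_iff, mk_ord_toType]; exact (aleph0_pos.trans hκ').ne'
  let G : Set Φ := ⋃ i, (f i).1
  have hG : Good S G := by
    intro θ hθ
    obtain ⟨j, hj⟩ := Directed.exists_mem_subset_of_finset_subset_biUnion
        (f := fun j => (f j).1) (hf.directed_le) hθ
    exact (f j).2.2 θ hj
  have hfG : ∀ i, (f i).1 ⊆ G := fun i => Set.subset_iUnion (fun i => (f i).1) i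
  -- finite parts of `G` are satisfied in `M`, the elements of `M` being assigned to themselves
  have hsat : ∀ θ : Finset Φ, (θ : Set Φ) ⊆ G →
      ∃ v : M ⊕ (Sp ⊕ H) → M, (∀ m, v (Sum.inl m) = m) ∧ ∀ φ ∈ θ, φ.Realize v := by
    intro θ hθ
    have hne : (sol (θ : Set Φ)).Nonempty := by
      rw [Set.nonempty_iff_ne_empty]
      intro h
      exact hS.empty_notMem (h ▸ hG θ hθ)
    obtain ⟨s, t, ht⟩ := hne
    exact ⟨_, fun _ => rfl, ht⟩
  have hcomp : ∀ φ : Φ, φ ∈ G ∨ φ.not ∈ G := by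
    intro φ
    obtain ⟨i, hi⟩ := he (Sum.inl φ)
    have := hfD i
    rw [hi] at this
    exact this.imp (fun h => hfG i h) (fun h => hfG i h)
  have hcons : ∀ φ : Φ, φ ∈ G → φ.not ∉ G := by
    intro φ h1 h2
    obtain ⟨v, -, hv⟩ := hsat {φ, φ.not} (by
      intro x hx
      simp only [Finset.coe_insert, Finset.coe_singleton, Set.mem_insert_iff,
        Set.mem_singleton_iff] at hx
      rcases hx with rfl | rfl <;> assumption)
    exact (Formula.realize_not.1 (hv φ.not (by simp))) (hv φ (by simp))
  obtain ⟨N, hNne, hNstr, v, hv, hvG⟩ := exists_term_model G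
    (fun θ hθ => by
      obtain ⟨v, -, hv⟩ := hsat θ hθ
      exact ⟨M, inferInstance, inferInstance, v, hv⟩)
    hcomp
    (fun φ hφ => by
      obtain ⟨i, hi⟩ := he (Sum.inr (Sum.inl φ))
      have := hfD i
      rw [hi] at this
      rcases this with h | ⟨x, h⟩
      · exact absurd (hfG i h) (hcons _ hφ)
      · exact ⟨x, hfG i h⟩)
  -- in particular `G` contains the elementary diagram of `M`
  have hself : ∀ φ : Φ, (∀ v : M ⊕ (Sp ⊕ H) → M, (∀ m, v (Sum.inl m) = m) → φ.Realize v) →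
      φ ∈ G := by
    intro φ h
    refine (hcomp φ).resolve_right fun hn => ?_
    obtain ⟨v, hv, hv'⟩ := hsat {φ.not} (by simpa using hn)
    exact (Formula.realize_not.1 (hv' φ.not (by simp))) (h v hv)
  let f' : M ↪ₑ[L] N :=
    { toFun := fun m => v (Sum.inl m)
      map_formula' := by
        have key : ∀ (n : ℕ) (φ : L.Formula (Fin n)) (x : Fin n → M), φ.Realize x →
            φ.Realize ((fun m => v (Sum.inl m)) ∘ x) := by
          intro n φ x hx
          have : φ.relabel (fun i => (Sum.inl (x i) : M ⊕ (Sp ⊕ H))) ∈ G := by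
            refine hself _ fun w hw => ?_
            rw [Formula.realize_relabel]
            convert hx using 1
            funext i
            exact hw _
          rw [hvG, Formula.realize_relabel] at this
          exact this
        intro n φ x
        refine ⟨fun h => ?_, key n φ x⟩
        by_contra hx
        exact (Formula.realize_not.1 (key n φ.not x (Formula.realize_not.2 hx))) h }
  refine ⟨N, hNstr, f', fun s => v (Sum.inr (Sum.inl s)),
    (mk_le_of_surjective hv).trans hX, fun φ hφ => ?_, fun k hk D hDd => ?_⟩
  · have : φ.relabel (Sum.map id Sum.inl : M ⊕ Sp → M ⊕ (Sp ⊕ H)) ∈ G := by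
      refine (hcomp _).resolve_right fun hn => hφ ?_
      refine hS.mono ?_ (hG {(φ.relabel (Sum.map id Sum.inl)).not} (by simpa using hn))
      rintro s ⟨t, ht⟩ hs
      refine (Formula.realize_not.1 (ht _ (Finset.mem_coe.2 (Finset.mem_singleton_self _)))) ?_
      rw [Formula.realize_relabel, Sum.elim_comp_map]
      exact hs
    rw [hvG, Formula.realize_relabel] at this
    convert this using 1
    funext x
    rcases x with _ | _ <;> rfl
  · obtain ⟨δ, hδ⟩ := hDd
    obtain ⟨σ, hσ⟩ := hv.hasRightInverse
    obtain ⟨i, hi⟩ := he (Sum.inr (Sum.inr ⟨⟨k, hk⟩, δ.relabel (Sum.map σ id)⟩))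
    have := hfD i
    rw [hi] at this
    obtain ⟨i', j', h⟩ := this
    refine ⟨i', j', ?_⟩
    have h' := (hvG _).1 (hfG i h)
    rw [Formula.realize_not, Cut.realize_sepForm] at h'
    have e1 : (k.map (Sum.map id Sum.inl)).map v =
        k.map (Sum.elim f' fun s => v (Sum.inr (Sum.inl s))) := by
      rw [Cut.map_map]
      congr 1
      funext x
      rcases x with _ | _ <;> rfl
    have e2 : (fun x => (δ.relabel (Sum.map σ id)).Realize (Sum.elim v fun _ => x)) = D := by
      funext x
      rw [Formula.realize_relabel, Sum.elim_comp_map, hσ.comp_eq_id]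
      exact propext (hδ _)
    rw [e1, e2] at h'
    exact h'

end Extension

/-! ### Keeping a cut unseparated -/

section Keep

open Cardinal

variable {L : FirstOrder.Language.{u, u}} {M : Type u} [L.Structure M] {J Sp H : Type u}

/-- The left side of the cut increases, the right side decreases, and the left side is strictly
below the right side. -/
def Cut.IsNested [LT J] (k : Cut L J M) : Prop :=
  (∀ i i', i < i' → k.rel (k.a i) (k.a i')) ∧ (∀ j j', j < j' → k.rel (k.b j') (k.b j)) ∧
    ∀ i j, k.rel (k.a i) (k.b j) ∧ k.a i ≠ k.b j

theorem Cut.IsNested.separates_mono [LinearOrder J] {k : Cut L J M} (hk : k.IsNested)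
    {D : M → Prop} {i i' j j' : J} (hi : i ≤ i') (hj : j ≤ j') (h : k.Separates D i' j') :
    k.Separates D i j := by
  refine ⟨h.1, ?_, ?_⟩
  · rcases hi.lt_or_eq with hi | rfl
    · exact h.1 _ _ (hk.1 _ _ hi) h.2.1
    · exact h.2.1
  · rcases hj.lt_or_eq with hj | rfl
    · exact fun hD => h.2.2 (h.1 _ _ (hk.2.1 _ _ hj) hD)
    · exact h.2.2

/-- A definable set of assignments with positive projection retains a positive projection when it
is cut down so that a given definable family of sets fails to separate the cut `k` at suitable
indices. -/
def KeepsCut (H : Type u) (S : Set (Set (Sp → M))) (k : Cut L J M) : Prop :=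
  ∀ (A : (Sp ⊕ H → M) → Prop) (Δ : ((Sp ⊕ H) ⊕ Unit → M) → Prop), Dfn L A → Dfn L Δ →
    {s | ∃ t, A (Sum.elim s t)} ∈ S →
    ∃ i j, {s | ∃ t, A (Sum.elim s t) ∧
      ¬ k.Separates (fun x => Δ (Sum.elim (Sum.elim s t) fun _ => x)) i j} ∈ S

theorem Cut.realize_sepForm_inl {k : Cut L J M} {δ : L.Formula ((M ⊕ (Sp ⊕ H)) ⊕ Unit)} {i j : J}
    {s : Sp → M} {t : H → M} :
    (((k.map Sum.inl).map (Sum.map id Sum.inl)).sepForm δ i j).Realize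
      (Sum.elim id (Sum.elim s t)) ↔ k.Separates
        (fun x => δ.Realize (Sum.elim (Sum.elim id (Sum.elim s t)) fun _ => x)) i j := by
  rw [Cut.realize_sepForm]
  rfl

theorem KeepsCut.exists_good_insert {κ : Cardinal.{u}} (hκ : κ.IsRegular) (hκ' : ℵ₀ < κ)
    {S : Set (Set (Sp → M))} (hS : IsPositive S) {k : Cut L κ.ord.ToType M} (hk : k.IsNested)
    (hkS : KeepsCut H S k) (δ : L.Formula ((M ⊕ (Sp ⊕ H)) ⊕ Unit))
    (q : Set (L.Formula (M ⊕ (Sp ⊕ H)))) (hqcard : #q < κ) (hq : Good S q) :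
    ∃ i j, Good S (insert (((k.map Sum.inl).map (Sum.map id Sum.inl)).sepForm δ i j).not q) := by
  classical
  by_contra! hcon
  set σ : κ.ord.ToType → κ.ord.ToType → L.Formula (M ⊕ (Sp ⊕ H)) := fun i j =>
    (((k.map Sum.inl).map (Sum.map id Sum.inl)).sepForm δ i j).not with hσ
  let tofin : List q → Finset (L.Formula (M ⊕ (Sp ⊕ H))) := fun l =>
    (l.map Subtype.val).toFinset
  have htofin : ∀ l, (tofin l : Set (L.Formula (M ⊕ (Sp ⊕ H)))) ⊆ q := by
    intro l φ hφ
    simp only [tofin, Finset.mem_coe, List.mem_toFinset, List.mem_map] at hφ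
    obtain ⟨ψ, -, rfl⟩ := hφ
    exact ψ.2
  -- a finite part of `q` that refutes the enlargement for all indices: there are fewer than `κ` finite
  -- parts, while `κ` is regular
  obtain ⟨l, hl⟩ := exists_uniform_witness (I := κ.ord.ToType × κ.ord.ToType) (Y := List q)
    (p := fun x l => sol (insert (σ x.1 x.2) (tofin l : Set (L.Formula (M ⊕ (Sp ⊕ H))))) ∉ S)
    (by
      intro g
      have hlist : #(List q) < κ := (mk_list_le_max q).trans_lt (max_lt hκ' hqcard)
      obtain ⟨i, hi⟩ := exists_forall_lt_of_isRegular hκ hlist fun y => (g y).1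
      obtain ⟨j, hj⟩ := exists_forall_lt_of_isRegular hκ hlist fun y => (g y).2
      exact ⟨(i, j), fun y => ⟨(hi y).le, (hj y).le⟩⟩)
    (by
      rintro ⟨i, j⟩ ⟨i', j'⟩ l ⟨hi, hj⟩ hnot hin
      refine hnot (hS.mono ?_ hin)
      rintro s ⟨t, ht⟩
      refine ⟨t, fun φ hφ => ?_⟩
      rcases hφ with rfl | hφ
      · have := ht _ (Set.mem_insert _ _)
        simp only [hσ] at this ⊢
        rw [Formula.realize_not, Cut.realize_sepForm_inl] at this ⊢
        exact fun h => this (hk.separates_mono hi hj h)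
      · exact ht φ (Set.mem_insert_of_mem _ hφ))
    (by
      rintro ⟨i, j⟩
      have := hcon i j
      simp only [Good, not_forall] at this
      obtain ⟨θ, hθ, hθ'⟩ := this
      have hmem : ∀ φ ∈ θ.erase (σ i j), φ ∈ q := fun φ hφ =>
        (hθ (Finset.mem_coe.2 (Finset.mem_of_mem_erase hφ))).resolve_left (Finset.ne_of_mem_erase hφ)
      refine ⟨(θ.erase (σ i j)).attach.toList.map fun φ => ⟨φ.1, hmem φ.1 φ.2⟩, fun h => hθ' ?_⟩
      refine hS.mono (sol_anti fun φ hφ => ?_) h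
      by_cases e : φ = σ i j
      · exact Or.inl e
      · refine Or.inr ?_
        simp only [tofin, Finset.mem_coe, List.mem_toFinset, List.map_map, List.mem_map,
          Finset.mem_toList, Finset.mem_attach, true_and, Function.comp]
        exact ⟨⟨φ, Finset.mem_erase.2 ⟨e, hφ⟩⟩, rfl⟩)
  obtain ⟨i, j, hij⟩ := hkS
    (fun v => ∀ φ ∈ tofin l, φ.Realize (Sum.elim id v))
    (fun w => δ.Realize (Sum.elim (Sum.elim id (w ∘ Sum.inl)) (w ∘ Sum.inr)))
    (Dfn.ball _ fun φ _ => ⟨φ, fun _ => Iff.rfl⟩)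
    ⟨δ.relabel (Equiv.sumAssoc M (Sp ⊕ H) Unit), fun w => by
      rw [Formula.realize_relabel]
      apply iff_of_eq
      congr 1
      funext x
      rcases x with (_ | _) | _ <;> rfl⟩
    (hq _ (htofin l))
  refine hl (i, j) (hS.mono ?_ hij)
  rintro s ⟨t, ht, ht'⟩
  refine ⟨t, fun φ hφ => ?_⟩
  rcases hφ with rfl | hφ
  · simp only [hσ]
    rw [Formula.realize_not, Cut.realize_sepForm_inl]
    exact ht'
  · exact ht φ hφ

end Keep

/-! ### Realising free arrays -/

section Stem

variable {C I : Type*} {ε : C → C → Prop}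

/-- `h` consists of elements of the domain of the partial equivalence relation `ε` and contains
at most one element of each class. -/
def IsChoice (ε : C → C → Prop) (h : Set C) : Prop :=
  (∀ d ∈ h, ε d d) ∧ ∀ d ∈ h, ∀ d' ∈ h, ε d d' → d = d'

/-- The elements of `h` outside `f` are inequivalent to those of `e`. -/
def Avoids (ε : C → C → Prop) (f h e : Set C) : Prop :=
  ∀ d ∈ h, d ∉ f → ∀ d' ∈ e, ¬ ε d d'

theorem Avoids.mono {f h e e' : Set C} (he : e' ⊆ e) (H : Avoids ε f h e) : Avoids ε f h e' :=
  fun d hd hf d' hd' => H d hd hf d' (he hd')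

/-- Suppose that for every finite `e` there is a choice `h` of at most `n` elements with `B i h`
that agrees with the choice `X` on the classes of `e`. Then, for some finite part `f` of `X`, there
are such choices `h ⊇ f` whose other elements avoid any given `e`: a maximal `f` for which the
assumption holds with `f ⊆ h` has this property. -/
theorem exists_stem [Preorder I] [IsDirectedOrder I] [Nonempty I] (hsymm : ∀ d d', ε d d' → ε d' d)
    (htrans : ∀ d d' d'', ε d d' → ε d' d'' → ε d d'') {X : Set C} (hX : IsChoice ε X)
    {B : I → Finset C → Prop} (hB : ∀ i j h, i ≤ j → B j h → B i h) {n : ℕ}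
    (H : ∀ (i : I) (e : Finset C), ∃ h : Finset C, h.card ≤ n ∧ IsChoice ε (h : Set C) ∧
      Avoids ε X h e ∧ B i h) :
    ∃ f : Finset C, (f : Set C) ⊆ X ∧ ∀ (i : I) (e : Finset C), ∃ h : Finset C, f ⊆ h ∧
      h.card ≤ n ∧ IsChoice ε (h : Set C) ∧ Avoids ε f h e ∧ B i h := by
  classical
  let p : Finset C → Prop := fun f => (f : Set C) ⊆ X ∧ ∀ (i : I) (e : Finset C),
    ∃ h : Finset C, f ⊆ h ∧ h.card ≤ n ∧ IsChoice ε (h : Set C) ∧ Avoids ε X h e ∧ B i h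
  suffices hmain : ∀ (m : ℕ) (f : Finset C), n - f.card = m → p f →
      ∃ f : Finset C, (f : Set C) ⊆ X ∧ ∀ (i : I) (e : Finset C), ∃ h : Finset C, f ⊆ h ∧
      h.card ≤ n ∧ IsChoice ε (h : Set C) ∧ Avoids ε f h e ∧ B i h by
    exact hmain _ ∅ rfl ⟨by simp, fun i e => (H i e).imp fun h hh => ⟨by simp, hh⟩⟩
  intro m
  induction m using Nat.strong_induction_on with
  | _ m ih =>
    intro f hfm hf
    by_contra hcon
    have hcon' := hcon
    push Not at hcon'
    obtain ⟨i₁, e₁, h₁⟩ := hcon' f hf.1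
    -- if `f` fails at `e₁`, it can be enlarged by an element of `X` in one of the classes of `e₁`; as
    -- only finitely many elements are eligible, one of them serves for all indices
    let Y := {d : C // d ∈ X ∧ d ∉ f ∧ ∃ d' ∈ e₁, ε d d'}
    have hYfin : Finite Y := by
      have hch : ∀ d : Y, ∃ d' : e₁, ε d.1 d' := fun d =>
        let ⟨d', hd', h⟩ := d.2.2.2
        ⟨⟨d', hd'⟩, h⟩
      choose g hg using hch
      refine Finite.of_injective g fun d d' hdd => Subtype.ext (hX.2 _ d.2.1 _ d'.2.1 ?_)
      exact htrans _ _ _ (hg d) (hdd ▸ hsymm _ _ (hg d'))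
    obtain ⟨d, hd⟩ := exists_uniform_witness (I := I × Finset C) (Y := Y)
      (p := fun x d => ∃ h : Finset C, insert d.1 f ⊆ h ∧ h.card ≤ n ∧ IsChoice ε (h : Set C) ∧
        Avoids ε X h x.2 ∧ B x.1 h)
      (by
        have : IsDirectedOrder (I × Finset C) := ⟨fun a b => by
          obtain ⟨i, h1, h2⟩ := exists_ge_ge a.1 b.1
          exact ⟨(i, a.2 ∪ b.2), ⟨h1, Finset.subset_union_left⟩, ⟨h2, Finset.subset_union_right⟩⟩⟩
        exact fun g => Finite.exists_le g)
      (by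
        rintro ⟨i, e⟩ ⟨i', e'⟩ d ⟨hi, he⟩ ⟨h, hh1, hh2, hh3, hh4, hh5⟩
        exact ⟨h, hh1, hh2, hh3, hh4.mono (by exact_mod_cast he), hB _ _ _ hi hh5⟩)
      (by
        rintro ⟨i, e⟩
        obtain ⟨i', hi1, hi2⟩ := exists_ge_ge i i₁
        obtain ⟨h, hh1, hh2, hh3, hh4, hh5⟩ := hf.2 i' (e ∪ e₁)
        have hna : ¬ Avoids ε f h e₁ := fun ha => h₁ h hh1 hh2 hh3 ha (hB _ _ _ hi2 hh5)
        simp only [Avoids, not_forall, not_not] at hna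
        obtain ⟨d, hdh, hdf, d', hd', hdd⟩ := hna
        have hdX : d ∈ X := by
          by_contra hdX
          exact hh4 d hdh hdX d' (by simp [Finset.mem_coe.1 hd']) hdd
        exact ⟨⟨d, hdX, hdf, d', hd', hdd⟩, h, Finset.insert_subset hdh hh1, hh2, hh3,
          hh4.mono (by simp), hB _ _ _ hi1 hh5⟩)
    have hpd : p (insert d.1 f) :=
      ⟨by rw [Finset.coe_insert]; exact Set.insert_subset d.2.1 hf.1, fun i e => hd (i, e)⟩
    have hcard : (insert d.1 f).card = f.card + 1 := Finset.card_insert_of_notMem d.2.2.1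
    have hle : (insert d.1 f).card ≤ n := by
      obtain ⟨h, hh1, hh2, -⟩ := hpd.2 (Classical.arbitrary I) ∅
      exact (Finset.card_le_card hh1).trans hh2
    exact hcon (ih (n - (insert d.1 f).card) (by omega) _ rfl hpd)

end Stem

section Array

variable {L : FirstOrder.Language.{u, u}} {M : Type u} [L.Structure M] {J H : Type u}

theorem Dfn.downwardClosed [Nonempty M] {γ : Type*} (k : Cut L J M)
    {Δ : (γ ⊕ Unit → M) → Prop} (hΔ : Dfn L Δ) :
    Dfn L fun u : γ → M => ∀ x y, k.rel x y → Δ (Sum.elim u fun _ => y) →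
      Δ (Sum.elim u fun _ => x) := by
  have h1 : Dfn L fun w : γ ⊕ Fin 2 → M => k.rel (w (Sum.inr 0)) (w (Sum.inr 1)) :=
    ((Dfn.of_formula k.R k.c).comp (Sum.inr : Fin 2 → γ ⊕ Fin 2)).congr fun w => by
      have : w ∘ Sum.inr = ![w (Sum.inr 0), w (Sum.inr 1)] := by
        funext i; fin_cases i <;> rfl
      rw [this]; rfl
  have h2 : ∀ t : Fin 2, Dfn L fun w : γ ⊕ Fin 2 → M =>
      Δ (Sum.elim (w ∘ Sum.inl) fun _ => w (Sum.inr t)) := fun t =>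
    (hΔ.comp (Sum.map id fun _ => t)).congr fun w => by
      apply iff_of_eq
      congr 1
      funext x
      rcases x with _ | _ <;> rfl
  refine ((h1.imp ((h2 1).imp (h2 0))).all).congr fun u => ⟨fun h x y => h ![x, y], fun h w => ?_⟩
  exact h (w 0) (w 1)

/-- The positive sets of the array step: a set of elements `s` is positive if, for every `n`, it
realises all small choices of `n` codes that agree with `X` on the classes of some finite set of
exceptional codes. -/
def arrayPositive (ρ : M → (Fin 2 → M) → Prop) (ε : (Fin 2 → M) → (Fin 2 → M) → Prop)
    (X : Set (Fin 2 → M)) : Set (Set (PUnit.{u + 1} → M)) :=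
  {A | ∀ n : ℕ, ∃ e : Finset (Fin 2 → M), ∀ h : Finset (Fin 2 → M), h.card ≤ n →
    IsChoice ε (h : Set (Fin 2 → M)) → Avoids ε X h e → ∃ s ∈ A, ∀ d ∈ h, ρ (s ⟨⟩) d}

variable {ρ : M → (Fin 2 → M) → Prop} {ε : (Fin 2 → M) → (Fin 2 → M) → Prop}
  {X : Set (Fin 2 → M)}

theorem IsChoice.union {C : Type*} {ε : C → C → Prop} (hsymm : ∀ d d', ε d d' → ε d' d)
    {h h' : Set C} (hh : IsChoice ε h)
    (hh' : IsChoice ε h') (H : ∀ d ∈ h, ∀ d' ∈ h', ε d d' → d = d') : IsChoice ε (h ∪ h') := by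
  refine ⟨fun d hd => hd.elim (hh.1 d) (hh'.1 d), ?_⟩
  rintro d (hd | hd) d' (hd' | hd') hdd
  · exact hh.2 d hd d' hd' hdd
  · exact H d hd d' hd' hdd
  · exact (H d' hd' d hd (hsymm _ _ hdd)).symm
  · exact hh'.2 d hd d' hd' hdd

theorem isPositive_arrayPositive (hsymm : ∀ d d', ε d d' → ε d' d)
    (htrans : ∀ d d' d'', ε d d' → ε d' d'' → ε d d'')
    (harr : ∀ h : Finset (Fin 2 → M), IsChoice ε (h : Set (Fin 2 → M)) → ∃ z, ∀ d ∈ h, ρ z d)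
    (hX : IsChoice ε X) : IsPositive (arrayPositive ρ ε X) := by
  classical
  refine ⟨fun n => ⟨∅, fun h _ hh _ => ?_⟩, fun h => ?_, fun {s t} hst hs n => ?_, fun {s t} hst => ?_⟩
  · obtain ⟨z, hz⟩ := harr h hh
    exact ⟨fun _ => z, trivial, hz⟩
  · obtain ⟨e, he⟩ := h 0
    obtain ⟨s, hs, -⟩ := he ∅ le_rfl (by simp [IsChoice]) (by simp [Avoids])
    exact hs
  · obtain ⟨e, he⟩ := hs n
    exact ⟨e, fun h h1 h2 h3 => let ⟨x, hx, hx'⟩ := he h h1 h2 h3; ⟨x, hst hx, hx'⟩⟩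
  · by_contra hcon
    push Not at hcon
    have key : ∀ A : Set (PUnit.{u + 1} → M), A ∉ arrayPositive ρ ε X → ∃ (n : ℕ) (f : Finset (Fin 2 → M)),
        (f : Set (Fin 2 → M)) ⊆ X ∧ ∀ e : Finset (Fin 2 → M), ∃ h : Finset (Fin 2 → M), f ⊆ h ∧
        h.card ≤ n ∧ IsChoice ε (h : Set (Fin 2 → M)) ∧ Avoids ε f h e ∧
        ∀ s ∈ A, ¬ ∀ d ∈ h, ρ (s ⟨⟩) d := by
      intro A hA
      simp only [arrayPositive, Set.mem_ofPred_eq, not_forall, not_exists] at hA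
      obtain ⟨n, hn⟩ := hA
      obtain ⟨f, hf, hf'⟩ := exists_stem (I := Unit) hsymm htrans hX (n := n)
        (B := fun _ h => ∀ s ∈ A, ¬ ∀ d ∈ h, ρ (s ⟨⟩) d) (fun _ _ _ _ h => h) (by
          intro _ e
          obtain ⟨h, h1, h2, h3, h4⟩ := hn e
          exact ⟨h, h1, h2, h3, fun s hs hd => h4 s ⟨hs, hd⟩⟩)
      exact ⟨n, f, hf, hf' ()⟩
    obtain ⟨n₁, f₁, hf₁, H₁⟩ := key s hcon.1
    obtain ⟨n₂, f₂, hf₂, H₂⟩ := key t hcon.2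
    obtain ⟨e₀, he₀⟩ := hst (n₁ + n₂)
    -- counterexamples for the two parts that fit together into one for the union
    obtain ⟨h₁, hfh₁, hc₁, hch₁, hav₁, hno₁⟩ := H₁ (e₀ ∪ f₂)
    obtain ⟨h₂, hfh₂, hc₂, hch₂, hav₂, hno₂⟩ := H₂ (e₀ ∪ (f₁ ∪ h₁))
    obtain ⟨x, hx, hx'⟩ := he₀ (h₁ ∪ h₂) ((Finset.card_union_le _ _).trans (add_le_add hc₁ hc₂))
      (by
        rw [Finset.coe_union]
        refine hch₁.union hsymm hch₂ fun d hd d' hd' hdd => ?_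
        by_cases h2 : d' ∈ f₂
        · by_cases h1 : d ∈ f₁
          · exact hX.2 d (hf₁ h1) d' (hf₂ h2) hdd
          · exact absurd hdd (hav₁ d hd h1 d' (by simp [h2]))
        · exact absurd (hsymm _ _ hdd) (hav₂ d' hd' h2 d (by simp [Finset.mem_coe.1 hd])))
      (by
        intro d hd hdX d' hd'
        rcases Finset.mem_union.1 (Finset.mem_coe.1 hd) with hd | hd
        · exact hav₁ d hd (fun h => hdX (hf₁ h)) d' (by simp [Finset.mem_coe.1 hd'])
        · exact hav₂ d hd (fun h => hdX (hf₂ h)) d' (by simp [Finset.mem_coe.1 hd']))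
    rcases hx with hx | hx
    · exact hno₁ x hx fun d hd => hx' d (Finset.mem_union_left _ hd)
    · exact hno₂ x hx fun d hd => hx' d (Finset.mem_union_right _ hd)

theorem exists_finset_card_le_iff {C : Type*} {n : ℕ} {Q : Set C → Prop} :
    (∃ h : Finset C, h.card ≤ n ∧ Q h) ↔ ∃ (m : Fin (n + 1)) (y : Fin m → C), Q (Set.range y) := by
  classical
  constructor
  · rintro ⟨h, hn, hQ⟩
    refine ⟨⟨h.card, by omega⟩, fun p => h.equivFin.symm p, ?_⟩
    convert hQ
    ext x
    constructor
    · rintro ⟨p, rfl⟩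
      exact (h.equivFin.symm p).2
    · exact fun hx => ⟨h.equivFin ⟨x, hx⟩, by simp⟩
  · rintro ⟨m, y, hQ⟩
    refine ⟨Finset.univ.image y, Finset.card_image_le.trans (by simp; omega), ?_⟩
    simpa using hQ

/-- Suppose that, for all `i` and `j`, almost all solutions give a set `Δ` that separates `a i` from
`b j`. Then this is forced by choices that have a bounded size and a common stem, and the elements that
such a choice forces into `Δ` form a definable set that separates the two sides of the cut. -/
theorem keepsCut_arrayPositive [Nonempty M] [LinearOrder J] [Nonempty J]
    (hJ : ∀ g : ℕ → J, ∃ j, ∀ n, g n ≤ j) (hsymm : ∀ d d', ε d d' → ε d' d)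
    (htrans : ∀ d d' d'', ε d d' → ε d' d'' → ε d d'')
    (hρ : Dfn L fun v : Unit ⊕ Fin 2 → M => ρ (v (Sum.inl ())) (v ∘ Sum.inr))
    (hε : Dfn L fun v : Fin 2 ⊕ Fin 2 → M => ε (v ∘ Sum.inl) (v ∘ Sum.inr))
    (hX : IsChoice ε X) {k : Cut L J M} (hk : k.IsNested) (hk' : k.Unseparated) :
    KeepsCut H (arrayPositive ρ ε X) k := by
  classical
  intro A Δ hA hΔ hS
  by_contra hcon
  push Not at hcon
  let Sep : (PUnit.{u + 1} ⊕ H → M) → J → J → Prop := fun u i j =>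
    k.Separates (fun x => Δ (Sum.elim u fun _ => x)) i j
  let B : ℕ → J × J → Finset (Fin 2 → M) → Prop := fun _ ij h =>
    ∀ u : PUnit.{u + 1} ⊕ H → M, A u → (∀ d ∈ h, ρ (u (Sum.inl ⟨⟩)) d) → Sep u ij.1 ij.2
  -- a bound for the size of the choices that force the separation, uniform in the indices
  obtain ⟨n, hn⟩ := exists_uniform_witness (I := J × J) (Y := ℕ)
    (p := fun ij n => ∀ e : Finset (Fin 2 → M), ∃ h : Finset (Fin 2 → M), h.card ≤ n ∧
      IsChoice ε (h : Set (Fin 2 → M)) ∧ Avoids ε X h e ∧ B 0 ij h)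
    (by
      intro g
      obtain ⟨i, hi⟩ := hJ fun n => (g n).1
      obtain ⟨j, hj⟩ := hJ fun n => (g n).2
      exact ⟨(i, j), fun n => ⟨hi n, hj n⟩⟩)
    (by
      rintro ⟨i, j⟩ ⟨i', j'⟩ n ⟨hi, hj⟩ h e
      obtain ⟨h, h1, h2, h3, h4⟩ := h e
      exact ⟨h, h1, h2, h3, fun u hu hd => hk.separates_mono hi hj (h4 u hu hd)⟩)
    (by
      rintro ⟨i, j⟩
      have := hcon i j
      simp only [arrayPositive, Set.mem_ofPred_eq, not_forall, not_exists] at this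
      obtain ⟨n, hn⟩ := this
      refine ⟨n, fun e => ?_⟩
      obtain ⟨h, h1, h2, h3, h4⟩ := hn e
      refine ⟨h, h1, h2, h3, fun u hu hd => ?_⟩
      by_contra hsep
      refine h4 (u ∘ Sum.inl) ⟨⟨u ∘ Sum.inr, ?_⟩, hd⟩
      rw [Sum.elim_comp_inl_inr]
      exact ⟨hu, hsep⟩)
  have : IsDirectedOrder (J × J) := ⟨fun a b => ⟨a ⊔ b, le_sup_left, le_sup_right⟩⟩
  obtain ⟨f, hfX, hf⟩ := exists_stem (I := J × J) hsymm htrans hX (n := n) (B := B 0)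
    (by
      rintro ⟨i, j⟩ ⟨i', j'⟩ h ⟨hi, hj⟩ h4 u hu hd
      exact hk.separates_mono hi hj (h4 u hu hd)) (fun ij e => hn ij e)
  obtain ⟨e₀, he₀⟩ := hS (n + n)
  -- the elements that belong to the set defined by `Δ` for all solutions of some short extension
  -- of the stem
  let Q : M → Set (Fin 2 → M) → Prop := fun c h => (∀ d ∈ f, d ∈ h) ∧ IsChoice ε h ∧
    Avoids ε f h e₀ ∧ ∀ u : PUnit.{u + 1} ⊕ H → M, A u → (∀ d ∈ h, ρ (u (Sum.inl ⟨⟩)) d) →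
      (∀ x y, k.rel x y → Δ (Sum.elim u fun _ => y) → Δ (Sum.elim u fun _ => x)) ∧
        Δ (Sum.elim u fun _ => c)
  let D : M → Prop := fun c => ∃ h : Finset (Fin 2 → M), h.card ≤ n ∧ Q c h
  have hD : Dfn L fun v : Unit → M => D (v ()) := by
    refine Dfn.congr ?_ fun v => (exists_finset_card_le_iff (Q := Q (v ()))).symm
    refine Dfn.exists_fin fun m => ?_
    refine (Dfn.ex (β := Fin m × Fin 2) (P := fun w => Q (w (Sum.inl ()))
      (Set.range fun (p : Fin m) (q : Fin 2) => w (Sum.inr (p, q)))) ?_).congr fun v =>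
        ⟨fun ⟨w, hw⟩ => ⟨fun p q => w (p, q), hw⟩, fun ⟨y, hy⟩ => ⟨fun x => y x.1 x.2, hy⟩⟩
    have hε2 : ∀ {γ : Type} (g g' : Fin 2 → M ⊕ γ), Dfn L fun w : γ → M =>
        ε (fun q => Sum.elim id w (g q)) (fun q => Sum.elim id w (g' q)) := fun g g' =>
      hε.subst (Sum.elim g g')
    have heq : ∀ {γ : Type} (g g' : Fin 2 → M ⊕ γ), Dfn L fun w : γ → M =>
        (fun q => Sum.elim id w (g q)) = (fun q => Sum.elim id w (g' q)) := fun g g' =>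
      (Dfn.forall_fin fun q => Dfn.eq (g q) (g' q)).congr fun w => funext_iff.symm
    refine Dfn.and ?_ (Dfn.and (Dfn.and ?_ ?_) (Dfn.and ?_ ?_))
    · exact Dfn.ball _ fun d _ => Dfn.exists_fin fun p =>
        heq (fun q => Sum.inr (Sum.inr (p, q))) (fun q => Sum.inl (d q))
    · refine (Dfn.forall_fin fun p : Fin m => hε2 (fun q => Sum.inr (Sum.inr (p, q)))
        (fun q => Sum.inr (Sum.inr (p, q)))).congr fun w => ?_
      rw [Set.forall_mem_range]
      rfl
    · refine (Dfn.forall_fin fun p : Fin m => Dfn.forall_fin fun p' : Fin m =>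
        (hε2 (fun q => Sum.inr (Sum.inr (p, q))) (fun q => Sum.inr (Sum.inr (p', q)))).imp
        (heq (fun q => Sum.inr (Sum.inr (p, q))) (fun q => Sum.inr (Sum.inr (p', q))))).congr
          fun w => ?_
      simp only [Set.forall_mem_range]
      rfl
    · refine (Dfn.forall_fin fun p : Fin m => (Dfn.ball f fun d _ =>
        (heq (fun q => Sum.inr (Sum.inr (p, q))) (fun q => Sum.inl (d q))).not).imp
        (Dfn.ball e₀ fun d _ =>
          (hε2 (fun q => Sum.inr (Sum.inr (p, q))) (fun q => Sum.inl (d q))).not)).congr fun w => ?_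
      simp only [Avoids, Set.forall_mem_range, Finset.mem_coe]
      exact forall_congr' fun p => imp_congr
        ⟨fun h hf => h _ hf rfl, fun h d hd he => h (Set.mem_of_eq_of_mem he hd)⟩ Iff.rfl
    · refine (Dfn.all (β := PUnit.{u + 1} ⊕ H) (P := fun w => A (w ∘ Sum.inr) →
        (∀ p : Fin m, ρ (w (Sum.inr (Sum.inl ⟨⟩))) fun q => w (Sum.inl (Sum.inr (p, q)))) →
        (∀ x y, k.rel x y → Δ (Sum.elim (w ∘ Sum.inr) fun _ => y) →
          Δ (Sum.elim (w ∘ Sum.inr) fun _ => x)) ∧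
        Δ (Sum.elim (w ∘ Sum.inr) fun _ => w (Sum.inl (Sum.inl ())))) ?_).congr fun w => ?_
      · refine (hA.comp Sum.inr).imp (Dfn.imp (Dfn.forall_fin fun p : Fin m => ?_) (Dfn.and ?_ ?_))
        · exact (hρ.comp (Sum.elim (fun _ => Sum.inr (Sum.inl PUnit.unit))
            fun q => Sum.inl (Sum.inr (p, q))))
        · exact (Dfn.downwardClosed k hΔ).comp Sum.inr
        · refine (hΔ.comp (Sum.elim Sum.inr fun _ => Sum.inl (Sum.inl ()))).congr fun w => ?_
          apply iff_of_eq
          congr 1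
          funext x
          rcases x with _ | _ <;> rfl
      · simp only [Set.forall_mem_range]
        rfl
  obtain ⟨i, j, hij⟩ := hk' D hD
  refine hij ⟨fun x y hxy hy => ?_, ?_, ?_⟩
  · obtain ⟨h, h1, h2, h3, h4, h5⟩ := hy
    exact ⟨h, h1, h2, h3, h4, fun u hu hd => ⟨(h5 u hu hd).1, (h5 u hu hd).1 _ _ hxy (h5 u hu hd).2⟩⟩
  · obtain ⟨h, h1, h2, h3, h4, h5⟩ := hf (i, j) e₀
    exact ⟨h, h2, fun d hd => h1 hd, h3, h4, fun u hu hd => ⟨(h5 u hu hd).1, (h5 u hu hd).2.1⟩⟩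
  · rintro ⟨h, h1, h2, h3, h4, h5⟩
    -- a choice forcing `b j` out of the set, compatible with one forcing it in
    obtain ⟨h', g1, g2, g3, g4, g5⟩ := hf (i, j) (e₀ ∪ h)
    obtain ⟨s, ⟨t, ht⟩, hs⟩ := he₀ (h ∪ h') ((Finset.card_union_le _ _).trans (add_le_add h1 g2))
      (by
        rw [Finset.coe_union]
        refine h3.union hsymm g3 fun d hd d' hd' hdd => ?_
        by_cases h2' : d' ∈ f
        · exact h3.2 d hd d' (h2 d' h2') hdd
        · exact absurd (hsymm _ _ hdd) (g4 d' hd' h2' d (by simp [Finset.mem_coe.1 hd])))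
      (by
        intro d hd hdX d' hd'
        rcases Finset.mem_union.1 (Finset.mem_coe.1 hd) with hd | hd
        · exact h4 d hd (fun h => hdX (hfX h)) d' hd'
        · exact g4 d hd (fun h => hdX (hfX h)) d' (by simp [Finset.mem_coe.1 hd']))
    exact (g5 _ ht fun d hd => hs d (Finset.mem_union_right _ hd)).2.2
      (h5 _ ht fun d hd => hs d (Finset.mem_union_left _ hd)).2

end Array

section ArrayStep

open Cardinal

variable {L : FirstOrder.Language.{u, u}} {M N : Type u} [L.Structure M] [L.Structure N]

/-- Elementary embeddings reflect finite systems of conditions on finitely many unknowns. -/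
theorem exists_realize_of_map {L : FirstOrder.Language.{u₀, v₀}} {M : Type u₁} {N : Type v₁}
    [L.Structure M] [L.Structure N] {β : Type*} [Finite β] (f : M ↪ₑ[L] N)
    (s : Finset (L.Formula (M ⊕ β)))
    (h : ∃ z : β → N, ∀ φ ∈ s, φ.Realize (Sum.elim f z)) :
    ∃ z : β → M, ∀ φ ∈ s, φ.Realize (Sum.elim id z) := by
  have h1 : ((Formula.iInf fun φ : s => φ.1).iExs β).Realize (f ∘ id) := by
    simpa [Formula.realize_iExs, Formula.realize_iInf] using h
  rw [f.map_formula] at h1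
  simpa [Formula.realize_iExs, Formula.realize_iInf] using h1

/-- The relation between elements and codes (pairs of elements) given by a formula with
parameters. -/
def codeRel (φ : L.Formula (ℕ ⊕ (Unit ⊕ Fin 2))) (c : ℕ → M) (z : M) (d : Fin 2 → M) : Prop :=
  φ.Realize (Sum.elim c (Sum.elim (fun _ => z) d))

/-- The relation between codes given by a formula with parameters. -/
def codeEquiv (ψ : L.Formula (ℕ ⊕ (Fin 2 ⊕ Fin 2))) (c : ℕ → M) (d d' : Fin 2 → M) : Prop :=
  ψ.Realize (Sum.elim c (Sum.elim d d'))

/-- `ψ` defines a partial equivalence relation on the codes, and any finitely many inequivalent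
codes of its domain have a common `φ`-solution. -/
structure IsArray (φ : L.Formula (ℕ ⊕ (Unit ⊕ Fin 2))) (ψ : L.Formula (ℕ ⊕ (Fin 2 ⊕ Fin 2)))
    (c : ℕ → M) : Prop where
  symm : ∀ d d', codeEquiv ψ c d d' → codeEquiv ψ c d' d
  trans : ∀ d d' d'', codeEquiv ψ c d d' → codeEquiv ψ c d' d'' → codeEquiv ψ c d d''
  exists_rel : ∀ h : Finset (Fin 2 → M), IsChoice (codeEquiv ψ c) (h : Set (Fin 2 → M)) →
    ∃ z, ∀ d ∈ h, codeRel φ c z d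

theorem dfn_codeRel (φ : L.Formula (ℕ ⊕ (Unit ⊕ Fin 2))) (c : ℕ → M) :
    Dfn L fun v : Unit ⊕ Fin 2 → M => codeRel φ c (v (Sum.inl ())) (v ∘ Sum.inr) :=
  (Dfn.of_formula φ c).congr fun v => by
    rw [codeRel]
    apply iff_of_eq
    congr 2
    funext x
    rcases x with _ | _ <;> rfl

theorem dfn_codeEquiv (ψ : L.Formula (ℕ ⊕ (Fin 2 ⊕ Fin 2))) (c : ℕ → M) :
    Dfn L fun v : Fin 2 ⊕ Fin 2 → M => codeEquiv ψ c (v ∘ Sum.inl) (v ∘ Sum.inr) :=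
  (Dfn.of_formula ψ c).congr fun v => by
    rw [codeEquiv, Sum.elim_comp_inl_inr]

theorem codeRel_map (f : M ↪ₑ[L] N) (φ : L.Formula (ℕ ⊕ (Unit ⊕ Fin 2))) (c : ℕ → M) (z : M)
    (d : Fin 2 → M) : codeRel φ (f ∘ c) (f z) (f ∘ d) ↔ codeRel φ c z d := by
  rw [codeRel, codeRel, ← f.map_formula]
  exact realize_congr (by rintro (_ | _ | _) <;> rfl)

theorem codeEquiv_map (f : M ↪ₑ[L] N) (ψ : L.Formula (ℕ ⊕ (Fin 2 ⊕ Fin 2))) (c : ℕ → M)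
    (d d' : Fin 2 → M) : codeEquiv ψ (f ∘ c) (f ∘ d) (f ∘ d') ↔ codeEquiv ψ c d d' := by
  rw [codeEquiv, codeEquiv, ← f.map_formula]
  exact realize_congr (by rintro (_ | _ | _) <;> rfl)

theorem isChoice_map (f : M ↪ₑ[L] N) (ψ : L.Formula (ℕ ⊕ (Fin 2 ⊕ Fin 2))) (c : ℕ → M)
    (h : Set (Fin 2 → M)) :
    IsChoice (codeEquiv ψ (f ∘ c)) ((f ∘ ·) '' h) ↔ IsChoice (codeEquiv ψ c) h := by
  simp only [IsChoice, Set.forall_mem_image, codeEquiv_map]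
  refine and_congr Iff.rfl (forall₂_congr fun d _ => forall₂_congr fun d' _ => ?_)
  rw [(f.injective.comp_left).eq_iff]

theorem IsArray.of_map (f : M ↪ₑ[L] N) {φ : L.Formula (ℕ ⊕ (Unit ⊕ Fin 2))}
    {ψ : L.Formula (ℕ ⊕ (Fin 2 ⊕ Fin 2))} {c : ℕ → M} (h : IsArray φ ψ (f ∘ c)) :
    IsArray φ ψ c := by
  classical
  refine ⟨fun d d' hd => ?_, fun d d' d'' h1 h2 => ?_, fun s hs => ?_⟩
  · rw [← codeEquiv_map f] at hd ⊢
    exact h.symm _ _ hd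
  · rw [← codeEquiv_map f] at h1 h2 ⊢
    exact h.trans _ _ _ h1 h2
  · obtain ⟨z, hz⟩ := h.exists_rel (s.image (f ∘ ·)) (by
      rw [Finset.coe_image, isChoice_map]
      exact hs)
    let σ : (Fin 2 → M) → L.Formula (M ⊕ Unit) := fun d =>
      φ.relabel (Sum.elim (fun n => Sum.inl (c n)) (Sum.elim Sum.inr fun q => Sum.inl (d q)))
    obtain ⟨y, hy⟩ := exists_realize_of_map f (s.image σ) ⟨fun _ => z, by
      simp only [Finset.mem_image, forall_exists_index, and_imp, forall_apply_eq_imp_iff₂]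
      intro d hd
      have := hz _ (Finset.mem_image_of_mem _ hd)
      exact Formula.realize_relabel.2 ((realize_congr (by rintro (_ | _ | _) <;> rfl)).1 this)⟩
    refine ⟨y (), fun d hd => ?_⟩
    have := hy _ (Finset.mem_image_of_mem _ hd)
    exact (realize_congr (by rintro (_ | _ | _) <;> rfl)).1 (Formula.realize_relabel.1 this)

theorem exists_forall_nat_le {κ : Cardinal.{u}} (hκ : κ.IsRegular) (hκ' : ℵ₀ < κ)
    (g : ℕ → κ.ord.ToType) : ∃ j, ∀ n, g n ≤ j := by
  obtain ⟨j, hj⟩ := exists_forall_lt_of_isRegular hκ (Y := ULift.{u} ℕ) (by simpa using hκ')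
    fun n => g n.down
  exact ⟨j, fun n => (hj ⟨n⟩).le⟩

/-- An elementary extension realising a whole choice of codes of an array, in which given cuts stay
unseparated. -/
theorem exists_extension_array {κ : Cardinal.{u}} (hκ : κ.IsRegular) (hκ' : ℵ₀ < κ)
    (hL : L.card ≤ κ) [Nonempty M] (hM : #M ≤ κ) (K : Set (Cut L κ.ord.ToType M)) (hKcard : #K ≤ κ)
    (hK : ∀ k ∈ K, k.IsNested ∧ k.Unseparated) {φ : L.Formula (ℕ ⊕ (Unit ⊕ Fin 2))}
    {ψ : L.Formula (ℕ ⊕ (Fin 2 ⊕ Fin 2))} {c : ℕ → M} (h : IsArray φ ψ c) {X : Set (Fin 2 → M)}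
    (hX : IsChoice (codeEquiv ψ c) X) :
    ∃ (N : Type u) (_ : L.Structure N) (f : M ↪ₑ[L] N), #N ≤ κ ∧
      (∃ z, ∀ d ∈ X, codeRel φ (f ∘ c) z (f ∘ d)) ∧ ∀ k ∈ K, (k.map f).Unseparated := by
  classical
  have : Nonempty κ.ord.ToType := by
    rw [← mk_ne_zero_iff, mk_ord_toType]; exact (aleph0_pos.trans hκ').ne'
  have hS := isPositive_arrayPositive h.symm h.trans h.exists_rel hX
  obtain ⟨N, hN, f, s, hNcard, hs, hcut⟩ := exists_extension hκ hκ' hL hM (Sp := PUnit.{u + 1})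
    (H := κ.out) (by simpa using (one_lt_aleph0.trans hκ').le) (mk_out κ) hS
    (Cut.map Sum.inl '' K) (mk_image_le.trans hKcard) (by
      rintro _ ⟨k, hk, rfl⟩ δ q hq hqS
      exact (keepsCut_arrayPositive (exists_forall_nat_le hκ hκ') h.symm h.trans
        (dfn_codeRel φ c) (dfn_codeEquiv ψ c) hX (hK k hk).1 (hK k hk).2).exists_good_insert
          hκ hκ' hS (hK k hk).1 δ q hq hqS)
  refine ⟨N, hN, f, hNcard, ⟨s ⟨⟩, fun d hd => ?_⟩, fun k hk => ?_⟩
  · have := hs (φ.relabel (Sum.elim (fun n => Sum.inl (c n))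
      (Sum.elim (fun _ => Sum.inr ⟨⟩) fun q => Sum.inl (d q)))) (by
        intro hcon
        obtain ⟨e, he⟩ := hcon 1
        obtain ⟨t, ht, ht'⟩ := he {d} (by simp) (by
          rw [Finset.coe_singleton]
          exact ⟨fun d' hd' => hX.1 d' (by rwa [Set.mem_singleton_iff.1 hd']),
            fun d' hd' d'' hd'' _ => hd'.trans hd''.symm⟩)
          (by
            intro d' hd' hdX
            rw [Finset.coe_singleton, Set.mem_singleton_iff] at hd'
            exact absurd hd (hd' ▸ hdX))
        refine ht ?_
        exact Formula.realize_relabel.2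
          ((realize_congr (by rintro (_ | _ | _) <;> rfl)).1 (ht' d (by simp))))
    exact (realize_congr (by rintro (_ | _ | _) <;> rfl)).1 (Formula.realize_relabel.1 this)
  · exact hcut _ ⟨k, hk, rfl⟩

end ArrayStep

/-! ### Creating an unfilled cut -/

section Chains

variable {M Λ : Type*}

/-- `x` is strictly below `y` for the relation `R`. -/
def StrictRel (R : M → M → Prop) (x y : M) : Prop := R x y ∧ x ≠ y

/-- Between any two finite sets of elements of the domain `{x | R x x}`, the first below the second,
there is a further element of the domain. -/
def FinBetween (R : M → M → Prop) : Prop :=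
  ∀ lo hi : Finset M, (∀ x ∈ lo, R x x) → (∀ y ∈ hi, R y y) →
    (∀ x ∈ lo, ∀ y ∈ hi, StrictRel R x y) →
    ∃ m, R m m ∧ (∀ x ∈ lo, StrictRel R x m) ∧ ∀ y ∈ hi, StrictRel R m y

/-- `v` maps `s` to a strictly increasing chain in the domain of `R`. -/
def ChainOn [LT Λ] (R : M → M → Prop) (s : Set Λ) (v : Λ → M) : Prop :=
  (∀ x ∈ s, R (v x) (v x)) ∧ ∀ x ∈ s, ∀ y ∈ s, x < y → StrictRel R (v x) (v y)

variable {R : M → M → Prop}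

theorem ChainOn.mono [LT Λ] {s s' : Set Λ} {v : Λ → M} (h : ChainOn R s v) (hs : s' ⊆ s) :
    ChainOn R s' v :=
  ⟨fun x hx => h.1 x (hs hx), fun x hx y hy => h.2 x (hs hx) y (hs hy)⟩

theorem ChainOn.congr [LT Λ] {s : Set Λ} {v w : Λ → M} (h : ChainOn R s v)
    (hs : ∀ x ∈ s, w x = v x) : ChainOn R s w :=
  ⟨fun x hx => by rw [hs x hx]; exact h.1 x hx,
    fun x hx y hy hxy => by rw [hs x hx, hs y hy]; exact h.2 x hx y hy hxy⟩

theorem ChainOn.insert_of [LinearOrder Λ] {s : Set Λ} {v : Λ → M} (h : ChainOn R s v)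
    {x : Λ} {m : M} (hm : R m m)  (hvx : v x = m)
    (hlo : ∀ y ∈ s, y < x → StrictRel R (v y) m) (hhi : ∀ y ∈ s, x < y → StrictRel R m (v y)) :
    ChainOn R (insert x s) v := by
  subst hvx
  refine ⟨?_, ?_⟩
  · rintro y (rfl | hy)
    exacts [hm, h.1 y hy]
  · rintro y (rfl | hy) z (rfl | hz) hyz
    · exact absurd hyz (lt_irrefl _)
    · exact hhi z hz hyz
    · exact hlo y hy hyz
    · exact h.2 y hy z hz hyz

theorem ChainOn.exists_insert [LinearOrder Λ] (hR : FinBetween R) {s : Finset Λ} {v : Λ → M}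
    (h : ChainOn R (s : Set Λ) v) (x : Λ) (hx : x ∉ s) :
    ∃ v' : Λ → M, (∀ y ∈ s, v' y = v y) ∧ ChainOn R (insert x s : Set Λ) v' := by
  classical
  obtain ⟨m, hm, hlo, hhi⟩ := hR ((s.filter (· < x)).image v) ((s.filter (x < ·)).image v)
    (by simp only [Finset.mem_image, Finset.mem_filter]; rintro _ ⟨y, hy, rfl⟩; exact h.1 y hy.1)
    (by simp only [Finset.mem_image, Finset.mem_filter]; rintro _ ⟨y, hy, rfl⟩; exact h.1 y hy.1)
    (by
      simp only [Finset.mem_image, Finset.mem_filter]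
      rintro _ ⟨y, hy, rfl⟩ _ ⟨z, hz, rfl⟩
      exact h.2 y hy.1 z hz.1 (hy.2.trans hz.2))
  have hne : ∀ y ∈ s, Function.update v x m y = v y := fun y hy =>
    Function.update_of_ne (by rintro rfl; exact hx hy) _ _
  refine ⟨Function.update v x m, hne, ?_⟩
  refine (h.congr hne).insert_of hm (Function.update_self ..) (fun y hy hyx => ?_)
    (fun y hy hyx => ?_)
  · rw [hne y hy]
    exact hlo _ (Finset.mem_image_of_mem _ (Finset.mem_filter.2 ⟨hy, hyx⟩))
  · rw [hne y hy]
    exact hhi _ (Finset.mem_image_of_mem _ (Finset.mem_filter.2 ⟨hy, hyx⟩))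

theorem ChainOn.exists_extend [LinearOrder Λ] (hR : FinBetween R) {s : Finset Λ} {v : Λ → M}
    (h : ChainOn R (s : Set Λ) v) (t : Finset Λ) :
    ∃ v' : Λ → M, (∀ y ∈ s, v' y = v y) ∧ ChainOn R (t ∪ s : Set Λ) v' := by
  classical
  induction t using Finset.induction_on with
  | empty => exact ⟨v, fun _ _ => rfl, by simpa using h⟩
  | insert x t _ ih =>
    obtain ⟨v', h1, h2⟩ := ih
    by_cases hx : x ∈ t ∪ s
    · refine ⟨v', h1, ?_⟩
      convert h2 using 1
      ext y
      simp only [Finset.coe_insert, Set.mem_union, Set.mem_insert_iff, Finset.mem_coe]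
      constructor
      · rintro ((rfl | hy) | hy)
        · simpa using hx
        · exact Or.inl hy
        · exact Or.inr hy
      · tauto
    · have h2' : ChainOn R ((t ∪ s : Finset Λ) : Set Λ) v' := by rwa [Finset.coe_union]
      obtain ⟨v'', h3, h4⟩ := ChainOn.exists_insert hR h2' x hx
      refine ⟨v'', fun y hy => (h3 y (Finset.mem_union_right _ hy)).trans (h1 y hy), ?_⟩
      rw [Finset.coe_insert, Set.insert_union, ← Finset.coe_union]
      exact h4

/-- The positive sets of the cut-creation step: those containing chains on every finite set. -/
def chainPositive (Λ : Type*) [LT Λ] (R : M → M → Prop) : Set (Set (Λ → M)) :=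
  {A | ∀ s : Finset Λ, ∃ v ∈ A, ChainOn R (s : Set Λ) v}

theorem isPositive_chainPositive [Nonempty M] [LinearOrder Λ] (hR : FinBetween R) :
    IsPositive (chainPositive Λ R) := by
  classical
  refine ⟨fun s => ?_, fun h => ?_, fun {s t} hst hs u => ?_, fun {A B} hAB => ?_⟩
  · obtain ⟨v, -, hv⟩ := ChainOn.exists_extend hR (s := (∅ : Finset Λ))
      (v := fun _ => Classical.arbitrary M) (by simp [ChainOn]) s
    exact ⟨v, trivial, hv.mono Set.subset_union_left⟩
  · obtain ⟨v, hv, -⟩ := h ∅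
    exact hv
  · exact (hs u).imp fun v hv => ⟨hst hv.1, hv.2⟩
  · by_contra hcon
    simp only [chainPositive, Set.mem_ofPred_eq, not_or, not_forall] at hcon
    obtain ⟨⟨s, hs⟩, t, ht⟩ := hcon
    obtain ⟨v, hv, hv'⟩ := hAB (s ∪ t)
    rcases hv with hv | hv
    · exact hs ⟨v, hv, hv'.mono (by simp)⟩
    · exact ht ⟨v, hv, hv'.mono (by simp)⟩

end Chains

section ChainKeep

variable {L : FirstOrder.Language.{u, u}} {M : Type u} [L.Structure M] {J H Λ : Type u}
  {R : M → M → Prop}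

/-- A definable predicate depends on finitely many variables only. -/
theorem Dfn.exists_finset {γ : Type*} {P : (γ → M) → Prop} (h : Dfn L P) :
    ∃ s : Finset γ, ∀ v w, (∀ x ∈ s, v x = w x) → (P v ↔ P w) := by
  classical
  obtain ⟨φ, hφ⟩ := h
  refine ⟨(fv φ).preimage Sum.inr Sum.inr_injective.injOn, fun v w hvw => ?_⟩
  rw [← hφ, ← hφ]
  refine realize_congr_of_eqOn ?_
  rintro (x | x) hx
  · rfl
  · exact hvw x (Finset.mem_preimage.2 hx)

/-- If the sets `Δ` given by chains on large finite sets separated the two sides, then so would the set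
of elements that belong to `Δ` for all chains on the finitely many variables involved. -/
theorem keepsCut_chainPositive [Nonempty M] [LinearOrder Λ]
    (hR : Dfn L fun v : Fin 2 → M => R (v 0) (v 1)) (hRb : FinBetween R) {k : Cut L J M}
    (hk' : k.Unseparated) : KeepsCut H (chainPositive Λ R) k := by
  classical
  intro A Δ hA hΔ hS
  by_contra hcon
  simp only [chainPositive, Set.mem_ofPred_eq, not_exists, not_forall] at hcon
  obtain ⟨sA, hsA⟩ := hA.exists_finset
  obtain ⟨sΔ, hsΔ⟩ := hΔ.exists_finset
  -- the special variables that matter for `A` and `Δ`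
  let s₀ : Finset Λ := sA.preimage Sum.inl Sum.inl_injective.injOn ∪
    sΔ.preimage (fun x => Sum.inl (Sum.inl x)) (fun x _ y _ h => by simpa using h)
  have hsA' : ∀ (v v' : Λ → M) (t : H → M), (∀ x ∈ s₀, v x = v' x) →
      (A (Sum.elim v t) ↔ A (Sum.elim v' t)) := by
    intro v v' t h
    refine hsA _ _ ?_
    rintro (x | x) hx
    · exact h x (Finset.mem_union_left _ (Finset.mem_preimage.2 hx))
    · rfl
  have hsΔ' : ∀ (v v' : Λ → M) (t : H → M) (y : M), (∀ x ∈ s₀, v x = v' x) →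
      (Δ (Sum.elim (Sum.elim v t) fun _ => y) ↔ Δ (Sum.elim (Sum.elim v' t) fun _ => y)) := by
    intro v v' t y h
    refine hsΔ _ _ ?_
    rintro ((x | x) | x) hx
    · exact h x (Finset.mem_union_right _ (Finset.mem_preimage.2 hx))
    · rfl
    · rfl
  -- the elements that belong to the set defined by `Δ` for all solutions that are chains on `s₀`
  let D : M → Prop := fun c => ∀ u : Λ ⊕ H → M, ChainOn R (s₀ : Set Λ) (u ∘ Sum.inl) → A u →
    (∀ x y, k.rel x y → Δ (Sum.elim u fun _ => y) → Δ (Sum.elim u fun _ => x)) ∧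
      Δ (Sum.elim u fun _ => c)
  have hD : Dfn L fun v : Unit → M => D (v ()) := by
    refine Dfn.all (β := Λ ⊕ H) (P := fun w => ChainOn R (s₀ : Set Λ) (w ∘ Sum.inr ∘ Sum.inl) →
      A (w ∘ Sum.inr) → (∀ x y, k.rel x y → Δ (Sum.elim (w ∘ Sum.inr) fun _ => y) →
          Δ (Sum.elim (w ∘ Sum.inr) fun _ => x)) ∧
        Δ (Sum.elim (w ∘ Sum.inr) fun _ => w (Sum.inl ()))) ?_
    have hR2 : ∀ x y : Λ, Dfn L fun w : Unit ⊕ (Λ ⊕ H) → M =>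
        R (w (Sum.inr (Sum.inl x))) (w (Sum.inr (Sum.inl y))) := fun x y =>
      hR.comp ![Sum.inr (Sum.inl x), Sum.inr (Sum.inl y)]
    refine Dfn.imp (Dfn.and ?_ ?_) ((hA.comp Sum.inr).imp (Dfn.and ?_ ?_))
    · exact Dfn.ball s₀ fun x _ => hR2 x x
    · exact Dfn.ball s₀ fun x _ => Dfn.ball s₀ fun y _ => (Dfn.const _).imp
        ((hR2 x y).and (Dfn.eq (Sum.inr (Sum.inr (Sum.inl x))) (Sum.inr (Sum.inr (Sum.inl y)))).not)
    · exact (Dfn.downwardClosed k hΔ).comp Sum.inr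
    · refine (hΔ.comp (Sum.elim Sum.inr fun _ => Sum.inl ())).congr fun w => ?_
      apply iff_of_eq
      congr 1
      funext x
      rcases x with _ | _ <;> rfl
  obtain ⟨i, j, hij⟩ := hk' D hD
  obtain ⟨s, hs⟩ := hcon i j
  have hs' : ∀ v t, ChainOn R (s : Set Λ) v → A (Sum.elim v t) →
      k.Separates (fun x => Δ (Sum.elim (Sum.elim v t) fun _ => x)) i j := by
    intro v t hv hA'
    by_contra hsep
    exact hs v ⟨⟨t, hA', hsep⟩, hv⟩
  refine hij ⟨fun x y hxy hy u hu hAu => ⟨(hy u hu hAu).1, (hy u hu hAu).1 _ _ hxy (hy u hu hAu).2⟩,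
    fun u hu hAu => ?_, fun hb => ?_⟩
  · obtain ⟨v', h1, h2⟩ := hu.exists_extend hRb s
    have hu' : Sum.elim (u ∘ Sum.inl) (u ∘ Sum.inr) = u := Sum.elim_comp_inl_inr u
    have h3 := hs' v' (u ∘ Sum.inr) (h2.mono Set.subset_union_left)
      ((hsA' _ _ _ h1).2 (by rwa [hu']))
    have h4 : ∀ y, Δ (Sum.elim (Sum.elim v' (u ∘ Sum.inr)) fun _ => y) ↔
        Δ (Sum.elim u fun _ => y) := fun y => by rw [hsΔ' _ _ _ y h1, hu']
    simp only [Cut.Separates, h4] at h3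
    exact ⟨h3.1, h3.2.1⟩
  · obtain ⟨v, ⟨t, ht⟩, hv⟩ := hS (s₀ ∪ s)
    rw [Finset.coe_union] at hv
    exact (hs' v t (hv.mono Set.subset_union_right) ht).2.2
      (hb (Sum.elim v t) (hv.mono Set.subset_union_left) ht).2

end ChainKeep

section NewCut

open Cardinal

variable {L : FirstOrder.Language.{u, u}} {M : Type u} [L.Structure M] {H : Type u}

/-- The binary relation defined by a formula with parameters. -/
def defRel (φ : L.Formula (ℕ ⊕ Fin 2)) (c : ℕ → M) (x y : M) : Prop :=
  φ.Realize (Sum.elim c ![x, y])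

theorem dfn_defRel (φ : L.Formula (ℕ ⊕ Fin 2)) (c : ℕ → M) :
    Dfn L fun v : Fin 2 → M => defRel φ c (v 0) (v 1) :=
  (Dfn.of_formula φ c).congr fun v => realize_congr (by
    rintro (_ | i)
    · rfl
    · fin_cases i <;> rfl)

/-- The index set of the new elements: an increasing `κ`-sequence followed by a decreasing one. -/
abbrev CutIndex (κ : Cardinal.{u}) : Type u := Lex (κ.ord.ToType ⊕ (κ.ord.ToType)ᵒᵈ)

/-- The cut formed by the new elements. -/
def newCut (κ : Cardinal.{u}) (φ : L.Formula (ℕ ⊕ Fin 2)) (c : ℕ → M) :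
    Cut L κ.ord.ToType (M ⊕ CutIndex κ) :=
  ⟨φ, Sum.inl ∘ c, fun j => Sum.inr (toLex (Sum.inl j)),
    fun j => Sum.inr (toLex (Sum.inr (OrderDual.toDual j)))⟩

theorem realize_sepForm_newCut {κ : Cardinal.{u}} {φ : L.Formula (ℕ ⊕ Fin 2)} {c : ℕ → M}
    {δ : L.Formula ((M ⊕ (CutIndex κ ⊕ H)) ⊕ Unit)} {i j : κ.ord.ToType} {s : CutIndex κ → M}
    {t : H → M} :
    (((newCut κ φ c).map (Sum.map id Sum.inl)).sepForm δ i j).Realize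
      (Sum.elim id (Sum.elim s t)) ↔
      (∀ x y, defRel φ c x y → δ.Realize (Sum.elim (Sum.elim id (Sum.elim s t)) fun _ => y) →
        δ.Realize (Sum.elim (Sum.elim id (Sum.elim s t)) fun _ => x)) ∧
      δ.Realize (Sum.elim (Sum.elim id (Sum.elim s t)) fun _ => s (toLex (Sum.inl i))) ∧
      ¬ δ.Realize (Sum.elim (Sum.elim id (Sum.elim s t)) fun _ =>
        s (toLex (Sum.inr (OrderDual.toDual j)))) := by
  rw [Cut.realize_sepForm]
  rfl

/-- Of three successive elements between `lo` and `hi`, some two consecutive ones are not separated by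
`δ`. -/
theorem exists_three_between {R : M → M → Prop} (hR : FinBetween R) {lo hi : Finset M}
    (hlo : ∀ x ∈ lo, R x x) (hhi : ∀ x ∈ hi, R x x) (h : ∀ x ∈ lo, ∀ y ∈ hi, StrictRel R x y)
    (δ : M → Prop) :
    ∃ α β, R α α ∧ R β β ∧ StrictRel R α β ∧ (∀ x ∈ lo, StrictRel R x α ∧ StrictRel R x β) ∧
      (∀ x ∈ hi, StrictRel R α x ∧ StrictRel R β x) ∧ ¬ (δ α ∧ ¬ δ β) := by
  classical
  obtain ⟨c₁, h1, h1l, h1h⟩ := hR lo hi hlo hhi h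
  obtain ⟨c₂, h2, h2l, h2h⟩ := hR (insert c₁ lo) hi
    (by simpa [h1] using hlo) hhi (by simpa [h1h] using ⟨h1h, h⟩)
  simp only [Finset.forall_mem_insert] at h2l
  obtain ⟨c₃, h3, h3l, h3h⟩ := hR (insert c₂ lo) hi
    (by simpa [h2] using hlo) hhi (by simpa [h2h] using ⟨h2h, h⟩)
  simp only [Finset.forall_mem_insert] at h3l
  by_cases hδ : δ c₂
  · exact ⟨c₁, c₂, h1, h2, h2l.1, fun x hx => ⟨h1l x hx, h2l.2 x hx⟩,
      fun x hx => ⟨h1h x hx, h2h x hx⟩, fun h => h.2 hδ⟩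
  · exact ⟨c₂, c₃, h2, h3, h3l.1, fun x hx => ⟨h2l.2 x hx, h3l.2 x hx⟩,
      fun x hx => ⟨h2h x hx, h3h x hx⟩, fun h => hδ h.1⟩

/-- The new cut is not separated by `δ`: at an index that occurs neither in `δ` nor in `q`, the two
elements of the cut may be any interpolating pair. -/
theorem good_insert_newCut {κ : Cardinal.{u}} (hκ : κ.IsRegular)
    {φ : L.Formula (ℕ ⊕ Fin 2)} {c : ℕ → M} (hR : FinBetween (defRel φ c))
    (δ : L.Formula ((M ⊕ (CutIndex κ ⊕ H)) ⊕ Unit)) (q : Set (L.Formula (M ⊕ (CutIndex κ ⊕ H))))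
    (hqcard : #q < κ) (hq : Good (chainPositive (CutIndex κ) (defRel φ c)) q) :
    ∃ i j, Good (chainPositive (CutIndex κ) (defRel φ c))
      (insert (((newCut κ φ c).map (Sum.map id Sum.inl)).sepForm δ i j).not q) := by
  classical
  let idx : CutIndex κ → κ.ord.ToType := fun x => (ofLex x).elim id OrderDual.ofDual
  let vars : L.Formula (M ⊕ (CutIndex κ ⊕ H)) → Finset (CutIndex κ) := fun ψ =>
    (fv ψ).preimage (fun x => Sum.inr (Sum.inl x)) (fun x _ y _ h => by simpa using h)
  let varsδ : Finset (CutIndex κ) :=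
    (fv δ).preimage (fun x => Sum.inl (Sum.inr (Sum.inl x))) (fun x _ y _ h => by simpa using h)
  have hne : Nonempty κ.ord.ToType := by
    rw [← mk_ne_zero_iff, mk_ord_toType]; exact hκ.pos.ne'
  -- an index beyond those of all variables that occur
  obtain ⟨j, hj⟩ : ∃ j, (∀ ψ ∈ q, ∀ x ∈ vars ψ, idx x < j) ∧ ∀ x ∈ varsδ, idx x < j := by
    have hb : ∀ s : Finset (CutIndex κ), ∃ i, ∀ x ∈ s, idx x ≤ i := fun s => by
      obtain ⟨i, hi⟩ := (s.image idx).exists_le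
      exact ⟨i, fun x hx => hi _ (Finset.mem_image_of_mem _ hx)⟩
    choose b hb using hb
    obtain ⟨j, hj⟩ := exists_forall_lt_of_isRegular hκ (Y := Option q)
      (by rw [mk_option]
          exact add_lt_of_lt hκ.aleph0_le hqcard (one_lt_aleph0.trans_le hκ.aleph0_le))
      (fun o => b (o.elim varsδ fun ψ => vars ψ.1))
    exact ⟨j, fun ψ hψ x hx => (hb _ x hx).trans_lt (hj (some ⟨ψ, hψ⟩)),
      fun x hx => (hb _ x hx).trans_lt (hj none)⟩
  refine ⟨j, j, fun θ hθ s => ?_⟩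
  set σ := (((newCut κ φ c).map (Sum.map id Sum.inl)).sepForm δ j j).not with hσ
  have hθ' : ∀ ψ ∈ θ.erase σ, ψ ∈ q := fun ψ hψ =>
    (hθ (Finset.mem_of_mem_erase hψ)).resolve_left (Finset.ne_of_mem_erase hψ)
  let s₀ : Finset (CutIndex κ) := (θ.erase σ).biUnion vars ∪ varsδ
  have hs₀ : ∀ x ∈ s₀, idx x < j := by
    intro x hx
    rcases Finset.mem_union.1 hx with hx | hx
    · obtain ⟨ψ, hψ, hx⟩ := Finset.mem_biUnion.1 hx
      exact hj.1 ψ (hθ' ψ hψ) x hx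
    · exact hj.2 x hx
  obtain ⟨v, ⟨t, ht⟩, hv⟩ := hq (θ.erase σ) (fun ψ hψ => hθ' ψ hψ) s₀
  let aj : CutIndex κ := toLex (Sum.inl j)
  let bj : CutIndex κ := toLex (Sum.inr (OrderDual.toDual j))
  have hab : aj < bj := Sum.Lex.inl_lt_inr _ _
  have hside : ∀ x ∈ s₀, x < aj ∨ bj < x := by
    intro x hx
    have := hs₀ x hx
    obtain ⟨x, rfl⟩ := toLex.surjective x
    rcases x with x | x
    · exact Or.inl (Sum.Lex.inl_lt_inl_iff.2 this)
    · exact Or.inr (Sum.Lex.inr_lt_inr_iff.2 this)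
  -- new values for `a j` and `b j` that the set defined by `δ` does not separate; the formulas of `q`
  -- and `δ` do not involve these variables
  obtain ⟨α, β, hα, hβ, hαβ, hlo, hhi, hδ⟩ := exists_three_between hR
    (lo := (s₀.filter (· < aj)).image v) (hi := (s₀.filter (bj < ·)).image v)
    (by simp only [Finset.mem_image, Finset.mem_filter]; rintro _ ⟨y, hy, rfl⟩; exact hv.1 y hy.1)
    (by simp only [Finset.mem_image, Finset.mem_filter]; rintro _ ⟨y, hy, rfl⟩; exact hv.1 y hy.1)
    (by
      simp only [Finset.mem_image, Finset.mem_filter]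
      rintro _ ⟨y, hy, rfl⟩ _ ⟨z, hz, rfl⟩
      exact hv.2 y hy.1 z hz.1 (hy.2.trans (hab.trans hz.2)))
    (fun y => δ.Realize (Sum.elim (Sum.elim id (Sum.elim v t)) fun _ => y))
  have hlo' : ∀ x ∈ s₀, x < aj → _ := fun x hx hxa =>
    hlo (v x) (Finset.mem_image_of_mem _ (Finset.mem_filter.2 ⟨hx, hxa⟩))
  have hhi' : ∀ x ∈ s₀, bj < x → _ := fun x hx hxa =>
    hhi (v x) (Finset.mem_image_of_mem _ (Finset.mem_filter.2 ⟨hx, hxa⟩))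
  let v₁ : CutIndex κ → M := Function.update (Function.update v aj α) bj β
  have hv₁a : v₁ aj = α := by
    simp only [v₁]
    rw [Function.update_of_ne hab.ne, Function.update_self]
  have hv₁b : v₁ bj = β := Function.update_self ..
  have hv₁ : ∀ x ∈ s₀, v₁ x = v x := by
    intro x hx
    have h1 : x ≠ bj := by
      rintro rfl; exact (hside _ hx).elim (fun h => (h.trans hab).false) (fun h => h.false)
    have h2 : x ≠ aj := by
      rintro rfl; exact (hside _ hx).elim (fun h => h.false) (fun h => (h.trans hab).false)
    simp only [v₁]
    rw [Function.update_of_ne h1, Function.update_of_ne h2]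
  have hc₁ : ChainOn (defRel φ c) (insert aj (s₀ : Set (CutIndex κ))) v₁ := by
    refine (hv.congr hv₁).insert_of hα hv₁a (fun y hy hya => ?_) (fun y hy hya => ?_)
    · rw [hv₁ y hy]; exact (hlo' y hy hya).1
    · rw [hv₁ y hy]; exact (hhi' y hy ((hside y hy).resolve_left hya.not_gt)).1
  have hc₂ : ChainOn (defRel φ c) (insert bj (insert aj (s₀ : Set (CutIndex κ)))) v₁ := by
    refine hc₁.insert_of hβ hv₁b (fun y hy hya => ?_) (fun y hy hya => ?_)
    · rcases hy with rfl | hy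
      · rwa [hv₁a]
      · rw [hv₁ y hy]; exact (hlo' y hy ((hside y hy).resolve_right hya.not_gt)).2
    · rcases hy with rfl | hy
      · exact absurd hya hab.not_gt
      · rw [hv₁ y hy]; exact (hhi' y hy hya).2
  have hc₃ : ChainOn (defRel φ c)
      ((insert bj (insert aj s₀) : Finset (CutIndex κ)) : Set (CutIndex κ)) v₁ := by
    rwa [Finset.coe_insert, Finset.coe_insert]
  obtain ⟨w, hw, hws⟩ := hc₃.exists_extend hR s
  have hwa : w aj = α := (hw aj (by simp)).trans hv₁a
  have hwb : w bj = β := (hw bj (by simp)).trans hv₁b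
  have hwv : ∀ x ∈ s₀, w x = v x := fun x hx => (hw x (by simp [hx])).trans (hv₁ x hx)
  refine ⟨w, ⟨t, fun ψ hψ => ?_⟩, hws.mono Set.subset_union_left⟩
  by_cases hψσ : ψ = σ
  · rw [hψσ, hσ, Formula.realize_not, realize_sepForm_newCut]
    rintro ⟨-, h1, h2⟩
    have hcongr : ∀ y, δ.Realize (Sum.elim (Sum.elim id (Sum.elim w t)) fun _ => y) ↔
        δ.Realize (Sum.elim (Sum.elim id (Sum.elim v t)) fun _ => y) := fun y => by
      refine realize_congr_of_eqOn ?_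
      rintro ((x | x | x) | x) hx
      · rfl
      · exact hwv x (Finset.mem_union_right _ (Finset.mem_preimage.2 hx))
      · rfl
      · rfl
    rw [hcongr] at h1 h2
    exact hδ ⟨hwa ▸ h1, hwb ▸ h2⟩
  · have hψ' : ψ ∈ θ.erase σ := Finset.mem_erase.2 ⟨hψσ, hψ⟩
    refine (realize_congr_of_eqOn ?_).1 (ht ψ hψ')
    rintro (x | x | x) hx
    · rfl
    · exact (hwv x (Finset.mem_union_left _
        (Finset.mem_biUnion.2 ⟨ψ, hψ', Finset.mem_preimage.2 hx⟩))).symm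
    · rfl

/-- An elementary extension with a new unfilled cut in a given definable relation, in which given
cuts stay unseparated. -/
theorem exists_extension_cut {κ : Cardinal.{u}} (hκ : κ.IsRegular) (hκ' : ℵ₀ < κ)
    (hL : L.card ≤ κ) [Nonempty M] (hM : #M ≤ κ) (K : Set (Cut L κ.ord.ToType M)) (hKcard : #K ≤ κ)
    (hK : ∀ k ∈ K, k.IsNested ∧ k.Unseparated) {φ : L.Formula (ℕ ⊕ Fin 2)} {c : ℕ → M}
    (hR : FinBetween (defRel φ c)) :
    ∃ (N : Type u) (_ : L.Structure N) (f : M ↪ₑ[L] N) (a b : κ.ord.ToType → N), #N ≤ κ ∧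
      (⟨φ, f ∘ c, a, b⟩ : Cut L κ.ord.ToType N).IsNested ∧
      (⟨φ, f ∘ c, a, b⟩ : Cut L κ.ord.ToType N).Unseparated ∧
      ∀ k ∈ K, (k.map f).Unseparated := by
  classical
  have hS := isPositive_chainPositive (Λ := CutIndex κ) hR
  have hΛ : #(CutIndex κ) ≤ κ := by
    refine mk_sum_le_of_le hκ.aleph0_le (mk_ord_toType κ).le ?_
    exact (mk_ord_toType κ).le
  obtain ⟨N, hN, f, s, hNcard, hs, hcut⟩ := exists_extension hκ hκ' hL hM hΛ
    (H := κ.out) (mk_out κ) hS (insert (newCut κ φ c) (Cut.map Sum.inl '' K))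
    (mk_insert_le.trans (add_le_of_le hκ.aleph0_le (mk_image_le.trans hKcard)
      (one_lt_aleph0.trans hκ').le)) (by
      rintro _ (rfl | ⟨k, hk, rfl⟩) δ q hq hqS
      · exact good_insert_newCut hκ hR δ q hq hqS
      · exact (keepsCut_chainPositive (dfn_defRel φ c) hR (hK k hk).2).exists_good_insert
          hκ hκ' hS (hK k hk).1 δ q hq hqS)
  have hlt : ∀ x y : CutIndex κ, x < y → StrictRel (defRel φ (f ∘ c)) (s x) (s y) := by
    intro x y hxy
    have h1 := hs (φ.relabel (Sum.elim (fun n => Sum.inl (c n)) ![Sum.inr x, Sum.inr y]) ⊓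
        (Term.equal (Term.var (Sum.inr x)) (Term.var (Sum.inr y))).not) (by
      intro hcon
      obtain ⟨v, hv, hv'⟩ := hcon {x, y}
      have := hv'.2 x (by simp) y (by simp) hxy
      refine hv ?_
      rw [Formula.realize_inf, Formula.realize_not, Formula.realize_equal]
      refine ⟨Formula.realize_relabel.2 ((realize_congr ?_).1 this.1), this.2⟩
      rintro (_ | i)
      · rfl
      · fin_cases i <;> rfl)
    rw [Formula.realize_inf, Formula.realize_not, Formula.realize_equal] at h1
    refine ⟨(realize_congr ?_).1 (Formula.realize_relabel.1 h1.1), h1.2⟩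
    rintro (_ | i)
    · rfl
    · fin_cases i <;> rfl
  refine ⟨N, hN, f, fun j => s (toLex (Sum.inl j)),
    fun j => s (toLex (Sum.inr (OrderDual.toDual j))), hNcard, ⟨fun i i' h => ?_, fun j j' h => ?_,
      fun i j => ?_⟩, hcut _ (Set.mem_insert _ _), fun k hk => hcut _ (Or.inr ⟨k, hk, rfl⟩)⟩
  · exact (hlt _ _ (Sum.Lex.inl_lt_inl_iff.2 h)).1
  · exact (hlt _ _ (Sum.Lex.inr_lt_inr_iff.2 h)).1
  · exact hlt _ _ (Sum.Lex.inl_lt_inr _ _)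

end NewCut

/-! ### Elementary chains of structures with protected cuts -/

section CutMaps

variable {L : FirstOrder.Language.{u, u}} {J : Type u}

theorem Cut.map_congr {X Y : Type u} {f g : X → Y} {k : Cut L J X}
    (h : (∀ n, f (k.c n) = g (k.c n)) ∧ (∀ j, f (k.a j) = g (k.a j)) ∧ ∀ j, f (k.b j) = g (k.b j)) :
    k.map f = k.map g := by
  simp only [Cut.map, Cut.mk.injEq, true_and]
  exact ⟨funext h.1, funext h.2.1, funext h.2.2⟩

theorem Cut.rel_map {M N : Type u} [L.Structure M] [L.Structure N] (f : M ↪ₑ[L] N)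
    (k : Cut L J M) (x y : M) : (k.map f).rel (f x) (f y) ↔ k.rel x y := by
  rw [Cut.rel, Cut.rel, ← f.map_formula]
  refine realize_congr ?_
  rintro (_ | i)
  · rfl
  · fin_cases i <;> rfl

theorem Cut.IsNested.map [LT J] {M N : Type u} [L.Structure M] [L.Structure N]
    (f : M ↪ₑ[L] N) {k : Cut L J M} (h : k.IsNested) : (k.map f).IsNested :=
  ⟨fun i i' hi => (k.rel_map f _ _).2 (h.1 i i' hi),
    fun i i' hi => (k.rel_map f _ _).2 (h.2.1 i i' hi),
    fun i j => ⟨(k.rel_map f _ _).2 (h.2.2 i j).1, fun e => (h.2.2 i j).2 (f.injective e)⟩⟩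

end CutMaps

section Stages

open Cardinal

variable {L : FirstOrder.Language.{u, u}} {T : L.Theory} {J W : Type u} [LinearOrder J]

/-- A stage of the construction: an infinite model of `T` enumerated by a set `V` of names, with a
set of cuts, given by names, that are nested and unseparated. -/
structure Stage (T : L.Theory) (J W : Type u) [LinearOrder J] where
  /-- the set of names in use -/
  V : Set W
  /-- the model -/
  M : Type u
  [str : L.Structure M]
  [inf : Infinite M]
  /-- the elements named; the values outside `V` are irrelevant -/
  v : W → M
  surj : ∀ m, ∃ x ∈ V, v x = m
  /-- the protected cuts -/
  K : Set (Cut L J W)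
  mem_V : ∀ k ∈ K, (∀ n, k.c n ∈ V) ∧ (∀ j, k.a j ∈ V) ∧ ∀ j, k.b j ∈ V
  nested : ∀ k ∈ K, (k.map v).IsNested
  unseparated : ∀ k ∈ K, (k.map v).Unseparated
  model : M ⊨ T

attribute [instance] Stage.str Stage.inf

namespace Stage

instance : Preorder (Stage T J W) where
  le p q := p.V ⊆ q.V ∧ p.K ⊆ q.K ∧ ∃ j : p.M ↪ₑ[L] q.M, ∀ x ∈ p.V, j (p.v x) = q.v x
  le_refl p := ⟨subset_rfl, subset_rfl, ElementaryEmbedding.refl L p.M, fun _ _ => rfl⟩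
  le_trans p q r h h' := by
    obtain ⟨h1, h2, j, hj⟩ := h
    obtain ⟨h1', h2', j', hj'⟩ := h'
    refine ⟨h1.trans h1', h2.trans h2', j'.comp j, fun x hx => ?_⟩
    rw [ElementaryEmbedding.comp_apply, hj x hx, hj' x (h1 hx)]

/-- The union of a chain of stages. -/
theorem exists_union {Y : Type u} [LinearOrder Y] [Nonempty Y] {p : Y → Stage T J W}
    (hp : Monotone p) :
    ∃ q : Stage T J W, q.V = (⋃ i, (p i).V) ∧ q.K = (⋃ i, (p i).K) ∧ ∀ i, p i ≤ q := by
  classical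
  let V : Set W := ⋃ i, (p i).V
  let i₀ : Y := Classical.arbitrary Y
  obtain ⟨w₀, hw₀, -⟩ := (p i₀).surj (Classical.arbitrary _)
  -- replaces the names not in use by one that is in use from the stage `i₀` on
  let r : W → W := fun x => if x ∈ V then x else w₀
  have hrV : ∀ x, r x ∈ V := by
    intro x
    by_cases hx : x ∈ V
    · simp only [r, if_pos hx, hx]
    · simp only [r, if_neg hx]
      exact Set.mem_iUnion.2 ⟨i₀, hw₀⟩
  have hr : ∀ x ∈ V, r x = x := fun x hx => if_pos hx
  -- finitely many names occur at some stage
  have hfin : ∀ s : Finset W, ∃ i, ∀ x ∈ s, r x ∈ (p i).V := by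
    intro s
    have : ∀ x, ∃ i, r x ∈ (p i).V := fun x => Set.mem_iUnion.1 (hrV x)
    choose g hg using this
    obtain ⟨i, hi⟩ := (s.image g).exists_le
    exact ⟨i, fun x hx => (hp (hi _ (Finset.mem_image_of_mem g hx))).1 (hg x)⟩
  have hstable : ∀ (φ : L.Formula W) i, (∀ x ∈ fv φ, r x ∈ (p i).V) → ∀ i', i ≤ i' →
      (φ.Realize ((p i).v ∘ r) ↔ φ.Realize ((p i').v ∘ r)) := by
    intro φ i hφ i' hi
    obtain ⟨h1, -, j, hj⟩ := hp hi
    rw [← j.map_formula]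
    exact realize_congr_of_eqOn fun x hx => hj _ (hφ x hx)
  -- the formulas that hold from some stage on
  let G : Set (L.Formula W) := {φ | ∃ i, ∀ i', i ≤ i' → φ.Realize ((p i').v ∘ r)}
  obtain ⟨N, hN, hNstr, v, hv, hvG⟩ := exists_term_model G
    (by
      intro θ hθ
      choose! g hg using hθ
      obtain ⟨i, hi⟩ := (θ.image g).exists_le
      exact ⟨(p i).M, inferInstance, inferInstance, (p i).v ∘ r,
        fun φ hφ => hg φ hφ i (hi _ (Finset.mem_image_of_mem g hφ))⟩)
    (by
      intro φ
      obtain ⟨i, hi⟩ := hfin (fv φ)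
      by_cases h : φ.Realize ((p i).v ∘ r)
      · exact Or.inl ⟨i, fun i' hi' => (hstable φ i hi i' hi').1 h⟩
      · exact Or.inr ⟨i, fun i' hi' => Formula.realize_not.2 fun h' =>
          h ((hstable φ i hi i' hi').2 h')⟩)
    (by
      rintro φ ⟨i₁, h₁⟩
      obtain ⟨i₂, h₂⟩ := hfin ((fv φ).preimage Sum.inl Sum.inl_injective.injOn)
      set i := i₁ ⊔ i₂ with hi
      obtain ⟨a, ha⟩ := Formula.realize_iExs.1 (h₁ i le_sup_left)
      obtain ⟨x, hx, hxa⟩ := (p i).surj (a ())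
      have hrx : r x = x := hr x (Set.mem_iUnion.2 ⟨i, hx⟩)
      refine ⟨x, i, fun i' hi' => ?_⟩
      obtain ⟨-, -, j, hj⟩ := hp hi'
      rw [Formula.realize_relabel]
      rw [← j.map_formula] at ha
      refine (realize_congr_of_eqOn ?_).1 ha
      rintro (y | y) hy
      · exact hj _ ((hp le_sup_right).1 (h₂ y (Finset.mem_preimage.2 hy)))
      · simp only [Function.comp, Sum.elim_inr, hrx]
        rw [← hj x hx, hxa])
  have hvr : ∀ x, v (r x) = v x := by
    intro x
    have h : Term.equal (Term.var (r x)) (Term.var x) ∈ G := by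
      refine ⟨i₀, fun i _ => ?_⟩
      simp only [Formula.realize_equal, Term.realize_var, Function.comp]
      rw [hr _ (hrV x)]
    simpa [Formula.realize_equal] using (hvG _).1 h
  have hle : ∀ i, ∃ j : (p i).M ↪ₑ[L] N, ∀ x ∈ (p i).V, j ((p i).v x) = v x := by
    intro i
    have hVi : ∀ x ∈ (p i).V, r x = x := fun x hx => hr x (Set.mem_iUnion.2 ⟨i, hx⟩)
    choose σ hσ hσ' using (p i).surj
    have key : ∀ {X : Type} (φ : L.Formula X) (x : X → W), (∀ y, x y ∈ (p i).V) →
        (φ.Realize (v ∘ x) ↔ φ.Realize ((p i).v ∘ x)) := by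
      intro X φ x hx
      rw [← Formula.realize_relabel, ← hvG]
      have h : ∀ i', i ≤ i' →
          ((φ.relabel x).Realize ((p i').v ∘ r) ↔ φ.Realize ((p i).v ∘ x)) := by
        intro i' hi'
        obtain ⟨-, -, j, hj⟩ := hp hi'
        rw [← j.map_formula, Formula.realize_relabel]
        exact realize_congr fun y => by simp [hVi _ (hx y), hj _ (hx y)]
      exact ⟨fun ⟨i', h'⟩ => (h _ le_sup_left).1 (h' (i ⊔ i') le_sup_right),
        fun h' => ⟨i, fun i' hi' => (h i' hi').2 h'⟩⟩
    refine ⟨⟨fun m => v (σ m), fun {n} φ x => ?_⟩, fun x hx => ?_⟩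
    · refine (key φ (fun t => σ (x t)) fun t => hσ _).trans ?_
      exact realize_congr fun t => hσ' _
    · have := (key (X := Fin 2) (Term.equal (Term.var 0) (Term.var 1)) ![σ ((p i).v x), x]
        (by intro y; fin_cases y; exacts [hσ _, hx])).2 (by
          simpa [Formula.realize_equal] using hσ' ((p i).v x))
      rw [Formula.realize_equal] at this
      exact this
  obtain ⟨j₀, hj₀⟩ := hle i₀
  have hninf : Infinite N := Infinite.of_injective j₀ j₀.injective
  have hKV : ∀ k ∈ ⋃ i, (p i).K, (∀ n, k.c n ∈ V) ∧ (∀ j, k.a j ∈ V) ∧ ∀ j, k.b j ∈ V := by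
    intro k hk
    obtain ⟨i, hi⟩ := Set.mem_iUnion.1 hk
    have hVi : (p i).V ⊆ V := Set.subset_iUnion (fun i => (p i).V) i
    obtain ⟨h1, h2, h3⟩ := (p i).mem_V k hi
    exact ⟨fun n => hVi (h1 n), fun n => hVi (h2 n), fun n => hVi (h3 n)⟩
  have hmap : ∀ i (j : (p i).M ↪ₑ[L] N), (∀ x ∈ (p i).V, j ((p i).v x) = v x) →
      ∀ k ∈ (p i).K, (k.map (p i).v).map j = k.map v := by
    intro i j hj k hk
    rw [Cut.map_map]
    obtain ⟨h1, h2, h3⟩ := (p i).mem_V k hk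
    exact Cut.map_congr ⟨fun n => hj _ (h1 n), fun n => hj _ (h2 n), fun n => hj _ (h3 n)⟩
  have hsurj : ∀ m, ∃ x ∈ V, v x = m := fun m => by
    obtain ⟨x, rfl⟩ := hv m
    exact ⟨r x, hrV x, hvr x⟩
  refine ⟨⟨V, N, v, hsurj, ⋃ i, (p i).K, hKV, fun k hk => ?_, fun k hk D hD => ?_,
    (j₀.theory_model_iff T).1 (p i₀).model⟩, rfl, rfl,
    fun i => ⟨Set.subset_iUnion (fun i => (p i).V) i, Set.subset_iUnion (fun i => (p i).K) i, hle i⟩⟩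
  · obtain ⟨i, hi⟩ := Set.mem_iUnion.1 hk
    obtain ⟨j, hj⟩ := hle i
    rw [← hmap i j hj k hi]
    exact ((p i).nested k hi).map j
  · -- the parameters of a definable set separating the cut would occur at some stage
    obtain ⟨i₁, h₁⟩ := Set.mem_iUnion.1 hk
    obtain ⟨δ, hδ⟩ := hD
    choose σ hσ hσ' using hsurj
    set δ' : L.Formula (W ⊕ Unit) := δ.relabel (Sum.map σ id) with hδ'
    obtain ⟨i₂, h₂⟩ := hfin ((fv δ').preimage Sum.inl Sum.inl_injective.injOn)
    set i := i₁ ⊔ i₂ with hi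
    have hki : k ∈ (p i).K := (hp le_sup_left).2.1 h₁
    obtain ⟨j, hj⟩ := hle i
    obtain ⟨a, b, hab⟩ := (p i).unseparated k hki
      (fun y => δ'.Realize (Sum.elim ((p i).v ∘ r) fun _ => y)) ((Dfn.of_formula δ' _).congr fun w => Iff.rfl)
    refine ⟨a, b, fun hsep => hab ?_⟩
    rw [← hmap i j hj k hki] at hsep
    have hD' : ∀ y, D (j y) ↔ δ'.Realize (Sum.elim ((p i).v ∘ r) fun _ => y) := by
      intro y
      have h1 : δ'.Realize (Sum.elim v fun _ => j y) ↔ D (j y) := by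
        refine Iff.trans ?_ (hδ fun _ => j y)
        rw [hδ', Formula.realize_relabel]
        refine realize_congr ?_
        rintro (x | x)
        · exact hσ' x
        · rfl
      rw [← h1, ← j.map_formula]
      refine realize_congr_of_eqOn ?_
      rintro (x | x) hx
      · exact ((hj _ ((hp le_sup_right).1 (h₂ x (Finset.mem_preimage.2 hx)))).trans (hvr x)).symm
      · rfl
    refine ⟨fun x y hxy hy => (hD' x).1 (hsep.1 _ _ ((Cut.rel_map j _ _ _).2 hxy) ((hD' y).2 hy)),
      (hD' _).1 hsep.2.1, fun h => hsep.2.2 ((hD' _).2 h)⟩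

end Stage

end Stages

section Construction

open Cardinal

variable {L : FirstOrder.Language.{u, u}} {T : L.Theory} {W : Type u}

theorem FinBetween.of_map {M N : Type u} [L.Structure M] [L.Structure N] (f : M ↪ₑ[L] N)
    {φ : L.Formula (ℕ ⊕ Fin 2)} {c : ℕ → M} (h : FinBetween (defRel φ (f ∘ c))) :
    FinBetween (defRel φ c) := by
  classical
  have hmap : ∀ x y, defRel φ (f ∘ c) (f x) (f y) ↔ defRel φ c x y := fun x y =>
    Cut.rel_map f (⟨φ, c, fun _ : PEmpty => x, fun _ => x⟩ : Cut L PEmpty M) x y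
  have hmap' : ∀ x y, StrictRel (defRel φ (f ∘ c)) (f x) (f y) ↔ StrictRel (defRel φ c) x y :=
    fun x y => and_congr (hmap x y) f.injective.ne_iff
  intro lo hi hlo hhi hlh
  obtain ⟨m, hm, hlom, hhim⟩ := h (lo.image f) (hi.image f) (by simpa [hmap] using hlo)
    (by simpa [hmap] using hhi) (by simpa [hmap'] using hlh)
  simp only [Finset.forall_mem_image] at hlom hhim
  -- the conditions on the element in between
  let σ : M ⊕ Unit → M ⊕ Unit → L.Formula (M ⊕ Unit) := fun x y =>
    φ.relabel (Sum.elim (fun n => Sum.inl (c n)) ![x, y])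
  let τ : M ⊕ Unit → M ⊕ Unit → L.Formula (M ⊕ Unit) := fun x y =>
    σ x y ⊓ (Term.equal (Term.var x) (Term.var y)).not
  have hσ : ∀ {X : Type u} [L.Structure X] (g : M → X) (z : Unit → X) x y,
      (σ x y).Realize (Sum.elim g z) ↔ defRel φ (g ∘ c) (Sum.elim g z x) (Sum.elim g z y) := by
    intro X _ g z x y
    rw [Formula.realize_relabel]
    refine realize_congr ?_
    rintro (_ | i)
    · rfl
    · fin_cases i <;> rfl
  have hτ : ∀ {X : Type u} [L.Structure X] (g : M → X) (z : Unit → X) x y,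
      (τ x y).Realize (Sum.elim g z) ↔
        StrictRel (defRel φ (g ∘ c)) (Sum.elim g z x) (Sum.elim g z y) := by
    intro X _ g z x y
    rw [Formula.realize_inf, hσ, Formula.realize_not, Formula.realize_equal]
    rfl
  obtain ⟨z, hz⟩ := exists_realize_of_map f
    (insert (σ (Sum.inr ()) (Sum.inr ())) (lo.image (fun x => τ (Sum.inl x) (Sum.inr ())) ∪
      hi.image (fun y => τ (Sum.inr ()) (Sum.inl y)))) ⟨fun _ => m, by
    simp only [Finset.forall_mem_insert, Finset.forall_mem_union, Finset.forall_mem_image, hσ, hτ]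
    exact ⟨hm, hlom, hhim⟩⟩
  simp only [Finset.forall_mem_insert, Finset.forall_mem_union, Finset.forall_mem_image, hσ, hτ] at hz
  exact ⟨z (), hz⟩

/-- Names for the elements of an extension. -/
theorem exists_names {lam : Cardinal.{u}} (hlam : ℵ₀ ≤ lam) (hW : lam < #W) {V : Set W}
    (hV : #V ≤ lam) {M N : Type u} (f : M → N) (v : W → M) (hN : #N ≤ lam) [Nonempty N] :
    ∃ (V' : Set W) (v' : W → N), V ⊆ V' ∧ #V' ≤ lam ∧ (∀ x ∈ V, v' x = f (v x)) ∧
      ∀ n, ∃ x ∈ V', v' x = n := by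
  classical
  have h1 : #N ≤ #(Vᶜ : Set W) := by
    have : lam < #(Vᶜ : Set W) := by
      by_contra hcon
      have h2 := mk_sum_compl V
      rw [← h2] at hW
      exact absurd hW (add_le_of_le hlam hV (not_lt.1 hcon)).not_gt
    exact hN.trans this.le
  obtain ⟨e⟩ := h1
  refine ⟨V ∪ Set.range fun n => (e n : W),
    fun x => if hx : x ∈ V then f (v x) else Function.invFun (fun n => (e n : W)) x,
    Set.subset_union_left, ?_, fun x hx => dif_pos hx, fun n => ⟨e n, Or.inr ⟨n, rfl⟩, ?_⟩⟩
  · exact (mk_union_le _ _).trans (add_le_of_le hlam hV (mk_range_le.trans hN))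
  · exact (dif_neg (e n).2).trans
      (Function.leftInverse_invFun (fun a b h => e.injective (Subtype.ext h)) n)

/-- The tasks of the construction: to realise a choice of codes of an array, or to create a cut. -/
abbrev Task (L : FirstOrder.Language.{u, u}) (J W : Type u) : Type u :=
  ((L.Formula (ℕ ⊕ (Unit ⊕ Fin 2)) × L.Formula (ℕ ⊕ (Fin 2 ⊕ Fin 2)) × (ℕ → W)) ×
    (J → Fin 2 → W)) ⊕ (L.Formula (ℕ ⊕ Fin 2) × (ℕ → W))

/-- The task is completed at a stage if its parameters are in use there and it makes sense. -/
def Task.Done {J : Type u} [LinearOrder J] (t : Task L J W) (p : Stage T J W) : Prop :=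
  match t with
  | Sum.inl ((φ, ψ, c), X) => (∀ n, c n ∈ p.V) → (∀ j i, X j i ∈ p.V) → IsArray φ ψ (p.v ∘ c) →
      IsChoice (codeEquiv ψ (p.v ∘ c)) (Set.range fun j => p.v ∘ X j) →
      ∃ z, ∀ j, codeRel φ (p.v ∘ c) z (p.v ∘ X j)
  | Sum.inr (φ, c) => (∀ n, c n ∈ p.V) → FinBetween (defRel φ (p.v ∘ c)) →
      ∃ a b : J → W, ⟨φ, c, a, b⟩ ∈ p.K

/-- The stages of cardinality at most `lam`. -/
def Stage.IsSmall {J : Type u} [LinearOrder J] (lam : Cardinal.{u}) (p : Stage T J W) : Prop :=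
  #p.V ≤ lam ∧ #p.K ≤ lam

theorem Stage.IsSmall.mk_le {J : Type u} [LinearOrder J] {lam : Cardinal.{u}} {p : Stage T J W}
    (hp : p.IsSmall lam) : #p.M ≤ lam := by
  refine le_trans ?_ hp.1
  exact mk_le_of_surjective (f := fun x : p.V => p.v x) fun m =>
    let ⟨x, hx, h⟩ := p.surj m; ⟨⟨x, hx⟩, h⟩

/-- Every small stage has a small extension in which a given task is completed. -/
theorem Task.exists_done {lam : Cardinal.{u}} (hreg : lam.IsRegular) (hlam : ℵ₀ < lam)
    (hL : L.card ≤ lam) (hW : lam < #W) (t : Task L lam.ord.ToType W)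
    (p : Stage T lam.ord.ToType W) (hp : p.IsSmall lam) :
    ∃ q : Stage T lam.ord.ToType W, p ≤ q ∧ q.IsSmall lam ∧ t.Done q := by
  classical
  have hK : ∀ k ∈ Cut.map p.v '' p.K, k.IsNested ∧ k.Unseparated := by
    rintro _ ⟨k, hk, rfl⟩
    exact ⟨p.nested k hk, p.unseparated k hk⟩
  have hKcard : #(Cut.map p.v '' p.K) ≤ lam := mk_image_le.trans hp.2
  -- cuts of the given stage in an extension
  have hcuts : ∀ {N : Type u} [L.Structure N] (f : p.M ↪ₑ[L] N) (v' : W → N),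
      (∀ x ∈ p.V, v' x = f (p.v x)) → ∀ k ∈ p.K, k.map v' = (k.map p.v).map f := by
    intro N _ f v' hv' k hk
    rw [Cut.map_map]
    obtain ⟨h1, h2, h3⟩ := p.mem_V k hk
    exact Cut.map_congr ⟨fun n => hv' _ (h1 n), fun n => hv' _ (h2 n), fun n => hv' _ (h3 n)⟩
  have hmemV : ∀ {V' : Set W}, p.V ⊆ V' → ∀ k ∈ p.K,
      (∀ n, k.c n ∈ V') ∧ (∀ j, k.a j ∈ V') ∧ ∀ j, k.b j ∈ V' := by
    intro V' hV' k hk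
    obtain ⟨h1, h2, h3⟩ := p.mem_V k hk
    exact ⟨fun n => hV' (h1 n), fun n => hV' (h2 n), fun n => hV' (h3 n)⟩
  rcases t with ⟨⟨φ, ψ, c⟩, X⟩ | ⟨φ, c⟩
  · by_cases hyp : (∀ n, c n ∈ p.V) ∧ (∀ j i, X j i ∈ p.V) ∧ IsArray φ ψ (p.v ∘ c) ∧
      IsChoice (codeEquiv ψ (p.v ∘ c)) (Set.range fun j => p.v ∘ X j)
    · obtain ⟨hc, hXV, harr, hch⟩ := hyp
      obtain ⟨N, hN, f, hNcard, ⟨z, hz⟩, hcut⟩ :=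
        exists_extension_array hreg hlam hL hp.mk_le _ hKcard hK harr hch
      have : Infinite N := Infinite.of_injective f f.injective
      obtain ⟨V', v', hVV', hV', hv', hsurj⟩ := exists_names hlam.le hW hp.1 f p.v hNcard
      refine ⟨⟨V', N, v', hsurj, p.K, hmemV hVV', fun k hk => ?_, fun k hk => ?_,
        (f.theory_model_iff T).1 p.model⟩,
        ⟨hVV', subset_rfl, f, fun x hx => (hv' x hx).symm⟩, ⟨hV', hp.2⟩, fun _ _ _ _ => ⟨z, fun j => ?_⟩⟩
      · rw [hcuts f v' hv' k hk]
        exact (p.nested k hk).map f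
      · rw [hcuts f v' hv' k hk]
        exact hcut _ ⟨k, hk, rfl⟩
      · have e1 : v' ∘ c = f ∘ p.v ∘ c := funext fun n => hv' _ (hc n)
        have e2 : v' ∘ X j = f ∘ p.v ∘ X j := funext fun n => hv' _ (hXV j n)
        show codeRel φ (v' ∘ c) z (v' ∘ X j)
        rw [e1, e2]
        exact hz _ ⟨j, rfl⟩
    · exact ⟨p, le_rfl, hp, fun h1 h2 h3 h4 => absurd ⟨h1, h2, h3, h4⟩ hyp⟩
  · by_cases hyp : (∀ n, c n ∈ p.V) ∧ FinBetween (defRel φ (p.v ∘ c))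
    · obtain ⟨hc, hfb⟩ := hyp
      obtain ⟨N, hN, f, a, b, hNcard, hnest, hunsep, hcut⟩ :=
        exists_extension_cut hreg hlam hL hp.mk_le _ hKcard hK hfb
      have : Infinite N := Infinite.of_injective f f.injective
      obtain ⟨V', v', hVV', hV', hv', hsurj⟩ := exists_names hlam.le hW hp.1 f p.v hNcard
      choose σ hσ hσ' using hsurj
      let k₀ : Cut L lam.ord.ToType W := ⟨φ, c, σ ∘ a, σ ∘ b⟩
      have hk₀ : k₀.map v' = ⟨φ, f ∘ p.v ∘ c, a, b⟩ := by
        simp only [k₀, Cut.map, Cut.mk.injEq, true_and]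
        exact ⟨funext fun n => hv' _ (hc n), funext fun j => hσ' _, funext fun j => hσ' _⟩
      refine ⟨⟨V', N, v', fun n => ⟨σ n, hσ n, hσ' n⟩, insert k₀ p.K, ?_, ?_, ?_,
        (f.theory_model_iff T).1 p.model⟩,
        ⟨hVV', Set.subset_insert _ _, f, fun x hx => (hv' x hx).symm⟩,
        ⟨hV', mk_insert_le.trans (add_le_of_le hlam.le hp.2 (one_lt_aleph0.trans hlam).le)⟩,
        fun _ _ => ⟨σ ∘ a, σ ∘ b, Set.mem_insert _ _⟩⟩
      · rintro k (rfl | hk)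
        · exact ⟨fun n => hVV' (hc n), fun j => hσ _, fun j => hσ _⟩
        · exact hmemV hVV' k hk
      · rintro k (rfl | hk)
        · rw [hk₀]; exact hnest
        · rw [hcuts f v' hv' k hk]
          exact (p.nested k hk).map f
      · rintro k (rfl | hk)
        · rw [hk₀]; exact hunsep
        · rw [hcuts f v' hv' k hk]
          exact hcut _ ⟨k, hk, rfl⟩
    · exact ⟨p, le_rfl, hp, fun h1 h2 => absurd ⟨h1, h2⟩ hyp⟩

end Construction

section Limit

open Cardinal

variable {L : FirstOrder.Language.{u, u}}

theorem mk_task_le {lam : Cardinal.{u}} (hlam : ℵ₀ ≤ lam) (hL : L.card ≤ lam)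
    (hgch : (2 : Cardinal.{u}) ^ lam = Order.succ lam) {J W : Type u} (hJ : #J ≤ lam)
    (hW : #W = Order.succ lam) : #(Task L J W) ≤ Order.succ lam := by
  have hs : ℵ₀ ≤ Order.succ lam := hlam.trans (Order.le_succ lam)
  have hpow : ∀ {A : Type u}, #A ≤ lam → #(A → W) ≤ Order.succ lam := by
    intro A hA
    rw [← power_def, hW]
    refine (power_le_power_left (succ_ne_zero lam) hA).trans ?_
    rw [← hgch, ← power_mul, mul_eq_self hlam]
  have hnat : #(ℕ → W) ≤ Order.succ lam := by
    rw [← mk_congr (Equiv.arrowCongr (Equiv.ulift.{u} (α := ℕ)) (Equiv.refl W))]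
    exact hpow (by simpa using hlam)
  have hF : ∀ {A : Type} [Countable A], #(L.Formula A) ≤ Order.succ lam := by
    intro A _
    have e : #(L.Formula A) ≤ #(Σ n, L.BoundedFormula A n) :=
      mk_le_of_injective (f := fun φ => (⟨0, φ⟩ : Σ n, L.BoundedFormula A n))
        fun φ ψ h => by simpa using h
    refine (e.trans (BoundedFormula.card_le.trans (max_le ?_ ?_))).trans (Order.le_succ lam)
    · simpa using hlam
    · refine add_le_of_le hlam ?_ (by simpa using hL)
      have : #A ≤ ℵ₀ := mk_le_aleph0
      exact (lift_le.{u}.2 this).trans (by simpa using hlam)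
  refine mk_sum_le_of_le hs (mk_prod_le_of_le hs (mk_prod_le_of_le hs hF
    (mk_prod_le_of_le hs hF hnat)) ?_) (mk_prod_le_of_le hs hF hnat)
  have : #(J → Fin 2 → W) = #(J × ULift.{u} (Fin 2) → W) :=
    mk_congr ((Equiv.arrowCongr (Equiv.refl J)
      (Equiv.arrowCongr Equiv.ulift.symm (Equiv.refl W))).trans (Equiv.curry _ _ _).symm)
  rw [this]
  exact hpow (mk_prod_le_of_le hlam hJ ((lt_aleph0_of_finite _).le.trans hlam))

/-- An enumeration in which every task occurs cofinally often. -/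
theorem exists_cofinal_enumeration {κ : Cardinal.{u}} (hκ : ℵ₀ ≤ κ) {A : Type u} [Nonempty A]
    (hA : #A ≤ κ) :
    ∃ e : κ.ord.ToType → A, ∀ a i, ∃ i', i ≤ i' ∧ e i' = a := by
  have hne : Nonempty κ.ord.ToType := by
    rw [← mk_ne_zero_iff, mk_ord_toType]
    exact (aleph0_pos.trans_le hκ).ne'
  obtain ⟨g, hg⟩ := exists_surjective_of_mk_le (A := κ.ord.ToType × A) (B := κ.ord.ToType)
    (by rw [mk_ord_toType]; exact mk_prod_le_of_le hκ (mk_ord_toType κ).le hA)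
  refine ⟨fun i => (g i).2, fun a i => ?_⟩
  by_contra! hcon
  have h1 : κ.ord.ToType ↪ Set.Iio i := by
    refine ⟨fun x => ⟨(hg (x, a)).choose, ?_⟩, fun x y hxy => ?_⟩
    · by_contra h
      exact hcon _ (not_lt.1 h) (by rw [(hg (x, a)).choose_spec])
    · have := congrArg (fun z : Set.Iio i => (g z.1).1) hxy
      simpa [(hg (x, a)).choose_spec, (hg (y, a)).choose_spec] using this
  have h2 := mk_le_of_injective h1.injective
  rw [mk_ord_toType] at h2
  exact absurd (mk_Iio_ord_toType_lt i) h2.not_gt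

/-- A complete theory with infinite models has a model of cardinality `lam⁺` in which all choices of
at most `lam` codes of an array are realised, while every definable relation that allows
interpolation between finite sets has an unfilled cut. -/
theorem exists_model_arrays_cuts {lam : Cardinal.{u}} (hreg : lam.IsRegular) (hlam : ℵ₀ < lam)
    (hgch : (2 : Cardinal.{u}) ^ lam = Order.succ lam) (hL : L.card ≤ lam) {T : L.Theory}
    {M₀ : Type u} [L.Structure M₀] [Infinite M₀] (hM₀ : M₀ ⊨ T) :
    ∃ (M : Type u) (_ : L.Structure M), M ⊨ T ∧ #M = Order.succ lam ∧
      (∀ (φ : L.Formula (ℕ ⊕ (Unit ⊕ Fin 2))) (ψ : L.Formula (ℕ ⊕ (Fin 2 ⊕ Fin 2)))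
        (c : ℕ → M), IsArray φ ψ c → ∀ X : Set (Fin 2 → M), #X ≤ lam →
        IsChoice (codeEquiv ψ c) X → ∃ z, ∀ d ∈ X, codeRel φ c z d) ∧
      ∀ (φ : L.Formula (ℕ ⊕ Fin 2)) (c : ℕ → M), FinBetween (defRel φ c) → ∃ a b : lam.ord.ToType → M,
        (⟨φ, c, a, b⟩ : Cut L lam.ord.ToType M).IsNested ∧
        (⟨φ, c, a, b⟩ : Cut L lam.ord.ToType M).Unseparated := by
  classical
  let ι := (Order.succ lam).ord.ToType
  have hι : #ι = Order.succ lam := mk_ord_toType _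
  have hsreg : (Order.succ lam).IsRegular := isRegular_succ hlam.le
  have hW : lam < #ι := by rw [hι]; exact Order.lt_succ lam
  have hJ : #lam.ord.ToType = lam := mk_ord_toType lam
  have hJne : Nonempty lam.ord.ToType := by
    rw [← mk_ne_zero_iff, hJ]; exact hreg.pos.ne'
  have hιne : Nonempty ι := by
    rw [← mk_ne_zero_iff, hι]; exact succ_ne_zero lam
  have hιinf : Infinite ι := by
    rw [infinite_iff, hι]; exact hsreg.aleph0_le
  -- the first stage
  obtain ⟨N₀, hemb, hN₀card⟩ := exists_elementaryEmbedding_card_eq L M₀ lam hlam.le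
    (by simpa using hL)
  have hN₀T : N₀ ⊨ T := by
    rcases hemb with ⟨⟨f⟩⟩ | ⟨⟨f⟩⟩
    · exact (f.theory_model_iff T).2 hM₀
    · exact (f.theory_model_iff T).1 hM₀
  have : Infinite N₀ := by rw [infinite_iff, hN₀card]; exact hlam.le
  obtain ⟨V₀, v₀, -, hV₀, -, hsurj₀⟩ := exists_names (W := ι) hlam.le hW (V := ∅) (M := N₀) (N := N₀)
    (by simp) id (fun _ => Classical.arbitrary N₀) hN₀card.le
  let p₀ : Stage T lam.ord.ToType ι := ⟨V₀, N₀, v₀, hsurj₀, ∅, by simp, by simp, by simp, hN₀T⟩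
  have hp₀ : p₀.IsSmall lam := ⟨hV₀, by simp [p₀]⟩
  -- the tasks
  have hTask : Nonempty (Task L lam.ord.ToType ι) :=
    ⟨Sum.inr (⊥, fun _ => Classical.arbitrary ι)⟩
  obtain ⟨e, he⟩ := exists_cofinal_enumeration (κ := Order.succ lam) hsreg.aleph0_le
    (mk_task_le hlam.le hL hgch hJ.le hι)
  let P := {p : Stage T lam.ord.ToType ι // p.IsSmall lam}
  obtain ⟨f, hf, hfD⟩ := exists_monotone_meeting (ι := ι) (P := P)
    (by
      intro i f hf
      rcases isEmpty_or_nonempty (Set.Iio i) with hi | hi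
      · exact ⟨⟨p₀, hp₀⟩, fun j => hi.elim j⟩
      · obtain ⟨q, hqV, hqK, hq⟩ := Stage.exists_union (p := fun j => (f j).1) hf
        have hi' : #(Set.Iio i) ≤ lam := Order.lt_succ_iff.1 (mk_Iio_ord_toType_lt i)
        have hU : ∀ {A : Type u} (s : Set.Iio i → Set A), (∀ j, #(s j) ≤ lam) →
            #(⋃ j, s j) ≤ lam := by
          intro A s hs
          refine (mk_iUnion_le_sum_mk.trans (sum_le_sum _ (fun _ => lam) hs)).trans ?_
          rw [sum_const, lift_id, lift_id]
          exact mul_le_of_le hlam.le hi' le_rfl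
        exact ⟨⟨q, by rw [hqV]; exact hU _ fun j => (f j).2.1,
          by rw [hqK]; exact hU _ fun j => (f j).2.2⟩, hq⟩)
    (fun i p => (e i).Done p.1)
    (by
      intro i p
      obtain ⟨q, hpq, hq, hd⟩ := (e i).exists_done hreg hlam hL hW p.1 p.2
      exact ⟨⟨q, hq⟩, hpq, hd⟩)
  obtain ⟨q, hqV, hqK, hq⟩ := Stage.exists_union (p := fun i => (f i).1) hf
  -- few names occur at some stage
  have hstage : ∀ {Y : Type u} (g : Y → ι), #Y ≤ lam → (∀ y, g y ∈ q.V) →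
      ∃ i, ∀ y, g y ∈ (f i).1.V := by
    intro Y g hY hg
    have : ∀ y, ∃ i, g y ∈ (f i).1.V := fun y => by
      have := hg y
      rw [hqV] at this
      exact Set.mem_iUnion.1 this
    choose s hs using this
    obtain ⟨i, hi⟩ := exists_forall_lt_of_isRegular hsreg (Order.lt_succ_iff.2 hY) s
    exact ⟨i, fun y => (hf (hi y).le).1 (hs y)⟩
  have hstageN : ∀ (g : ℕ → ι), (∀ y, g y ∈ q.V) → ∃ i, ∀ y, g y ∈ (f i).1.V := by
    intro g hg
    obtain ⟨i, hi⟩ := hstage (fun y : ULift.{u} ℕ => g y.down) (by simpa using hlam.le)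
      fun y => hg _
    exact ⟨i, fun n => hi ⟨n⟩⟩
  choose σ hσ hσ' using q.surj
  have harrays : ∀ (φ : L.Formula (ℕ ⊕ (Unit ⊕ Fin 2)))
      (ψ : L.Formula (ℕ ⊕ (Fin 2 ⊕ Fin 2))) (c : ℕ → q.M), IsArray φ ψ c → ∀ X : Set (Fin 2 → q.M), #X ≤ lam →
        IsChoice (codeEquiv ψ c) X → ∃ z, ∀ d ∈ X, codeRel φ c z d := by
    intro φ ψ c harr X hX hch
    rcases X.eq_empty_or_nonempty with rfl | hXne
    · exact ⟨Classical.arbitrary _, by simp⟩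
    have := hXne.to_subtype
    obtain ⟨x, hx⟩ := exists_surjective_of_mk_le (A := X) (B := lam.ord.ToType) (by rwa [hJ])
    obtain ⟨i₁, hi₁⟩ := hstageN (σ ∘ c) fun n => hσ _
    obtain ⟨i₂, hi₂⟩ := hstage (fun y : lam.ord.ToType × ULift.{u} (Fin 2) => σ ((x y.1).1 y.2.down))
      (mk_prod_le_of_le hlam.le hJ.le ((lt_aleph0_of_finite _).le.trans hlam.le)) fun y => hσ _
    obtain ⟨i, hi, hei⟩ := he (Sum.inl ((φ, ψ, σ ∘ c), fun j n => σ ((x j).1 n))) (i₁ ⊔ i₂)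
    have hd := hfD i
    rw [hei] at hd
    obtain ⟨-, -, j, hj⟩ := hq i
    have hcV : ∀ n, (σ ∘ c) n ∈ (f i).1.V := fun n => (hf (le_sup_left.trans hi)).1 (hi₁ n)
    have hxV : ∀ k n, σ ((x k).1 n) ∈ (f i).1.V := fun k n =>
      (hf (le_sup_right.trans hi)).1 (hi₂ (k, ⟨n⟩))
    have e1 : j ∘ (f i).1.v ∘ σ ∘ c = c := funext fun n => (hj _ (hcV n)).trans (hσ' _)
    have e2 : ∀ k, j ∘ (f i).1.v ∘ (fun n => σ ((x k).1 n)) = (x k).1 := fun k =>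
      funext fun n => (hj _ (hxV k n)).trans (hσ' _)
    obtain ⟨z, hz⟩ := hd hcV hxV (IsArray.of_map j (by rwa [e1])) (by
      rw [← isChoice_map j, e1]
      convert hch
      ext d
      simp only [Set.mem_image, Set.mem_range, exists_exists_eq_and, e2]
      constructor
      · rintro ⟨k, rfl⟩
        exact (x k).2
      · intro hd
        obtain ⟨k, hk⟩ := hx ⟨d, hd⟩
        exact ⟨k, by rw [hk]⟩)
    refine ⟨j z, fun d hd => ?_⟩
    obtain ⟨k, hk⟩ := hx ⟨d, hd⟩
    have := (codeRel_map j φ _ _ _).2 (hz k)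
    rw [e1, e2, hk] at this
    exact this
  refine ⟨q.M, inferInstance, q.model, le_antisymm ?_ ?_, harrays, fun φ c hfb => ?_⟩
  · rw [← hι]
    exact mk_le_of_surjective (f := q.v) fun m => let ⟨x, _, h⟩ := q.surj m; ⟨x, h⟩
  · -- the inequation `z ≠ d` is an array
    rw [Order.succ_le_iff]
    by_contra hcon
    obtain ⟨m₀⟩ : Nonempty q.M := inferInstance
    let φ : L.Formula (ℕ ⊕ (Unit ⊕ Fin 2)) :=
      (Term.equal (Term.var (Sum.inr (Sum.inl ()))) (Term.var (Sum.inr (Sum.inr 0)))).not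
    let ψ : L.Formula (ℕ ⊕ (Fin 2 ⊕ Fin 2)) :=
      Term.equal (Term.var (Sum.inr (Sum.inl 0))) (Term.var (Sum.inr (Sum.inr 0))) ⊓
      Term.equal (Term.var (Sum.inr (Sum.inl 1))) (Term.var (Sum.inr (Sum.inr 1)))
    have hφ : ∀ (c : ℕ → q.M) z d, codeRel φ c z d ↔ z ≠ d 0 := by
      intro c z d
      simp [φ, codeRel, Formula.realize_not, Formula.realize_equal]
    have hψ : ∀ (c : ℕ → q.M) d d', codeEquiv ψ c d d' ↔ d = d' := by
      intro c d d'
      simp [ψ, codeEquiv, Formula.realize_inf, Formula.realize_equal, funext_iff, Fin.forall_fin_two]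
    obtain ⟨z, hz⟩ := harrays φ ψ (fun _ => m₀)
      ⟨fun d d' h => by rw [hψ] at *; exact h.symm,
        fun d d' d'' h h' => by rw [hψ] at *; exact h.trans h', fun h _ => by
          obtain ⟨z, hz⟩ := Infinite.exists_notMem_finset (h.image fun d => d 0)
          refine ⟨z, fun d hd => (hφ _ _ _).2 ?_⟩
          rintro rfl
          exact hz (Finset.mem_image_of_mem _ hd)⟩ (Set.range fun m _ => m)
      (mk_range_le.trans (not_lt.1 hcon))
      ⟨fun d _ => (hψ _ _ _).2 rfl, fun d _ d' _ h => (hψ _ _ _).1 h⟩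
    exact (hφ _ _ _).1 (hz _ ⟨z, rfl⟩) rfl
  · obtain ⟨i₁, hi₁⟩ := hstageN (σ ∘ c) fun n => hσ _
    obtain ⟨i, hi, hei⟩ := he (Sum.inr (φ, σ ∘ c)) i₁
    have hd := hfD i
    rw [hei] at hd
    obtain ⟨-, hK, j, hj⟩ := hq i
    have hcV : ∀ n, (σ ∘ c) n ∈ (f i).1.V := fun n => (hf hi).1 (hi₁ n)
    have e1 : j ∘ (f i).1.v ∘ σ ∘ c = c := funext fun n => (hj _ (hcV n)).trans (hσ' _)
    obtain ⟨a, b, hab⟩ := hd hcV (FinBetween.of_map j (by rwa [e1]))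
    have e2 : (⟨φ, σ ∘ c, a, b⟩ : Cut L lam.ord.ToType ι).map q.v = ⟨φ, c, q.v ∘ a, q.v ∘ b⟩ := by
      simp only [Cut.map, Cut.mk.injEq, true_and, and_true]
      exact funext fun n => hσ' _
    refine ⟨q.v ∘ a, q.v ∘ b, ?_, ?_⟩
    · rw [← e2]; exact q.nested _ (hK hab)
    · rw [← e2]; exact q.unseparated _ (hK hab)

end Limit

/-! ### The theory `T_feq⁺` and its generic models -/

section FeqBasic

variable {M : Type*} [Lfeq.Structure M]

/-- `x` belongs to `P`. -/
def IsP (x : M) : Prop := Structure.RelMap relP ![x]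

/-- `x` belongs to `Q`. -/
def IsQ (x : M) : Prop := Structure.RelMap relQ ![x]

/-- `x` and `y` are `E`-equivalent. -/
def RelE (x y : M) : Prop := Structure.RelMap relE ![x, y]

/-- `x R z`. -/
def RelR (x z : M) : Prop := Structure.RelMap relR ![x, z]

/-- `F(x, z) = y`. -/
def RelF (x z y : M) : Prop := Structure.RelMap relF ![x, z, y]

/-- The elements `a` and `b` of `P` choose the same element of the class of `y`, that is
`F(y, a) = F(y, b)`. -/
def RelS (y a b : M) : Prop := ∃ u, RelE y u ∧ RelR u a ∧ RelR u b

/-- The models of `T_feq⁺`: an equivalence relation on `Q`, of which every element of `P` chooses one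
element in each class. -/
structure IsFeqPlus (M : Type*) [Lfeq.Structure M] : Prop where
  isQ_iff : ∀ x : M, IsQ x ↔ ¬ IsP x
  isQ_of_E : ∀ {x y : M}, RelE x y → IsQ x
  refl : ∀ {x : M}, IsQ x → RelE x x
  symm : ∀ {x y : M}, RelE x y → RelE y x
  trans : ∀ {x y z : M}, RelE x y → RelE y z → RelE x z
  isQ_of_R : ∀ {x z : M}, RelR x z → IsQ x
  isP_of_R : ∀ {x z : M}, RelR x z → IsP z
  unique : ∀ {x y z : M}, RelR x z → RelR y z → RelE x y → x = y
  total : ∀ {x z : M}, IsQ x → IsP z → ∃ y, RelE x y ∧ RelR y z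
  relF_iff : ∀ x z y : M, RelF x z y ↔ RelE x y ∧ RelR y z

theorem isFeqPlus_iff : IsFeqPlus M ↔ M ⊨ TfeqPlus := by
  rw [model_TfeqPlus_iff]
  constructor
  · intro h
    refine ⟨fun x hx => (h.isQ_iff x).1 hx.2 hx.1, fun x => ?_,
      fun x y hxy => ⟨h.isQ_of_E hxy, h.isQ_of_E (h.symm hxy)⟩, fun x => h.refl, fun x y => h.symm,
      fun x y z hh => h.trans hh.1 hh.2, fun x z hh => ⟨h.isQ_of_R hh, h.isP_of_R hh⟩,
      fun x y z hh => h.unique hh.1.1 hh.1.2 hh.2, fun x z y hh => ?_, fun x z y y' hh => ?_,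
      fun x z y hh => ?_, fun x z hh => ?_⟩
    · exact (em _).imp id (h.isQ_iff x).2
    · obtain ⟨h1, h2⟩ := (h.relF_iff _ _ _).1 hh
      exact ⟨⟨h.isQ_of_E h1, h.isP_of_R h2⟩, h.isQ_of_R h2⟩
    · obtain ⟨h1, h2⟩ := (h.relF_iff _ _ _).1 hh.1
      obtain ⟨h3, h4⟩ := (h.relF_iff _ _ _).1 hh.2
      exact h.unique h2 h4 (h.trans (h.symm h1) h3)
    · exact ((h.relF_iff _ _ _).1 hh).symm
    · obtain ⟨y, hy⟩ := h.total hh.1 hh.2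
      exact ⟨y, (h.relF_iff _ _ _).2 hy⟩
  · rintro ⟨h1, h2, h3, h4, h5, h6, h7, h8, h9, h10, h11, h12⟩
    refine ⟨fun x => ⟨fun hq hp => h1 x ⟨hp, hq⟩, fun hp => (h2 x).resolve_left hp⟩,
      fun h => (h3 _ _ h).1, h4 _, h5 _ _, fun h h' => h6 _ _ _ ⟨h, h'⟩, fun h => (h7 _ _ h).1,
      fun h => (h7 _ _ h).2, fun h h' h'' => h8 _ _ _ ⟨⟨h, h'⟩, h''⟩, fun hq hp => ?_,
      fun x z y => ⟨fun h => (h11 _ _ _ h).symm, fun h => ?_⟩⟩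
    · obtain ⟨y, hy⟩ := h12 _ _ ⟨hq, hp⟩
      exact ⟨y, (h11 _ _ _ hy).symm⟩
    · obtain ⟨y', hy'⟩ := h12 x z ⟨(h3 _ _ h.1).1, (h7 _ _ h.2).2⟩
      have := h11 _ _ _ hy'
      rw [h8 _ _ _ ⟨⟨h.2, this.1⟩, h6 _ _ _ ⟨h5 _ _ h.1, this.2⟩⟩]
      exact hy'

theorem RelS.symm {y a b : M} (h : RelS y a b) : RelS y b a :=
  let ⟨u, h1, h2, h3⟩ := h; ⟨u, h1, h3, h2⟩

namespace IsFeqPlus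

variable (hM : IsFeqPlus M)
include hM

theorem not_isP_of_isQ {x : M} (h : IsQ x) : ¬ IsP x := (hM.isQ_iff x).1 h

theorem relS_iff {y a b u : M} (h1 : RelE y u) (h2 : RelR u a) : RelS y a b ↔ RelR u b :=
  ⟨fun ⟨_, h1', h2', h3'⟩ =>
    hM.unique h2' h2 (hM.trans (hM.symm h1') h1) ▸ h3', fun h => ⟨u, h1, h2, h⟩⟩

theorem relS_congr {y y' a b : M} (h : RelE y y') : RelS y a b ↔ RelS y' a b :=
  ⟨fun ⟨u, h1, h2⟩ => ⟨u, hM.trans (hM.symm h) h1, h2⟩, fun ⟨u, h1, h2⟩ => ⟨u, hM.trans h h1, h2⟩⟩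

theorem relS_trans {y a b c : M} (h : RelS y a b) (h' : RelS y b c) : RelS y a c := by
  obtain ⟨u, h1, h2, h3⟩ := h
  exact (hM.relS_iff h1 h2).2 ((hM.relS_iff h1 h3).1 h')

theorem relS_self {y a : M} (hy : IsQ y) (ha : IsP a) : RelS y a a :=
  let ⟨u, h1, h2⟩ := hM.total hy ha; ⟨u, h1, h2, h2⟩

end IsFeqPlus

end FeqBasic

section FeqExt

open Cardinal

/-- The generic models of `T_feq⁺`, up to `κ`: from fewer than `κ` classes, some element of `P` makes
prescribed choices, the classes have at least `κ` elements, and for fewer than `κ` elements of `P`, some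
class outside fewer than `κ` given ones identifies their choices as an equivalence relation `r`
prescribes. -/
structure IsFeqGeneric (κ : Cardinal.{u}) (N : Type u) [Lfeq.Structure N] : Prop where
  exists_isP : ∀ X : Set N, #X < κ → (∀ x ∈ X, IsQ x) → (∀ x ∈ X, ∀ y ∈ X, RelE x y → x = y) →
    ∃ z, IsP z ∧ ∀ x ∈ X, RelR x z
  exists_relE : ∀ c : N, IsQ c → ∀ X : Set N, #X < κ → ∃ y, RelE c y ∧ y ∉ X
  exists_isQ : ∀ A X : Set N, #A < κ → #X < κ → (∀ a ∈ A, IsP a) → ∀ r : N → N → Prop,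
    (∀ a ∈ A, r a a) → (∀ a b, r a b → r b a) → (∀ a b c, r a b → r b c → r a c) →
    ∃ y, IsQ y ∧ (∀ a ∈ A, ∀ b ∈ A, RelS y a b ↔ r a b) ∧ ∀ x ∈ X, ¬ RelE y x

/-- Two families have the same diagram with respect to `P`, `E`, `R` and `F`, where only equations
between values of `F` are taken into account. -/
structure FeqSim {γ : Type*} {M N : Type*} [Lfeq.Structure M] [Lfeq.Structure N]
    (v : γ → M) (w : γ → N) : Prop where
  eq : ∀ i j, v i = v j ↔ w i = w j
  isP : ∀ i, IsP (v i) ↔ IsP (w i)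
  relE : ∀ i j, RelE (v i) (v j) ↔ RelE (w i) (w j)
  relR : ∀ i j, RelR (v i) (v j) ↔ RelR (w i) (w j)
  relS : ∀ i j k, RelS (v i) (v j) (v k) ↔ RelS (w i) (w j) (w k)

variable {γ : Type*} {M N : Type u} [Lfeq.Structure M] [Lfeq.Structure N]

theorem FeqSim.symm {v : γ → M} {w : γ → N} (h : FeqSim v w) : FeqSim w v :=
  ⟨fun i j => (h.eq i j).symm, fun i => (h.isP i).symm, fun i j => (h.relE i j).symm,
    fun i j => (h.relR i j).symm, fun i j k => (h.relS i j k).symm⟩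

theorem FeqSim.comp {γ' : Type*} {v : γ → M} {w : γ → N} (h : FeqSim v w) (f : γ' → γ) :
    FeqSim (v ∘ f) (w ∘ f) :=
  ⟨fun _ _ => h.eq _ _, fun _ => h.isP _, fun _ _ => h.relE _ _,
    fun _ _ => h.relR _ _, fun _ _ _ => h.relS _ _ _⟩

/-- The conditions on a new element of `P`. -/
theorem FeqSim.option_of_isP (hM : IsFeqPlus M) (hN : IsFeqPlus N) {v : γ → M} {w : γ → N}
    (h : FeqSim v w) {x : M} {y : N} (hx : IsP x) (hy : IsP y) (hvx : ∀ i, v i ≠ x)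
    (hwy : ∀ i, w i ≠ y) (hR : ∀ i, RelR (v i) x ↔ RelR (w i) y)
    (hS : ∀ i j, RelS (v i) x (v j) ↔ RelS (w i) y (w j)) :
    FeqSim (fun o : Option γ => o.elim x v) (fun o => o.elim y w) := by
  have hQ : ∀ i, IsQ (v i) ↔ IsQ (w i) := fun i => by rw [hM.isQ_iff, hN.isQ_iff, h.isP]
  have nE1 : ∀ a, ¬ RelE x a := fun a h => hM.not_isP_of_isQ (hM.isQ_of_E h) hx
  have nE2 : ∀ a, ¬ RelE y a := fun a h => hN.not_isP_of_isQ (hN.isQ_of_E h) hy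
  have nE1' : ∀ a, ¬ RelE a x := fun a h => nE1 a (hM.symm h)
  have nE2' : ∀ a, ¬ RelE a y := fun a h => nE2 a (hN.symm h)
  have nR1 : ∀ a, ¬ RelR x a := fun a h => hM.not_isP_of_isQ (hM.isQ_of_R h) hx
  have nR2 : ∀ a, ¬ RelR y a := fun a h => hN.not_isP_of_isQ (hN.isQ_of_R h) hy
  have nS1 : ∀ a b, ¬ RelS x a b := fun a b ⟨u, h, _⟩ => nE1 _ h
  have nS2 : ∀ a b, ¬ RelS y a b := fun a b ⟨u, h, _⟩ => nE2 _ h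
  have hSs : ∀ i, RelS (v i) x x ↔ RelS (w i) y y := fun i => by
    constructor
    · rintro ⟨u, h1, -⟩
      exact hN.relS_self ((hQ i).1 (hM.isQ_of_E h1)) hy
    · rintro ⟨u, h1, -⟩
      exact hM.relS_self ((hQ i).2 (hN.isQ_of_E h1)) hx
  refine ⟨?_, ?_, ?_, ?_, ?_⟩
  · rintro (_ | i) (_ | j)
    · simp
    · simp [(hvx j).symm, (hwy j).symm]
    · simp [hvx i, hwy i]
    · exact h.eq i j
  · rintro (_ | i)
    · simp [hx, hy]
    · exact h.isP i
  · rintro (_ | i) (_ | j)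
    · simp [nE1, nE2]
    · simp [nE1, nE2]
    · simp [nE1', nE2']
    · exact h.relE i j
  · rintro (_ | i) (_ | j)
    · simp [nR1, nR2]
    · simp [nR1, nR2]
    · exact hR i
    · exact h.relR i j
  · rintro (_ | i) (_ | j) (_ | k)
    · simp [nS1, nS2]
    · simp [nS1, nS2]
    · simp [nS1, nS2]
    · simp [nS1, nS2]
    · exact hSs i
    · exact hS i k
    · exact ⟨fun h => RelS.symm ((hS i j).1 h.symm),
        fun h => RelS.symm ((hS i j).2 h.symm)⟩
    · exact h.relS i j k

/-- The conditions on a new element of `Q`. -/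
theorem FeqSim.option_of_isQ (hM : IsFeqPlus M) (hN : IsFeqPlus N) {v : γ → M} {w : γ → N}
    (h : FeqSim v w) {x : M} {y : N} (hx : IsQ x) (hy : IsQ y) (hvx : ∀ i, v i ≠ x)
    (hwy : ∀ i, w i ≠ y) (hE : ∀ i, RelE x (v i) ↔ RelE y (w i))
    (hR : ∀ i, RelR x (v i) ↔ RelR y (w i)) (hS : ∀ i j, RelS x (v i) (v j) ↔ RelS y (w i) (w j)) :
    FeqSim (fun o : Option γ => o.elim x v) (fun o => o.elim y w) := by
  have hxP := hM.not_isP_of_isQ hx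
  have hyP := hN.not_isP_of_isQ hy
  have nR1 : ∀ a, ¬ RelR a x := fun a h => hxP (hM.isP_of_R h)
  have nR2 : ∀ a, ¬ RelR a y := fun a h => hyP (hN.isP_of_R h)
  have nS1 : ∀ a b, ¬ RelS a x b := fun a b ⟨u, _, h, _⟩ => nR1 _ h
  have nS2 : ∀ a b, ¬ RelS a y b := fun a b ⟨u, _, h, _⟩ => nR2 _ h
  have nS1' : ∀ a b, ¬ RelS a b x := fun a b ⟨u, _, _, h⟩ => nR1 _ h
  have nS2' : ∀ a b, ¬ RelS a b y := fun a b ⟨u, _, _, h⟩ => nR2 _ h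
  refine ⟨?_, ?_, ?_, ?_, ?_⟩
  · rintro (_ | i) (_ | j)
    · simp
    · simp [(hvx j).symm, (hwy j).symm]
    · simp [hvx i, hwy i]
    · exact h.eq i j
  · rintro (_ | i)
    · simp [hxP, hyP]
    · exact h.isP i
  · rintro (_ | i) (_ | j)
    · simp [hM.refl hx, hN.refl hy]
    · exact hE j
    · exact ⟨fun h => hN.symm ((hE i).1 (hM.symm h)), fun h => hM.symm ((hE i).2 (hN.symm h))⟩
    · exact h.relE i j
  · rintro (_ | i) (_ | j)
    · simp [nR1, nR2]
    · exact hR j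
    · simp [nR1, nR2]
    · exact h.relR i j
  · rintro (_ | i) (_ | j) (_ | k)
    · simp [nS1, nS2]
    · simp [nS1, nS2]
    · simp [nS1', nS2']
    · exact hS j k
    · simp [nS1, nS2]
    · simp [nS1, nS2]
    · simp [nS1', nS2']
    · exact h.relS i j k

theorem mk_image_lt_of_range {N : Type u} {κ : Cardinal.{u}} {w : γ → N} (hw : #(Set.range w) < κ)
    {t : γ → N} (ht : ∀ i j, w i = w j → t i = t j) (s : Set γ) : #(t '' s) < κ := by
  have : ∀ b : Set.range w, ∃ i, w i = b := fun b => b.2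
  choose g hg using this
  refine lt_of_le_of_lt ?_ hw
  refine (mk_le_mk_of_subset (t := Set.range fun b => t (g b)) ?_).trans mk_range_le
  rintro _ ⟨i, -, rfl⟩
  exact ⟨⟨w i, i, rfl⟩, ht _ _ (hg ⟨w i, i, rfl⟩)⟩

open Classical in
/-- One-point extension of similar families into a generic model. The value of `F` that a new element
of `P` has on a class, and the choices made by a new class, can be prescribed because a generic model
contains an element that makes given choices from fewer than `κ` classes, resp. for fewer than `κ`
elements of `P`. -/
theorem FeqSim.exists_option {κ : Cardinal.{u}} (hκ : ℵ₀ ≤ κ) (hM : IsFeqPlus M) (hN : IsFeqPlus N)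
    (hNκ : IsFeqGeneric κ N) {v : γ → M} {w : γ → N} (hw : #(Set.range w) < κ) (h : FeqSim v w)
    (x : M) : ∃ y, FeqSim (fun o : Option γ => o.elim x v) (fun o => o.elim y w) := by
  have hNe : Nonempty N := by
    obtain ⟨z, -⟩ := hNκ.exists_isP ∅ (by simpa using aleph0_pos.trans_le hκ) (by simp) (by simp)
    exact ⟨z⟩
  have hQ : ∀ i, IsQ (v i) ↔ IsQ (w i) := fun i => by rw [hM.isQ_iff, hN.isQ_iff, h.isP]
  have hsum : ∀ {A B : Set N}, #A < κ → #B < κ → #(A ∪ B : Set N) < κ := fun hA hB =>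
    (mk_union_le _ _).trans_lt (add_lt_of_lt hκ hA hB)
  -- the value `F(a, b)`, an arbitrary element where it is undefined
  let F : N → N → N := fun a b => Classical.epsilon fun u => RelE a u ∧ RelR u b
  have hF : ∀ {a b}, IsQ a → IsP b → RelE a (F a b) ∧ RelR (F a b) b := fun ha hb =>
    Classical.epsilon_spec (hN.total ha hb)
  have hFsmall : ∀ a, #(Set.range fun j => F a (w j)) < κ := fun a => by
    rw [← Set.image_univ]
    exact mk_image_lt_of_range hw (fun i j e => by rw [e]) _
  by_cases hxv : ∃ i, v i = x
  · obtain ⟨i₀, rfl⟩ := hxv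
    refine ⟨w i₀, ?_⟩
    convert h.comp (fun o : Option γ => o.elim i₀ id) using 1
    · funext o; cases o <;> rfl
    · funext o; cases o <;> rfl
  push Not at hxv
  by_cases hx : IsP x
  · -- the values of `F` at the new element of `P` are prescribed on the classes that occur
    let good : γ → N → Prop := fun i t => RelE (w i) t ∧
      (∀ k, RelE (v i) (v k) → (RelR (v k) x ↔ w k = t)) ∧
      ∀ j, IsP (v j) → (RelS (v i) x (v j) ↔ RelR t (w j))
    have hgood : ∀ i, IsQ (v i) → ∃ t, good i t := by
      intro i hi
      have hwi := (hQ i).1 hi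
      -- the value `F(v i, x)` is one of the given elements
      by_cases hA : ∃ k, RelE (v i) (v k) ∧ RelR (v k) x
      · obtain ⟨k, hk, hkx⟩ := hA
        refine ⟨w k, (h.relE _ _).1 hk, fun k' hk' => ?_, fun j hj => ?_⟩
        · rw [← h.eq]
          exact ⟨fun hR => hM.unique hR hkx (hM.trans (hM.symm hk') hk), fun e => e ▸ hkx⟩
        · rw [hM.relS_iff hk hkx, h.relR]
      push Not at hA
      -- the value is that of a given element of `P`
      by_cases hB : ∃ j, IsP (v j) ∧ RelS (v i) x (v j)
      · obtain ⟨j₀, hj₀, hSj⟩ := hB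
        obtain ⟨h1, h2⟩ := hF hwi ((h.isP _).1 hj₀)
        refine ⟨F (w i) (w j₀), h1, fun k hk => ⟨fun hR => absurd hR (hA k hk), fun e => ?_⟩,
          fun j hj => ?_⟩
        · rw [← e] at h2
          have := (hM.relS_iff hk ((h.relR _ _).2 h2)).1 hSj.symm
          exact absurd this (hA k hk)
        · rw [← hN.relS_iff h1 h2, ← h.relS]
          exact ⟨fun hh => hM.relS_trans hSj.symm hh, fun hh => hM.relS_trans hSj hh⟩
      push Not at hB
      -- otherwise it is a fresh element of the class
      obtain ⟨t, ht, htX⟩ := hNκ.exists_relE (w i) hwi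
        (Set.range w ∪ Set.range fun j => F (w i) (w j)) (hsum hw (hFsmall _))
      refine ⟨t, ht, fun k hk => ⟨fun hR => absurd hR (hA k hk), fun e => absurd (Or.inl ⟨k, e⟩) htX⟩,
        fun j hj => ⟨fun hS => absurd hS (hB j hj), fun hR => absurd (Or.inr ⟨j, ?_⟩) htX⟩⟩
      obtain ⟨h1, h2⟩ := hF hwi ((h.isP _).1 hj)
      exact hN.unique h2 hR (hN.trans (hN.symm h1) ht)
    have hgood_congr : ∀ i i', RelE (v i) (v i') → good i = good i' := by
      intro i i' hE
      funext t
      have e1 : RelE (w i) t ↔ RelE (w i') t :=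
        ⟨hN.trans (hN.symm ((h.relE _ _).1 hE)), hN.trans ((h.relE _ _).1 hE)⟩
      have e2 : ∀ k, RelE (v i) (v k) ↔ RelE (v i') (v k) := fun k =>
        ⟨hM.trans (hM.symm hE), hM.trans hE⟩
      have e3 : ∀ j, RelS (v i) x (v j) ↔ RelS (v i') x (v j) := fun j => hM.relS_congr hE
      simp only [good, e1, e2, e3]
    let t : γ → N := fun i => Classical.epsilon (good i)
    have ht : ∀ i, IsQ (v i) → good i (t i) := fun i hi => Classical.epsilon_spec (hgood i hi)
    have ht_congr : ∀ i i', RelE (v i) (v i') → t i = t i' := fun i i' hE => by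
      simp only [t, hgood_congr i i' hE]
    have ht_eq : ∀ i i', w i = w i' → t i = t i' := fun i i' e => by
      have : v i = v i' := (h.eq _ _).2 e
      simp only [t, good, this, e]
    have htE : ∀ i i', IsQ (v i) → IsQ (v i') → RelE (t i) (t i') → t i = t i' := by
      intro i i' hi hi' hE
      refine ht_congr i i' ((h.relE _ _).2 ?_)
      exact hN.trans (ht i hi).1 (hN.trans hE (hN.symm (ht i' hi').1))
    -- a further class separates the new element from the old ones
    obtain ⟨y₀, hy₀, -, hy₀X⟩ := hNκ.exists_isQ ∅ (Set.range w) (by simpa using aleph0_pos.trans_le hκ)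
      hw (by simp) (fun _ _ => True) (by simp) (by simp) (by simp)
    obtain ⟨u, hu, huX⟩ := hNκ.exists_relE y₀ hy₀ (Set.range fun j => F y₀ (w j)) (hFsmall _)
    have huQ : IsQ u := hN.isQ_of_E (hN.symm hu)
    have hut : ∀ i, IsQ (v i) → ¬ RelE u (t i) := fun i hi hE =>
      hy₀X (w i) ⟨i, rfl⟩ (hN.trans hu (hN.trans hE (hN.symm (ht i hi).1)))
    obtain ⟨y, hy, hyX⟩ := hNκ.exists_isP (insert u (t '' {i | IsQ (v i)}))
      (mk_insert_le.trans_lt (add_lt_of_lt hκ (mk_image_lt_of_range hw ht_eq _)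
        (one_lt_aleph0.trans_le hκ)))
      (by
        rintro _ (rfl | ⟨i, hi, rfl⟩)
        · exact huQ
        · exact hN.isQ_of_E (hN.symm (ht i hi).1))
      (by
        rintro _ (rfl | ⟨i, hi, rfl⟩) _ (rfl | ⟨i', hi', rfl⟩) hE
        · rfl
        · exact absurd hE (hut i' hi')
        · exact absurd (hN.symm hE) (hut i hi)
        · exact htE i i' hi hi' hE)
    have hty : ∀ i, IsQ (v i) → RelR (t i) y := fun i hi => hyX _ (Or.inr ⟨i, hi, rfl⟩)
    refine ⟨y, h.option_of_isP hM hN hx hy hxv (fun j e => huX ⟨j, ?_⟩) (fun i => ?_) fun i j => ?_⟩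
    · obtain ⟨h1, h2⟩ := hF hy₀ (e ▸ hy : IsP (w j))
      refine hN.unique h2 ?_ (hN.trans (hN.symm h1) hu)
      rw [e]
      exact hyX u (Or.inl rfl)
    · constructor
      · intro hR
        have hi := hM.isQ_of_R hR
        rw [((ht i hi).2.1 i (hM.refl hi)).1 hR]
        exact hty i hi
      · intro hR
        have hi := (hQ i).2 (hN.isQ_of_R hR)
        exact ((ht i hi).2.1 i (hM.refl hi)).2 (hN.unique hR (hty i hi) (ht i hi).1)
    · constructor
      · intro hS
        obtain ⟨a, ha, -, ha'⟩ := id hS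
        have hi := hM.isQ_of_E ha
        exact (hN.relS_iff (ht i hi).1 (hty i hi)).2
          (((ht i hi).2.2 j (hM.isP_of_R ha')).1 hS)
      · intro hS
        obtain ⟨a, ha, -, ha'⟩ := id hS
        have hi := (hQ i).2 (hN.isQ_of_E ha)
        exact ((ht i hi).2.2 j ((h.isP _).2 (hN.isP_of_R ha'))).2
          ((hN.relS_iff (ht i hi).1 (hty i hi)).1 hS)
  have hxQ : IsQ x := (hM.isQ_iff x).2 hx
  by_cases hE : ∃ i, RelE x (v i)
  · -- a new element of an old class
    obtain ⟨i₀, hi₀⟩ := hE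
    have hvi₀ := hM.isQ_of_E (hM.symm hi₀)
    have hwi₀ := (hQ i₀).1 hvi₀
    suffices hsuff : ∃ y, RelE (w i₀) y ∧ (∀ k, w k ≠ y) ∧ ∀ j, RelR x (v j) ↔ RelR y (w j) by
      obtain ⟨y, h1, h2, h3⟩ := hsuff
      refine ⟨y, h.option_of_isQ hM hN hxQ (hN.isQ_of_E (hN.symm h1)) hxv h2 (fun i => ?_) h3
        fun i j => ?_⟩
      · constructor
        · exact fun hh => hN.trans (hN.symm h1) ((h.relE _ _).1 (hM.trans (hM.symm hi₀) hh))
        · exact fun hh => hM.trans hi₀ ((h.relE _ _).2 (hN.trans h1 hh))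
      · rw [hM.relS_congr hi₀, h.relS, hN.relS_congr h1]
    -- either `x` is a value of `F` at a given point, or a fresh element will do
    by_cases hB : ∃ j, RelR x (v j)
    · obtain ⟨j₀, hj₀⟩ := hB
      obtain ⟨h1, h2⟩ := hF hwi₀ ((h.isP j₀).1 (hM.isP_of_R hj₀))
      refine ⟨F (w i₀) (w j₀), h1, fun k e => hxv k ?_, fun j => ?_⟩
      · rw [← e] at h1 h2
        exact hM.unique ((h.relR _ _).2 h2) hj₀
          (hM.symm (hM.trans hi₀ ((h.relE _ _).2 h1)))
      · rw [← hN.relS_iff h1 h2, ← h.relS, hM.relS_iff (hM.symm hi₀) hj₀]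
    · push Not at hB
      obtain ⟨y, hy, hyX⟩ := hNκ.exists_relE (w i₀) hwi₀
        (Set.range w ∪ Set.range fun j => F (w i₀) (w j)) (hsum hw (hFsmall _))
      refine ⟨y, hy, fun k e => hyX (Or.inl ⟨k, e⟩),
        fun j => ⟨fun hR => absurd hR (hB j), fun hR => absurd (Or.inr ⟨j, ?_⟩) hyX⟩⟩
      obtain ⟨h1, h2⟩ := hF hwi₀ (hN.isP_of_R hR)
      exact hN.unique h2 hR (hN.trans (hN.symm h1) hy)
  push Not at hE
  -- an element of a new class: the new class makes the choices prescribed by the class of `x`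
  let r : N → N → Prop := fun a b => ∃ i j, w i = a ∧ w j = b ∧ RelS x (v i) (v j)
  obtain ⟨y₀, hy₀, hyS, hyX⟩ := hNκ.exists_isQ (w '' {i | IsP (v i)}) (Set.range w)
    (mk_image_lt_of_range hw (fun _ _ e => e) _) hw
    (by rintro _ ⟨i, hi, rfl⟩; exact (h.isP i).1 hi) r
    (by rintro _ ⟨i, hi, rfl⟩; exact ⟨i, i, rfl, rfl, hM.relS_self hxQ hi⟩)
    (by rintro _ _ ⟨i, j, hi, hj, hS⟩; exact ⟨j, i, hj, hi, hS.symm⟩)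
    (by
      rintro _ _ _ ⟨i, j, hi, hj, hS⟩ ⟨i', j', hi', hj', hS'⟩
      refine ⟨i, j', hi, hj', hM.relS_trans hS ?_⟩
      rwa [(h.eq j i').2 (hj.trans hi'.symm)])
  have hyS' : ∀ i j, RelS x (v i) (v j) ↔ RelS y₀ (w i) (w j) := by
    intro i j
    constructor
    · intro hS
      obtain ⟨u, -, h2, h3⟩ := id hS
      exact (hyS _ ⟨i, hM.isP_of_R h2, rfl⟩ _ ⟨j, hM.isP_of_R h3, rfl⟩).2 ⟨i, j, rfl, rfl, hS⟩
    · intro hS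
      obtain ⟨u, -, h2, h3⟩ := id hS
      obtain ⟨i', j', hi', hj', hS'⟩ := (hyS _ ⟨i, (h.isP _).2 (hN.isP_of_R h2), rfl⟩ _
        ⟨j, (h.isP _).2 (hN.isP_of_R h3), rfl⟩).1 hS
      rwa [(h.eq _ _).2 hi', (h.eq _ _).2 hj'] at hS'
  suffices hsuff : ∃ y, RelE y₀ y ∧ ∀ j, RelR x (v j) ↔ RelR y (w j) by
    obtain ⟨y, h1, h3⟩ := hsuff
    have hyE : ∀ i, ¬ RelE y (w i) := fun i hh => hyX _ ⟨i, rfl⟩ (hN.trans h1 hh)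
    have hyQ : IsQ y := hN.isQ_of_E (hN.symm h1)
    refine ⟨y, h.option_of_isQ hM hN hxQ hyQ hxv (fun i e => hyE i ?_)
      (fun i => ⟨fun hh => absurd hh (hE i), fun hh => absurd hh (hyE i)⟩) h3 fun i j => ?_⟩
    · rw [e]
      exact hN.refl hyQ
    · rw [hyS', hN.relS_congr h1]
  by_cases hB : ∃ j, RelR x (v j)
  · obtain ⟨j₀, hj₀⟩ := hB
    obtain ⟨h1, h2⟩ := hF hy₀ ((h.isP j₀).1 (hM.isP_of_R hj₀))
    refine ⟨F y₀ (w j₀), h1, fun j => ?_⟩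
    rw [← hN.relS_iff h1 h2, ← hyS', hM.relS_iff (hM.refl hxQ) hj₀]
  · push Not at hB
    obtain ⟨y, hy, hyX'⟩ := hNκ.exists_relE y₀ hy₀ (Set.range fun j => F y₀ (w j)) (hFsmall _)
    refine ⟨y, hy, fun j => ⟨fun hR => absurd hR (hB j), fun hR => absurd ⟨j, ?_⟩ hyX'⟩⟩
    obtain ⟨h1, h2⟩ := hF hy₀ (hN.isP_of_R hR)
    exact hN.unique h2 hR (hN.trans (hN.symm h1) hy)

end FeqExt

/-! ### Elimination of quantifiers in generic models -/

section FeqQE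

open Cardinal

variable {M N : Type u} [Lfeq.Structure M] [Lfeq.Structure N]

theorem exists_var_eq {α : Type*} (t : Lfeq.Term α) : ∃ a, t = Term.var a := by
  cases t with
  | var a => exact ⟨a, rfl⟩
  | func f ts => exact f.elim

section RelMap

variable {X : Type*} [Lfeq.Structure X]

theorem relMap_P (y : Fin 1 → X) : Structure.RelMap relP y ↔ IsP (y 0) := by
  rw [show y = ![y 0] by funext i; fin_cases i; rfl]
  rfl

theorem relMap_Q (y : Fin 1 → X) : Structure.RelMap relQ y ↔ IsQ (y 0) := by
  rw [show y = ![y 0] by funext i; fin_cases i; rfl]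
  rfl

theorem relMap_E (y : Fin 2 → X) : Structure.RelMap relE y ↔ RelE (y 0) (y 1) := by
  rw [show y = ![y 0, y 1] by funext i; fin_cases i <;> rfl]
  rfl

theorem relMap_R (y : Fin 2 → X) : Structure.RelMap relR y ↔ RelR (y 0) (y 1) := by
  rw [show y = ![y 0, y 1] by funext i; fin_cases i <;> rfl]
  rfl

theorem relMap_F (y : Fin 3 → X) : Structure.RelMap relF y ↔ RelF (y 0) (y 1) (y 2) := by
  rw [show y = ![y 0, y 1, y 2] by funext i; fin_cases i <;> rfl]
  rfl

end RelMap

/-- Atomic formulas are decided by the diagram. -/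
theorem FeqSim.realize_rel {M N : Type*} [Lfeq.Structure M] [Lfeq.Structure N] (hM : IsFeqPlus M)
    (hN : IsFeqPlus N) {γ : Type*} {v : γ → M}
    {w : γ → N} (h : FeqSim v w) {l : ℕ} (r : Lfeq.Relations l) (x : Fin l → γ) :
    Structure.RelMap r (fun i => v (x i)) ↔ Structure.RelMap r (fun i => w (x i)) := by
  cases r with
  | P => exact (relMap_P _).trans ((h.isP _).trans (relMap_P fun i => w (x i)).symm)
  | Q =>
    exact (relMap_Q _).trans (((hM.isQ_iff _).trans ((not_congr (h.isP _)).trans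
      (hN.isQ_iff _).symm)).trans (relMap_Q fun i => w (x i)).symm)
  | E => exact (relMap_E _).trans ((h.relE _ _).trans (relMap_E fun i => w (x i)).symm)
  | R => exact (relMap_R _).trans ((h.relR _ _).trans (relMap_R fun i => w (x i)).symm)
  | F =>
    exact (relMap_F _).trans (((hM.relF_iff _ _ _).trans ((and_congr (h.relE _ _)
      (h.relR _ _)).trans (hN.relF_iff _ _ _).symm)).trans (relMap_F fun i => w (x i)).symm)

theorem FeqSim.snoc {α : Type*} {n : ℕ} {v : α → M} {w : α → N} {xs : Fin n → M} {ys : Fin n → N}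
    {x : M} {y : N}
    (h : FeqSim (fun o : Option (α ⊕ Fin n) => o.elim x (Sum.elim v xs))
      (fun o => o.elim y (Sum.elim w ys))) :
    FeqSim (Sum.elim v (Fin.snoc xs x : Fin (n + 1) → M)) (Sum.elim w (Fin.snoc ys y)) := by
  let f : α ⊕ Fin (n + 1) → Option (α ⊕ Fin n) := Sum.elim (fun a => some (Sum.inl a))
    fun i => Fin.lastCases (motive := fun _ => Option (α ⊕ Fin n)) none (fun i => some (Sum.inr i)) i
  have key : ∀ {X : Type u} (v : α → X) (xs : Fin n → X) (x : X),
      Sum.elim v (Fin.snoc xs x : Fin (n + 1) → X) =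
        (fun o : Option (α ⊕ Fin n) => o.elim x (Sum.elim v xs)) ∘ f := by
    intro X v xs x
    funext z
    rcases z with a | i
    · rfl
    · refine Fin.lastCases ?_ (fun i => ?_) i
      · simp [f]
      · simp [f]
  rw [key, key]
  exact h.comp f

/-- Similar finite families in generic models satisfy the same formulas. -/
theorem FeqSim.realize_boundedFormula (hM : IsFeqPlus M) (hN : IsFeqPlus N)
    (hMg : IsFeqGeneric ℵ₀ M) (hNg : IsFeqGeneric ℵ₀ N) {α : Type*} [Finite α] {n : ℕ}
    (φ : Lfeq.BoundedFormula α n) {v : α → M} {w : α → N} {xs : Fin n → M} {ys : Fin n → N}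
    (h : FeqSim (Sum.elim v xs) (Sum.elim w ys)) : φ.Realize v xs ↔ φ.Realize w ys := by
  induction φ with
  | falsum => exact Iff.rfl
  | equal t₁ t₂ =>
    obtain ⟨a, rfl⟩ := exists_var_eq t₁
    obtain ⟨b, rfl⟩ := exists_var_eq t₂
    exact h.eq a b
  | rel r ts =>
    choose a ha using fun i => exists_var_eq (ts i)
    rw [show ts = fun i => Term.var (a i) from funext ha]
    exact h.realize_rel hM hN r a
  | imp _ _ ih₁ ih₂ => exact imp_congr (ih₁ h) (ih₂ h)
  | all _ ih =>
    have hr : ∀ {X : Type u} {k : ℕ} (z : α ⊕ Fin k → X), #(Set.range z) < ℵ₀ := fun z =>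
      lt_aleph0_iff_finite.2 (Set.finite_range z)
    constructor
    · intro hall y
      obtain ⟨x, hx⟩ := h.symm.exists_option le_rfl hN hM hMg (hr _) y
      exact (ih hx.symm.snoc).1 (hall x)
    · intro hall x
      obtain ⟨y, hy⟩ := h.exists_option le_rfl hM hN hNg (hr _) x
      exact (ih hy.snoc).2 (hall y)

theorem FeqSim.realize_formula (hM : IsFeqPlus M) (hN : IsFeqPlus N)
    (hMg : IsFeqGeneric ℵ₀ M) (hNg : IsFeqGeneric ℵ₀ N) {α : Type*} (φ : Lfeq.Formula α) {v : α → M}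
    {w : α → N} (h : FeqSim v w) : φ.Realize v ↔ φ.Realize w := by
  classical
  have e : ∀ {X : Type u} [Lfeq.Structure X] (x : α → X), φ.Realize x ↔
      (BoundedFormula.restrictFreeVar φ id).Realize (fun a : φ.freeVarFinset => x a) default :=
    fun x => (BoundedFormula.realize_restrictFreeVar (f := id) x (fun _ => rfl)).symm
  rw [e v, e w]
  refine FeqSim.realize_boundedFormula hM hN hMg hNg _ ?_
  have key : ∀ {X : Type u} (x : α → X) (d : Fin 0 → X),
      Sum.elim (fun a : φ.freeVarFinset => x a) d = x ∘ Sum.elim Subtype.val Fin.elim0 := by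
    intro X x d
    funext z
    rcases z with a | i
    · rfl
    · exact i.elim0
  rw [key, key]
  exact h.comp _

theorem FeqSim.of_isEmpty {γ : Type*} [IsEmpty γ] {M N : Type*} [Lfeq.Structure M]
    [Lfeq.Structure N] (v : γ → M) (w : γ → N) :
    FeqSim v w :=
  ⟨isEmptyElim, isEmptyElim, isEmptyElim, isEmptyElim, isEmptyElim⟩

theorem FeqSim.of_embedding {M N : Type*} [Lfeq.Structure M]
    [Lfeq.Structure N] (hM : IsFeqPlus M) (hN : IsFeqPlus N) (f : M ↪[Lfeq] N) :
    FeqSim (id : M → M) f := by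
  have h1 : ∀ x : M, IsP x ↔ IsP (f x) := fun x =>
    (f.map_rel FeqOrd.relP ![x]).symm.trans (relMap_P _)
  have h2 : ∀ x y : M, RelE x y ↔ RelE (f x) (f y) := fun x y =>
    (f.map_rel FeqOrd.relE ![x, y]).symm.trans (relMap_E _)
  have h3 : ∀ x y : M, RelR x y ↔ RelR (f x) (f y) := fun x y =>
    (f.map_rel FeqOrd.relR ![x, y]).symm.trans (relMap_R _)
  refine ⟨fun i j => f.injective.eq_iff.symm, h1, h2, h3, fun y a b => ?_⟩
  constructor
  · rintro ⟨u, hu1, hu2, hu3⟩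
    exact ⟨f u, (h2 _ _).1 hu1, (h3 _ _).1 hu2, (h3 _ _).1 hu3⟩
  · rintro ⟨u, hu1, hu2, hu3⟩
    have hy : IsQ y := by
      rw [hM.isQ_iff, h1]
      exact hN.not_isP_of_isQ (hN.isQ_of_E hu1)
    have ha : IsP a := (h1 a).2 (hN.isP_of_R hu2)
    obtain ⟨u', h4, h5⟩ := hM.total hy ha
    have : f u' = u := hN.unique ((h3 _ _).1 h5) hu2 (hN.trans (hN.symm ((h2 _ _).1 h4)) hu1)
    exact ⟨u', h4, h5, (h3 _ _).2 (this ▸ hu3)⟩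

theorem FeqSim.trans {γ M N O : Type*} [Lfeq.Structure M] [Lfeq.Structure N] [Lfeq.Structure O]
    {v : γ → M} {w : γ → N} {x : γ → O} (h : FeqSim v w) (h' : FeqSim w x) : FeqSim v x :=
  ⟨fun i j => (h.eq i j).trans (h'.eq i j), fun i => (h.isP i).trans (h'.isP i),
    fun i j => (h.relE i j).trans (h'.relE i j), fun i j => (h.relR i j).trans (h'.relR i j),
    fun i j k => (h.relS i j k).trans (h'.relS i j k)⟩

end FeqQE

/-! ### Generic extensions -/

section GenericExtension

open Cardinal

/-- The `Lfeq`-structure in which `P` is given, the `E`-classes are the fibres of `cls` outside `P`,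
and `z` in `P` chooses the element `F c z` of the class `c`. -/
@[reducible]
def feqStructure {M C : Type*} (P : M → Prop) (cls : M → C) (F : C → M → M) :
    Lfeq.Structure M where
  funMap f := f.elim
  RelMap {n} r x := match n, (r : feqRel n), x with
    | _, .P, x => P (x 0)
    | _, .Q, x => ¬ P (x 0)
    | _, .E, x => ¬ P (x 0) ∧ ¬ P (x 1) ∧ cls (x 0) = cls (x 1)
    | _, .R, x => P (x 1) ∧ ¬ P (x 0) ∧ F (cls (x 0)) (x 1) = x 0
    | _, .F, x => ¬ P (x 0) ∧ P (x 1) ∧ F (cls (x 0)) (x 1) = x 2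

theorem isFeqPlus_feqStructure {M C : Type*} {P : M → Prop} {cls : M → C} {F : C → M → M}
    (hF : ∀ c z, P z → ¬ P (F c z) ∧ cls (F c z) = c) :
    @IsFeqPlus M (feqStructure P cls F) := by
  let := feqStructure P cls F
  refine ⟨fun x => Iff.rfl, fun h => h.1, fun h => ⟨h, h, rfl⟩, fun h => ⟨h.2.1, h.1, h.2.2.symm⟩,
    fun h h' => ⟨h.1, h'.2.1, h.2.2.trans h'.2.2⟩, fun h => h.2.1, fun h => h.1, fun {x y z} h h' h'' => ?_,
    fun {x z} hx hz => ⟨F (cls x) z, ⟨hx, (hF _ z hz).1, (hF _ z hz).2.symm⟩, hz, (hF _ z hz).1, ?_⟩,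
    fun x z y => ?_⟩
  · exact h.2.2.symm.trans ((congrArg (F · z) h''.2.2).trans h'.2.2)
  · exact congrArg (F · z) (hF _ z hz).2
  · constructor
    · rintro ⟨h1, h2, h3⟩
      have h3' : F (cls x) z = y := h3
      have h4 := hF (cls x) z h2
      rw [h3'] at h4
      exact ⟨⟨h1, h4.1, h4.2.symm⟩, h2, h4.1, (congrArg (F · z) h4.2).trans h3'⟩
    · rintro ⟨⟨h1, h2, h3⟩, h4, h5, h6⟩
      exact ⟨h1, h4, (congrArg (F · z) h3).trans h6⟩

theorem exists_surjective_label {ι X : Type} [Infinite ι] (hX : #X ≤ #ι) :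
    ∃ l : ι → Finset X × ℕ, Function.Surjective l := by
  refine exists_surjective_of_mk_le (mk_prod_le_of_le (infinite_iff.1 ‹_›) ?_ ?_)
  · rcases finite_or_infinite X with h | h
    · exact (lt_aleph0_of_finite _).le.trans (infinite_iff.1 ‹_›)
    · rwa [mk_finset_of_infinite]
  · exact mk_le_aleph0.trans (infinite_iff.1 ‹_›)

/-- Every model of `T_feq⁺` embeds into a generic one, which is obtained in one step: it suffices to
add infinitely many elements to each class, new classes and new elements of `P`, where the labels of
the latter two prescribe their behaviour on finite sets in all possible ways. -/
theorem exists_feqGeneric_extension {A : Type} [Lfeq.Structure A] (hA : IsFeqPlus A) :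
    ∃ (M : Type) (_ : Lfeq.Structure M) (_ : A ↪[Lfeq] M), IsFeqPlus M ∧ IsFeqGeneric ℵ₀ M := by
  classical
  let sA : Setoid A := ⟨fun x y => RelE x y ∨ x = y, fun x => Or.inr rfl,
    fun h => h.imp hA.symm Eq.symm, by
      rintro x y z (h | rfl) (h' | rfl)
      · exact Or.inl (hA.trans h h')
      · exact Or.inl h
      · exact Or.inl h'
      · exact Or.inr rfl⟩
  let ι := A ⊕ ℕ
  let C := Quotient sA ⊕ ι
  let M := A ⊕ ((C × ℕ) ⊕ ι)
  have hι : ℵ₀ ≤ #ι := infinite_iff.1 inferInstance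
  have hAι : #A ≤ #ι := mk_le_of_injective (f := Sum.inl) Sum.inl_injective
  have hNι : #ℕ ≤ #ι := mk_le_aleph0.trans hι
  have hMι : #(M × ℕ) ≤ #ι :=
    mk_prod_le_of_le hι (mk_sum_le_of_le hι hAι (mk_sum_le_of_le hι (mk_prod_le_of_le hι
      (mk_sum_le_of_le hι ((mk_le_of_surjective (Quotient.mk_surjective (s := sA))).trans hAι) le_rfl)
        hNι) le_rfl)) hNι
  -- the elements of `ι` are labelled by finite partial functions, each used infinitely often; a
  -- label prescribes the choices of a new element of `P`, and the choices made in a new class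
  obtain ⟨l, hl⟩ := exists_surjective_label hMι
  let P : M → Prop := Sum.elim IsP (Sum.elim (fun _ => False) fun _ => True)
  let cls : M → C := Sum.elim (fun a => Sum.inl (Quotient.mk sA a))
    (Sum.elim Prod.fst fun i => Sum.inr i)
  let new : C → ℕ → M := fun c n => Sum.inr (Sum.inl (c, n))
  let lab : ι → M → M := fun i z => new (Sum.inr i) (Classical.epsilon fun n => (z, n) ∈ (l i).1)
  let old : Quotient sA → A → M := fun q p =>
    if h : ∃ y : A, IsQ y ∧ Quotient.mk sA y = q ∧ RelR y p then Sum.inl h.choose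
    else new (Sum.inl q) 0
  let gen : C → M → M := fun c z => c.elim (fun q => new (Sum.inl q) 0) fun i => lab i z
  let F : C → M → M := fun c z => match z with
    | Sum.inl p => c.elim (fun q => old q p) fun i => lab i (Sum.inl p)
    | Sum.inr (Sum.inl x) => new c 0
    | Sum.inr (Sum.inr i) =>
        if h : ∃ m, (m, 0) ∈ (l i).1 ∧ ¬ P m ∧ cls m = c then h.choose else gen c z
  have hnew : ∀ c n, ¬ P (new c n) ∧ cls (new c n) = c := fun c n => ⟨id, rfl⟩
  have hnew_inj : ∀ c a b, new c a = new c b → a = b := fun c a b h =>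
    congrArg Prod.snd (Sum.inl_injective (Sum.inr_injective h))
  have hF : ∀ c z, P z → ¬ P (F c z) ∧ cls (F c z) = c := by
    rintro c (p | x | i) -
    · rcases c with q | i
      · simp only [F, Sum.elim_inl, old]
        split_ifs with h
        · exact ⟨hA.not_isP_of_isQ h.choose_spec.1, congrArg Sum.inl h.choose_spec.2.1⟩
        · exact hnew _ _
      · exact hnew _ _
    · exact hnew _ _
    · simp only [F]
      split_ifs with h
      · exact h.choose_spec.2
      · rcases c with q | i
        · exact hnew _ _
        · exact hnew _ _
  let := feqStructure P cls F
  have hM : IsFeqPlus M := isFeqPlus_feqStructure hF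
  -- the choices of the elements of `P` in a new class
  have hFi : ∀ (z : M), P z → ∀ i, (∀ j m, z = Sum.inr (Sum.inr j) → (m, 0) ∈ (l j).1 →
      cls m ≠ Sum.inr i) → F (Sum.inr i) z = lab i z := by
    rintro (p | x | j) hz i h
    · rfl
    · exact hz.elim
    · have : ¬ ∃ m, (m, 0) ∈ (l j).1 ∧ ¬ P m ∧ cls m = Sum.inr i := by
        rintro ⟨m, h1, -, h2⟩
        exact h j m rfl h1 h2
      simp only [F, dif_neg this]
      rfl
  have hE : ∀ x y : A, RelE x y ↔ ¬ IsP x ∧ ¬ IsP y ∧ Quotient.mk sA x = Quotient.mk sA y := by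
    intro x y
    rw [Quotient.eq]
    constructor
    · intro h
      exact ⟨hA.not_isP_of_isQ (hA.isQ_of_E h), hA.not_isP_of_isQ (hA.isQ_of_E (hA.symm h)), Or.inl h⟩
    · rintro ⟨h1, -, h3 | rfl⟩
      · exact h3
      · exact hA.refl ((hA.isQ_iff _).2 h1)
  have hE' : ∀ x y : A, RelE (Sum.inl x : M) (Sum.inl y) ↔ RelE x y := fun x y => by
    rw [hE]
    exact and_congr_right fun _ => and_congr_right fun _ => Sum.inl_injective.eq_iff
  have hR' : ∀ x y : A, RelR (Sum.inl x : M) (Sum.inl y) ↔ RelR x y := by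
    intro x y
    have e : RelR (Sum.inl x : M) (Sum.inl y) ↔
        IsP y ∧ ¬ IsP x ∧ old (Quotient.mk sA x) y = Sum.inl x := Iff.rfl
    rw [e]
    constructor
    · rintro ⟨-, -, h3⟩
      simp only [old] at h3
      split_ifs at h3 with h
      have := h.choose_spec.2.2
      rwa [Sum.inl_injective h3] at this
    · intro h
      have hQ := hA.isQ_of_R h
      have hex : ∃ y' : A, IsQ y' ∧ Quotient.mk sA y' = Quotient.mk sA x ∧ RelR y' y :=
        ⟨x, hQ, rfl, h⟩
      refine ⟨hA.isP_of_R h, hA.not_isP_of_isQ hQ, ?_⟩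
      simp only [old, dif_pos hex]
      obtain ⟨h1, h2, h3⟩ := hex.choose_spec
      exact congrArg Sum.inl (hA.unique h3 h ((hE _ _).2
        ⟨hA.not_isP_of_isQ h1, hA.not_isP_of_isQ hQ, h2⟩))
  have hQ' : ∀ x : A, IsQ (Sum.inl x : M) ↔ IsQ x := fun x => (hA.isQ_iff x).symm
  refine ⟨M, inferInstance, ⟨⟨Sum.inl, Sum.inl_injective⟩, fun f => f.elim, fun {n} r x => ?_⟩, hM, ?_⟩
  · cases r with
    | P => exact (relMap_P fun i => (Sum.inl (x i) : M)).trans (relMap_P x).symm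
    | Q => exact (relMap_Q fun i => (Sum.inl (x i) : M)).trans ((hQ' _).trans (relMap_Q x).symm)
    | E => exact (relMap_E fun i => (Sum.inl (x i) : M)).trans ((hE' _ _).trans (relMap_E x).symm)
    | R => exact (relMap_R fun i => (Sum.inl (x i) : M)).trans ((hR' _ _).trans (relMap_R x).symm)
    | F =>
      refine (relMap_F fun i => (Sum.inl (x i) : M)).trans (Iff.trans ?_ (relMap_F x).symm)
      rw [hM.relF_iff, hA.relF_iff, hE', hR']
  refine ⟨fun X hX hXQ hXE => ?_, fun c hc X hX => ?_, fun A₀ X hA₀ hX hA₀P r hr hr' hr'' => ?_⟩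
  · -- a new element of `P` whose label consists of the elements to be chosen
    have hXfin : X.Finite := lt_aleph0_iff_set_finite.1 hX
    obtain ⟨i, hi⟩ := hl (hXfin.toFinset.image (fun m => (m, 0)), 0)
    refine ⟨(Sum.inr (Sum.inr i) : M), trivial, fun x hx => ⟨trivial, hXQ x hx, ?_⟩⟩
    have hmem : ∀ m, (m, 0) ∈ (l i).1 ↔ m ∈ X := by
      intro m
      simp [hi]
    have hex : ∃ m, (m, 0) ∈ (l i).1 ∧ ¬ P m ∧ cls m = cls x := ⟨x, (hmem x).2 hx, hXQ x hx, rfl⟩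
    show F (cls x) (Sum.inr (Sum.inr i)) = x
    simp only [F, dif_pos hex]
    obtain ⟨h1, h2, h3⟩ := hex.choose_spec
    exact hXE _ ((hmem _).1 h1) _ hx ⟨h2, hXQ x hx, h3⟩
  · have hXfin : X.Finite := lt_aleph0_iff_set_finite.1 hX
    obtain ⟨n, hn⟩ := (hXfin.preimage (f := new (cls c)) (fun a _ b _ h => hnew_inj _ a b h)).exists_notMem
    exact ⟨new (cls c) n, ⟨hc, (hnew _ _).1, (hnew _ _).2.symm⟩, hn⟩
  · -- infinitely many new classes carry the label prescribing the choices of the elements of `A₀`;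
    -- almost all of them do not interfere with the labels of the elements of `A₀`
    have hAfin : A₀.Finite := lt_aleph0_iff_set_finite.1 hA₀
    have hXfin : X.Finite := lt_aleph0_iff_set_finite.1 hX
    obtain ⟨g, hg⟩ : ∃ g : M → ℕ, ∀ a ∈ A₀, ∀ b ∈ A₀, g a = g b ↔ r a b := by
      have := hAfin.to_subtype
      let s : Setoid A₀ := ⟨fun a b => r a b, fun a => hr a a.2, fun h => hr' _ _ h,
        fun h h' => hr'' _ _ _ h h'⟩
      obtain ⟨e, he⟩ := exists_injective_nat (Quotient s)
      refine ⟨fun m => if h : m ∈ A₀ then e (Quotient.mk s ⟨m, h⟩) else 0, fun a ha b hb => ?_⟩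
      simp only [dif_pos ha, dif_pos hb]
      rw [he.eq_iff, Quotient.eq]
      exact Iff.rfl
    let lbl : Finset (M × ℕ) := hAfin.toFinset.image fun a => (a, g a)
    choose i hi using fun k : ℕ => hl (lbl, k)
    have hiinj : Function.Injective i := fun a b h => by
      have := (hi a).symm.trans ((congrArg l h).trans (hi b))
      simpa using this
    let bad : Set C := cls '' X ∪ ⋃ a ∈ A₀, {c | ∃ j m, a = Sum.inr (Sum.inr j) ∧ (m, 0) ∈ (l j).1 ∧
      cls m = c}
    have hbad : bad.Finite := by
      refine (hXfin.image _).union (hAfin.biUnion fun a _ => ?_)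
      rcases a with a | a | j
      · refine Set.Finite.subset Set.finite_empty ?_
        rintro c ⟨j, m, h, -⟩
        exact absurd h Sum.inl_ne_inr
      · refine Set.Finite.subset Set.finite_empty ?_
        rintro c ⟨j, m, h, -⟩
        exact absurd (Sum.inr_injective h) Sum.inl_ne_inr
      · refine Set.Finite.subset ((l j).1.finite_toSet.image fun x => cls x.1) ?_
        rintro c ⟨j', m, h, hm, rfl⟩
        obtain rfl : j = j' := Sum.inr_injective (Sum.inr_injective h)
        exact ⟨(m, 0), hm, rfl⟩
    obtain ⟨k, hk⟩ := (hbad.preimage (f := fun k => (Sum.inr (i k) : C)) (fun a _ b _ h =>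
      hiinj (Sum.inr_injective h))).exists_notMem
    have hk1 : ∀ x ∈ X, cls x ≠ Sum.inr (i k) := fun x hx h => hk (Or.inl ⟨x, hx, h⟩)
    have hFk : ∀ a ∈ A₀, F (Sum.inr (i k)) a = new (Sum.inr (i k)) (g a) := by
      intro a ha
      rw [hFi a (hA₀P a ha) (i k) fun j m h1 h2 h3 => hk (Or.inr (Set.mem_biUnion ha
        ⟨j, m, h1, h2, h3⟩))]
      have hmem : ∀ n, (a, n) ∈ (l (i k)).1 ↔ n = g a := by
        intro n
        rw [hi k]
        simp only [lbl, Finset.mem_image, Set.Finite.mem_toFinset, Prod.mk.injEq]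
        constructor
        · rintro ⟨b, -, rfl, rfl⟩
          rfl
        · rintro rfl
          exact ⟨a, ha, rfl, rfl⟩
      have := Classical.epsilon_spec (p := fun n => (a, n) ∈ (l (i k)).1) ⟨g a, (hmem _).2 rfl⟩
      simp only [lab]
      rw [(hmem _).1 this]
    refine ⟨new (Sum.inr (i k)) 0, (hnew _ _).1, fun a ha b hb => ?_, fun x hx h => hk1 x hx ?_⟩
    · have h1 : ∀ a ∈ A₀, RelR (new (Sum.inr (i k)) (g a)) a := fun a ha =>
        ⟨hA₀P a ha, (hnew _ _).1, hFk a ha⟩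
      have h2 : RelE (new (Sum.inr (i k)) 0) (new (Sum.inr (i k)) (g a)) :=
        ⟨(hnew _ _).1, (hnew _ _).1, rfl⟩
      refine (hM.relS_iff h2 (h1 a ha)).trans (Iff.trans ?_ (hg a ha b hb))
      constructor
      · intro h
        have := (hFk b hb).symm.trans h.2.2
        exact hnew_inj _ _ _ this.symm
      · intro h
        rw [h]
        exact h1 b hb
    · exact h.2.2.symm

end GenericExtension

/-! ### The model completion of `T_feq⁺` -/

section ModelCompletion

open Cardinal

theorem realize_comp_embedding {L : FirstOrder.Language.{u₀, v₀}} {M N α : Type*} [L.Structure M]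
    [L.Structure N] {φ : L.Formula α} (hφ : BoundedFormula.IsQF φ) (f : M ↪[L] N) (v : α → M) :
    φ.Realize (f ∘ v) ↔ φ.Realize v := by
  have := hφ.realize_embedding f (v := v) (xs := default)
  rwa [Subsingleton.elim (f ∘ default) default] at this

/-- Generic models are existentially closed. -/
theorem isExistentiallyClosed_of_isFeqGeneric {M : Theory.ModelType.{0, 0, 0} TfeqPlus}
    (hM : IsFeqGeneric ℵ₀ M) : IsExistentiallyClosed M := by
  rintro N f m φ hφ ⟨b, hb⟩
  have hM' : IsFeqPlus M := isFeqPlus_iff.2 M.is_model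
  obtain ⟨K, _, g, hK, hKg⟩ := exists_feqGeneric_extension (isFeqPlus_iff.2 N.is_model)
  have hsim := FeqSim.of_embedding hM' hK (g.comp f)
  have h1 : (φ.iExs (Fin m)).Realize (g.comp f) := by
    refine Formula.realize_iExs.2 ⟨g ∘ b, ?_⟩
    have := (realize_comp_embedding hφ g _).2 hb
    refine (realize_congr fun a => ?_).1 this
    rcases a with a | a <;> rfl
  exact Formula.realize_iExs.1 ((hsim.realize_formula hM' hK hM hKg _).2 h1)

/-- The sentence `∀ v, χ(v) → ∃ w, θ(v, w)`. -/
noncomputable def forallExists {α β : Type} [Finite α] [Finite β] (χ : Lfeq.Formula α)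
    (θ : Lfeq.Formula (α ⊕ β)) : Lfeq.Sentence :=
  Formula.iAlls α ((χ.imp (θ.iExs β)).relabel Sum.inr)

theorem realize_forallExists {α β : Type} [Finite α] [Finite β] (χ : Lfeq.Formula α)
    (θ : Lfeq.Formula (α ⊕ β)) {X : Type*} [Lfeq.Structure X] : X ⊨ forallExists χ θ ↔
      ∀ v : α → X, χ.Realize v → ∃ w : β → X, θ.Realize (Sum.elim v w) := by
  refine Formula.realize_iAlls.trans (forall_congr' fun v => ?_)
  rw [Formula.realize_relabel, Formula.realize_imp, Formula.realize_iExs]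
  exact Iff.rfl

/-- A `∀∃`-condition with quantifier-free matrix that holds in all generic models holds in all
models of `T*_feq`. -/
theorem exists_realize_of_model_TfeqStar {α β : Type} [Finite α] [Finite β] {χ : Lfeq.Formula α}
    {θ : Lfeq.Formula (α ⊕ β)} (hχ : BoundedFormula.IsQF χ) (hθ : BoundedFormula.IsQF θ)
    (h : ∀ (N : Type) [Lfeq.Structure N], IsFeqPlus N → IsFeqGeneric ℵ₀ N → ∀ v : α → N,
      χ.Realize v → ∃ w : β → N, θ.Realize (Sum.elim v w))
    {B : Type*} [Lfeq.Structure B] (hB : B ⊨ TfeqStar) (v : α → B) (hv : χ.Realize v) :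
    ∃ w : β → B, θ.Realize (Sum.elim v w) := by
  refine (realize_forallExists χ θ).1 (Theory.realize_sentence_of_mem TfeqStar
    (?_ : forallExists χ θ ∈ TfeqStar)) v hv
  intro M hM
  refine (realize_forallExists χ θ).2 fun v hv => ?_
  obtain ⟨N, _, f, hN, hNg⟩ := exists_feqGeneric_extension (isFeqPlus_iff.2 M.is_model)
  have : N ⊨ TfeqPlus := isFeqPlus_iff.1 hN
  have : Nonempty N := ⟨f (Classical.arbitrary M)⟩
  obtain ⟨w, hw⟩ := h N hN hNg (f ∘ v) ((realize_comp_embedding hχ f v).2 hv)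
  obtain ⟨m, ⟨e⟩⟩ := Finite.exists_equiv_fin β
  obtain ⟨b, hb⟩ := hM (Theory.ModelType.of TfeqPlus N) f m (θ.relabel (Sum.map v e))
    (hθ.relabel _) ⟨w ∘ e.symm, by
      rw [Formula.realize_relabel]
      refine (realize_congr fun a => ?_).1 hw
      rcases a with a | a
      · rfl
      · exact congrArg w (e.symm_apply_apply a).symm⟩
  rw [Formula.realize_relabel] at hb
  refine ⟨b ∘ e, (realize_congr fun a => ?_).1 hb⟩
  rcases a with a | a <;> rfl

theorem isQF_iInf {L : FirstOrder.Language.{u₀, v₀}} {α ι : Type*} [Finite ι] {φ : ι → L.Formula α}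
    (h : ∀ i, BoundedFormula.IsQF (φ i)) : BoundedFormula.IsQF (Formula.iInf φ) := by
  have : ∀ l : List (L.BoundedFormula α 0), (∀ ψ ∈ l, ψ.IsQF) → (l.foldr (· ⊓ ·) ⊤).IsQF := by
    intro l
    induction l with
    | nil => exact fun _ => BoundedFormula.IsQF.top
    | cons a l ih =>
      exact fun hl => (hl a (by simp)).inf (ih fun ψ hψ => hl ψ (by simp [hψ]))
  refine this _ fun ψ hψ => ?_
  obtain ⟨i, -, rfl⟩ := List.mem_map.1 hψ
  exact h i


section Formulas

variable {α : Type*}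

/-- `P x`, as a formula. -/
def vP (x : α) : Lfeq.Formula α := relP.formula₁ (Term.var x)
/-- `Q x`, as a formula. -/
def vQ (x : α) : Lfeq.Formula α := relQ.formula₁ (Term.var x)
/-- `x E y`, as a formula. -/
def vE (x y : α) : Lfeq.Formula α := relE.formula₂ (Term.var x) (Term.var y)
/-- `x R y`, as a formula. -/
def vR (x y : α) : Lfeq.Formula α := relR.formula₂ (Term.var x) (Term.var y)
/-- `x = y`, as a formula. -/
def vEq (x y : α) : Lfeq.Formula α := Term.equal (Term.var x) (Term.var y)

variable {M : Type*} [Lfeq.Structure M] {v : α → M} {x y : α}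

theorem realize_vP : (vP x).Realize v ↔ IsP (v x) := Formula.realize_rel₁
theorem realize_vQ : (vQ x).Realize v ↔ IsQ (v x) := Formula.realize_rel₁
theorem realize_vE : (vE x y).Realize v ↔ RelE (v x) (v y) := Formula.realize_rel₂
theorem realize_vR : (vR x y).Realize v ↔ RelR (v x) (v y) := Formula.realize_rel₂
theorem realize_vEq : (vEq x y).Realize v ↔ v x = v y := by simp [vEq, Formula.realize_equal]

theorem isQF_vP : BoundedFormula.IsQF (vP x) := (BoundedFormula.IsAtomic.rel _ _).isQF
theorem isQF_vQ : BoundedFormula.IsQF (vQ x) := (BoundedFormula.IsAtomic.rel _ _).isQF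
theorem isQF_vE : BoundedFormula.IsQF (vE x y) := (BoundedFormula.IsAtomic.rel _ _).isQF
theorem isQF_vR : BoundedFormula.IsQF (vR x y) := (BoundedFormula.IsAtomic.rel _ _).isQF
theorem isQF_vEq : BoundedFormula.IsQF (vEq x y) := (BoundedFormula.IsAtomic.equal _ _).isQF

end Formulas

open Classical in
/-- Some element of `Q` outside the classes of the variables in the second family chooses according to
the equivalence relation `r` for the variables in the first family: besides this element, its choices
are unknowns. -/
noncomputable def choiceFormula {n m : ℕ} (r : Fin n → Fin n → Prop) :
    Lfeq.Formula ((Fin n ⊕ Fin m) ⊕ Option (Fin n)) :=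
  vQ (Sum.inr none) ⊓
    (Formula.iInf (fun i => vE (Sum.inr none) (Sum.inr (some i)) ⊓
      vR (Sum.inr (some i)) (Sum.inl (Sum.inl i))) ⊓
    (Formula.iInf (fun p : Fin n × Fin n => if r p.1 p.2 then
      vEq (Sum.inr (some p.1)) (Sum.inr (some p.2)) else
      (vEq (Sum.inr (some p.1)) (Sum.inr (some p.2))).not) ⊓
    Formula.iInf fun i => (vE (Sum.inr none) (Sum.inl (Sum.inr i))).not))

theorem realize_choiceFormula {n m : ℕ} {r : Fin n → Fin n → Prop} {X : Type*} [Lfeq.Structure X]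
    {v : (Fin n ⊕ Fin m) ⊕ Option (Fin n) → X} : (choiceFormula r).Realize v ↔
      IsQ (v (Sum.inr none)) ∧ (∀ i, RelE (v (Sum.inr none)) (v (Sum.inr (some i))) ∧
        RelR (v (Sum.inr (some i))) (v (Sum.inl (Sum.inl i)))) ∧
      (∀ p : Fin n × Fin n, v (Sum.inr (some p.1)) = v (Sum.inr (some p.2)) ↔ r p.1 p.2) ∧
      ∀ i, ¬ RelE (v (Sum.inr none)) (v (Sum.inl (Sum.inr i))) := by
  simp only [choiceFormula, Formula.realize_inf, Formula.realize_iInf, Formula.realize_not,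
    realize_vE, realize_vR, realize_vQ]
  refine and_congr_right fun _ => and_congr_right fun _ => and_congr_left fun _ =>
    forall_congr' fun p => ?_
  split_ifs with h <;> simp [h, realize_vEq]

theorem isQF_choiceFormula {n m : ℕ} (r : Fin n → Fin n → Prop) :
    BoundedFormula.IsQF (choiceFormula (m := m) r) := by
  refine isQF_vQ.inf ((isQF_iInf fun _ => isQF_vE.inf isQF_vR).inf ((isQF_iInf fun _ => ?_).inf
    (isQF_iInf fun _ => isQF_vE.not)))
  split_ifs
  · exact isQF_vEq
  · exact isQF_vEq.not

theorem isFeqPlus_of_model_TfeqStar {B : Type*} [Lfeq.Structure B] (hB : B ⊨ TfeqStar) :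
    IsFeqPlus B :=
  isFeqPlus_iff.2 (Theory.model_iff _ |>.2 fun _ hσ => Theory.realize_sentence_of_mem TfeqStar
    fun _ _ => Theory.realize_sentence_of_mem TfeqPlus hσ)

theorem exists_equiv_fin_of_mk_lt {B : Type u} {X : Set B} (hX : #X < ℵ₀) :
    ∃ (n : ℕ) (v : Fin n → B), Function.Injective v ∧ Set.range v = X := by
  have : Finite X := lt_aleph0_iff_finite.1 hX
  obtain ⟨n, ⟨e⟩⟩ := Finite.exists_equiv_fin X
  exact ⟨n, fun i => e.symm i, Subtype.val_injective.comp e.symm.injective, by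
    rw [show (fun i => (e.symm i : B)) = Subtype.val ∘ e.symm from rfl, e.symm.surjective.range_comp,
      Subtype.range_coe]⟩

/-- All models of `T*_feq`, in every universe, are generic: for sets of a given finite size, each of the
conditions defining genericity is a `∀∃`-sentence with quantifier-free matrix. -/
theorem isFeqGeneric_of_model_TfeqStar {B : Type u} [Lfeq.Structure B] (hB : B ⊨ TfeqStar) :
    IsFeqGeneric ℵ₀ B := by
  have hB' := isFeqPlus_of_model_TfeqStar hB
  have hr : ∀ {n : ℕ} {N : Type} (v : Fin n → N), #(Set.range v) < ℵ₀ := fun v =>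
    lt_aleph0_iff_finite.2 (Set.finite_range v)
  refine ⟨fun X hX hXQ hXE => ?_, fun c hc X hX => ?_, fun A X hA hX hAP r r1 r2 r3 => ?_⟩
  · -- an element of `P` to which all elements of a finite transversal are related
    obtain ⟨n, v, hv, rfl⟩ := exists_equiv_fin_of_mk_lt hX
    let χ : Lfeq.Formula (Fin n) := Formula.iInf (fun i => vQ i) ⊓
      Formula.iInf fun p : {p : Fin n × Fin n // p.1 ≠ p.2} => (vE p.1.1 p.1.2).not
    let θ : Lfeq.Formula (Fin n ⊕ Unit) := vP (Sum.inr ()) ⊓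
      Formula.iInf fun i => vR (Sum.inl i) (Sum.inr ())
    obtain ⟨w, hw⟩ := exists_realize_of_model_TfeqStar (χ := χ) (θ := θ)
      ((isQF_iInf fun _ => isQF_vQ).inf (isQF_iInf fun _ => isQF_vE.not))
      (isQF_vP.inf (isQF_iInf fun _ => isQF_vR)) (fun N _ hN hNg v hv => by
        simp only [χ, Formula.realize_inf, Formula.realize_iInf, Formula.realize_not, realize_vQ,
          realize_vE] at hv
        obtain ⟨z, hz, hzR⟩ := hNg.exists_isP (Set.range v) (hr v) (by simpa using hv.1) (by
          rintro _ ⟨i, rfl⟩ _ ⟨j, rfl⟩ h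
          by_contra hne
          exact hv.2 ⟨(i, j), fun h' => hne (congrArg v h')⟩ h)
        refine ⟨fun _ => z, ?_⟩
        simp only [θ, Formula.realize_inf, Formula.realize_iInf, realize_vP, realize_vR]
        exact ⟨hz, fun i => hzR _ ⟨i, rfl⟩⟩) hB v (by
        simp only [χ, Formula.realize_inf, Formula.realize_iInf, Formula.realize_not, realize_vQ,
          realize_vE]
        exact ⟨fun i => hXQ _ ⟨i, rfl⟩, fun p hp => p.2 (hv (hXE _ ⟨_, rfl⟩ _ ⟨_, rfl⟩ hp))⟩)
    simp only [θ, Formula.realize_inf, Formula.realize_iInf, realize_vP, realize_vR] at hw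
    refine ⟨w (), hw.1, ?_⟩
    rintro _ ⟨i, rfl⟩
    exact hw.2 i
  · -- an element of a class outside a finite set
    obtain ⟨n, v, hv, rfl⟩ := exists_equiv_fin_of_mk_lt hX
    let χ : Lfeq.Formula (Unit ⊕ Fin n) := vQ (Sum.inl ())
    let θ : Lfeq.Formula ((Unit ⊕ Fin n) ⊕ Unit) := vE (Sum.inl (Sum.inl ())) (Sum.inr ()) ⊓
      Formula.iInf fun i => (vEq (Sum.inr ()) (Sum.inl (Sum.inr i))).not
    obtain ⟨w, hw⟩ := exists_realize_of_model_TfeqStar (χ := χ) (θ := θ) isQF_vQ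
      (isQF_vE.inf (isQF_iInf fun _ => isQF_vEq.not)) (fun N _ hN hNg v hv => by
        simp only [χ, realize_vQ] at hv
        obtain ⟨y, hy, hyX⟩ := hNg.exists_relE _ hv (Set.range fun i => v (Sum.inr i)) (hr _)
        refine ⟨fun _ => y, ?_⟩
        simp only [θ, Formula.realize_inf, Formula.realize_iInf, Formula.realize_not, realize_vE,
          realize_vEq]
        exact ⟨hy, fun i hi => hyX ⟨i, hi.symm⟩⟩) hB (Sum.elim (fun _ => c) v) (realize_vQ.2 hc)
    simp only [θ, Formula.realize_inf, Formula.realize_iInf, Formula.realize_not, realize_vE,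
      realize_vEq] at hw
    refine ⟨w (), hw.1, ?_⟩
    rintro ⟨i, hi⟩
    exact hw.2 i hi.symm
  · -- a class with prescribed choices for finitely many elements of `P`, away from finitely many classes
    obtain ⟨n, a, ha, rfl⟩ := exists_equiv_fin_of_mk_lt hA
    obtain ⟨m, x, hx, rfl⟩ := exists_equiv_fin_of_mk_lt hX
    let χ : Lfeq.Formula (Fin n ⊕ Fin m) := Formula.iInf (fun i => vP (Sum.inl i)) ⊓
      Formula.iInf fun p : {p : Fin n × Fin n // p.1 ≠ p.2} =>
        (vEq (Sum.inl p.1.1) (Sum.inl p.1.2)).not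
    obtain ⟨w, hw⟩ := exists_realize_of_model_TfeqStar (χ := χ) (θ := choiceFormula fun i j => r (a i) (a j))
      ((isQF_iInf fun _ => isQF_vP).inf (isQF_iInf fun _ => isQF_vEq.not))
      (isQF_choiceFormula _) (fun N _ hN hNg v hv => by
        simp only [χ, Formula.realize_inf, Formula.realize_iInf, Formula.realize_not, realize_vP,
          realize_vEq] at hv
        have hvi : ∀ i j, v (Sum.inl i) = v (Sum.inl j) → i = j := fun i j h => by
          by_contra hne
          exact hv.2 ⟨(i, j), hne⟩ h
        obtain ⟨y, hy, hyS, hyE⟩ := hNg.exists_isQ (Set.range fun i => v (Sum.inl i))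
          (Set.range fun i => v (Sum.inr i)) (hr _) (hr _) (by simpa using hv.1)
          (fun b c => ∃ i j, v (Sum.inl i) = b ∧ v (Sum.inl j) = c ∧ r (a i) (a j))
          (by
            rintro _ ⟨i, rfl⟩
            exact ⟨i, i, rfl, rfl, r1 _ ⟨i, rfl⟩⟩)
          (by
            rintro _ _ ⟨i, j, rfl, rfl, h⟩
            exact ⟨j, i, rfl, rfl, r2 _ _ h⟩)
          (by
            rintro _ _ _ ⟨i, j, rfl, rfl, h⟩ ⟨j', k, h', rfl, h''⟩
            obtain rfl := hvi _ _ h'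
            exact ⟨i, k, rfl, rfl, r3 _ _ _ h h''⟩)
        choose u hu1 hu2 using fun i => hN.total hy (hv.1 i)
        refine ⟨fun o => o.elim y u, realize_choiceFormula.2 ⟨hy, fun i => ⟨hu1 i, hu2 i⟩, ?_,
          fun i => hyE _ ⟨i, rfl⟩⟩⟩
        rintro ⟨i, j⟩
        have h1 : r (a i) (a j) ↔ RelS y (v (Sum.inl i)) (v (Sum.inl j)) := by
          rw [hyS _ ⟨i, rfl⟩ _ ⟨j, rfl⟩]
          constructor
          · exact fun h => ⟨i, j, rfl, rfl, h⟩
          · rintro ⟨i', j', h1, h2, h⟩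
            obtain rfl := hvi _ _ h1
            obtain rfl := hvi _ _ h2
            exact h
        refine Iff.trans ?_ h1.symm
        rw [hN.relS_iff (hu1 i) (hu2 i)]
        constructor
        · intro h
          exact (show u i = u j from h) ▸ hu2 j
        · intro h
          exact hN.unique h (hu2 j) (hN.trans (hN.symm (hu1 i)) (hu1 j))) hB (Sum.elim a x) (by
        simp only [χ, Formula.realize_inf, Formula.realize_iInf, Formula.realize_not, realize_vP,
          realize_vEq]
        exact ⟨fun i => hAP _ ⟨i, rfl⟩, fun p hp => p.2 (ha hp)⟩)
    obtain ⟨h1, h2, h3, h4⟩ := realize_choiceFormula.1 hw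
    refine ⟨w none, h1, ?_, ?_⟩
    · rintro _ ⟨i, rfl⟩ _ ⟨j, rfl⟩
      refine Iff.trans ?_ (h3 (i, j))
      refine (hB'.relS_iff (h2 i).1 (h2 i).2).trans ?_
      constructor
      · intro h
        exact hB'.unique h (h2 j).2 (hB'.trans (hB'.symm (h2 i).1) (h2 j).1)
      · intro h
        exact (congrArg (RelR · (a j)) h).mpr (h2 j).2
    · rintro _ ⟨i, rfl⟩
      exact h4 i

theorem model_TfeqStar_of_isFeqGeneric {M : Type} [Lfeq.Structure M] (hM : IsFeqPlus M)
    (hMg : IsFeqGeneric ℵ₀ M) : M ⊨ TfeqStar := by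
  have : M ⊨ TfeqPlus := isFeqPlus_iff.1 hM
  obtain ⟨z, -⟩ := hMg.exists_isP ∅ (by simpa using aleph0_pos) (by simp) (by simp)
  have : Nonempty M := ⟨z⟩
  exact Theory.model_iff _ |>.2 fun σ hσ =>
    hσ (Theory.ModelType.of TfeqPlus M) (isExistentiallyClosed_of_isFeqGeneric hMg)

theorem isModelCompletion_TfeqStar : IsModelCompletion TfeqPlus TfeqStar := by
  refine ⟨fun M => isFeqPlus_iff.1 (isFeqPlus_of_model_TfeqStar M.is_model), fun A => ?_,
    fun A M N f g φ => ?_⟩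
  · obtain ⟨M, _, f, hM, hMg⟩ := exists_feqGeneric_extension (isFeqPlus_iff.2 A.is_model)
    have : M ⊨ TfeqStar := model_TfeqStar_of_isFeqGeneric hM hMg
    have : Nonempty M := ⟨f (Classical.arbitrary A)⟩
    exact ⟨Theory.ModelType.of TfeqStar M, ⟨f⟩⟩
  · have hA : IsFeqPlus A := isFeqPlus_iff.2 A.is_model
    have hM := isFeqPlus_of_model_TfeqStar M.is_model
    have hN := isFeqPlus_of_model_TfeqStar N.is_model
    exact FeqSim.realize_formula hM hN (isFeqGeneric_of_model_TfeqStar M.is_model)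
      (isFeqGeneric_of_model_TfeqStar N.is_model) φ
      ((FeqSim.of_embedding hA hM f).symm.trans (FeqSim.of_embedding hA hN g))

theorem exists_model_TfeqStar : ∃ (M : Type) (_ : Lfeq.Structure M), Nonempty M ∧ M ⊨ TfeqStar := by
  let := feqStructure (M := Unit) (C := Unit) (fun _ => False) id fun _ _ => ()
  have hA : IsFeqPlus Unit := isFeqPlus_feqStructure fun _ _ h => h.elim
  obtain ⟨M, hS, f, hM, hMg⟩ := exists_feqGeneric_extension hA
  exact ⟨M, hS, ⟨f ()⟩, model_TfeqStar_of_isFeqGeneric hM hMg⟩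

theorem isComplete_TfeqStar : TfeqStar.IsComplete := by
  refine ⟨?_, fun σ => ?_⟩
  · obtain ⟨M, _, _, hM⟩ := exists_model_TfeqStar
    exact Theory.Model.isSatisfiable M
  · obtain ⟨M, _, _, hM⟩ := exists_model_TfeqStar
    have key : ∀ (N : Theory.ModelType.{0, 0, 0} TfeqStar), M ⊨ σ ↔ N ⊨ σ := fun N =>
      FeqSim.realize_formula (isFeqPlus_of_model_TfeqStar hM) (isFeqPlus_of_model_TfeqStar N.is_model)
        (isFeqGeneric_of_model_TfeqStar hM) (isFeqGeneric_of_model_TfeqStar N.is_model) σ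
        (FeqSim.of_isEmpty _ _)
    by_cases h : M ⊨ σ
    · exact Or.inl (Theory.models_sentence_iff.2 fun N => (key N).1 h)
    · refine Or.inr (Theory.models_sentence_iff.2 fun N => ?_)
      rw [Sentence.realize_not, ← key]
      exact h

end ModelCompletion

/-! ### Interpretations of `T*_feq` in models realising arrays -/

section Interpreted

open Cardinal

variable {L : FirstOrder.Language.{u, u}} {M : Type u} [L.Structure M]

theorem Dfn.app₁ {γ : Type*} {P : M → Prop} (h : Dfn L fun v : Fin 1 → M => P (v 0)) (a : M ⊕ γ) :
    Dfn L fun v : γ → M => P (Sum.elim id v a) :=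
  h.subst fun _ => a

theorem Dfn.app₂ {γ : Type*} {P : M → M → Prop} (h : Dfn L fun v : Fin 2 → M => P (v 0) (v 1))
    (a b : M ⊕ γ) : Dfn L fun v : γ → M => P (Sum.elim id v a) (Sum.elim id v b) :=
  h.subst ![a, b]

theorem Dfn.app₃ {γ : Type*} {P : M → M → M → Prop}
    (h : Dfn L fun v : Fin 3 → M => P (v 0) (v 1) (v 2))
    (a b c : M ⊕ γ) :
    Dfn L fun v : γ → M => P (Sum.elim id v a) (Sum.elim id v b) (Sum.elim id v c) :=
  h.subst ![a, b, c]

/-- Formulas with constants define sets that are definable with parameters. -/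
theorem Dfn.of_withConstants {γ : Type*} (φ : L[[M]].Formula γ) :
    Dfn L fun v : γ → M => φ.Realize v :=
  ⟨BoundedFormula.constantsVarsEquiv φ, fun _ => BoundedFormula.realize_constantsVarsEquiv⟩

/-- In `M`, choices of at most `κ` codes of definable arrays are realised. -/
def RealizesArrays (L : FirstOrder.Language.{u, u}) (κ : Cardinal.{u}) (M : Type u) [L.Structure M] :
    Prop :=
  ∀ (ρ : M → (Fin 2 → M) → Prop) (ε : (Fin 2 → M) → (Fin 2 → M) → Prop),
    Dfn L (fun v : Unit ⊕ Fin 2 → M => ρ (v (Sum.inl ())) (v ∘ Sum.inr)) →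
    Dfn L (fun v : Fin 2 ⊕ Fin 2 → M => ε (v ∘ Sum.inl) (v ∘ Sum.inr)) →
    (∀ d d', ε d d' → ε d' d) → (∀ d d' d'', ε d d' → ε d' d'' → ε d d'') →
    (∀ h : Finset (Fin 2 → M), IsChoice ε (h : Set (Fin 2 → M)) → ∃ z, ∀ d ∈ h, ρ z d) →
    ∀ X : Set (Fin 2 → M), #X ≤ κ → IsChoice ε X → ∃ z, ∀ d ∈ X, ρ z d

theorem realizesArrays_of_isArray [Nonempty M] {κ : Cardinal.{u}}
    (h : ∀ (φ : L.Formula (ℕ ⊕ (Unit ⊕ Fin 2))) (ψ : L.Formula (ℕ ⊕ (Fin 2 ⊕ Fin 2)))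
      (c : ℕ → M), IsArray φ ψ c → ∀ X : Set (Fin 2 → M), #X ≤ κ →
      IsChoice (codeEquiv ψ c) X → ∃ z, ∀ d ∈ X, codeRel φ c z d) : RealizesArrays L κ M := by
  intro ρ ε hρ hε hsymm htrans hfin X hX hXc
  obtain ⟨φ, c₁, hφ⟩ := hρ.exists_nat
  obtain ⟨ψ, c₂, hψ⟩ := hε.exists_nat
  -- the two lists of parameters are interleaved
  let c : ℕ → M := fun n => if n % 2 = 0 then c₁ (n / 2) else c₂ (n / 2)
  have hc₁ : ∀ n, c (2 * n) = c₁ n := fun n => by simp [c]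
  have hc₂ : ∀ n, c (2 * n + 1) = c₂ n := fun n => by
    simp only [c, Nat.mul_add_mod, Nat.one_mod, one_ne_zero, if_false]
    congr 1
    lia
  have e1 : codeRel (φ.relabel (Sum.map (fun n => 2 * n) id)) c = ρ := by
    funext z d
    rw [codeRel, Formula.realize_relabel]
    refine propext (Iff.trans (realize_congr ?_) (hφ (Sum.elim (fun _ => z) d)))
    rintro (n | _)
    · exact hc₁ n
    · rfl
  have e2 : codeEquiv (ψ.relabel (Sum.map (fun n => 2 * n + 1) id)) c = ε := by
    funext d d'
    rw [codeEquiv, Formula.realize_relabel]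
    refine propext (Iff.trans (realize_congr ?_) (hψ (Sum.elim d d')))
    rintro (n | _)
    · exact hc₂ n
    · rfl
  have := h (φ.relabel (Sum.map (fun n => 2 * n) id)) (ψ.relabel (Sum.map (fun n => 2 * n + 1) id)) c
    ⟨by rwa [e2], by rwa [e2], by rwa [e1, e2]⟩ X hX
  rw [e1, e2] at this
  exact this hXc

/-- The models of `T*_feq` defined in a structure that realises arrays inherit genericity for larger
sets. -/
theorem isFeqGeneric_succ_of_realizesArrays {κ : Cardinal.{u}} (hκ : ℵ₀ ≤ κ)
    (hM : RealizesArrays L κ M) {D : Set M} [Lfeq.Structure D]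
    (hP : Dfn L fun v : Fin 1 → M => ∃ h, IsP (⟨v 0, h⟩ : D))
    (hE : Dfn L fun v : Fin 2 → M => ∃ h h', RelE (⟨v 0, h⟩ : D) ⟨v 1, h'⟩)
    (hR : Dfn L fun v : Fin 2 → M => ∃ h h', RelR (⟨v 0, h⟩ : D) ⟨v 1, h'⟩)
    (hD : IsFeqPlus D) (hDg : IsFeqGeneric ℵ₀ D) : IsFeqGeneric (Order.succ κ) D := by
  classical
  let P : M → Prop := fun x => ∃ h, IsP (⟨x, h⟩ : D)
  let E : M → M → Prop := fun x y => ∃ h h', RelE (⟨x, h⟩ : D) ⟨y, h'⟩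
  let R : M → M → Prop := fun x y => ∃ h h', RelR (⟨x, h⟩ : D) ⟨y, h'⟩
  let S : M → M → M → Prop := fun y a b => ∃ u, E y u ∧ R u a ∧ R u b
  have hE_iff : ∀ x y : D, E x y ↔ RelE x y := fun x y => ⟨fun ⟨_, _, h⟩ => h, fun h => ⟨_, _, h⟩⟩
  have hR_iff : ∀ x y : D, R x y ↔ RelR x y := fun x y => ⟨fun ⟨_, _, h⟩ => h, fun h => ⟨_, _, h⟩⟩
  have hP_iff : ∀ x : D, P x ↔ IsP x := fun x => ⟨fun ⟨_, h⟩ => h, fun h => ⟨_, h⟩⟩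
  have hS_iff : ∀ y a b : D, S y a b ↔ RelS y a b := fun y a b =>
    ⟨fun ⟨u, ⟨_, h, h1⟩, ⟨_, _, h2⟩, ⟨_, _, h3⟩⟩ => ⟨⟨u, h⟩, h1, h2, h3⟩,
      fun ⟨u, h1, h2, h3⟩ => ⟨u, ⟨_, _, h1⟩, ⟨_, _, h2⟩, ⟨_, _, h3⟩⟩⟩
  have hEsymm : ∀ x y, E x y → E y x := fun x y ⟨h, h', h1⟩ => ⟨h', h, hD.symm h1⟩
  have hEtrans : ∀ x y z, E x y → E y z → E x z := fun x y z ⟨h, _, h1⟩ ⟨_, h', h2⟩ =>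
    ⟨h, h', hD.trans h1 h2⟩
  have hMne : Nonempty M := by
    obtain ⟨z, -⟩ := hDg.exists_isP ∅ (by simpa using aleph0_pos) (by simp) (by simp)
    exact ⟨z⟩
  have hS : Dfn L fun v : Fin 3 → M => S (v 0) (v 1) (v 2) := by
    refine Dfn.exE (P := fun w : Fin 3 ⊕ Unit → M => E (w (Sum.inl 0)) (w (Sum.inr ())) ∧
      R (w (Sum.inr ())) (w (Sum.inl 1)) ∧ R (w (Sum.inr ())) (w (Sum.inl 2))) ?_
    exact (hE.app₂ (P := E) (Sum.inr (Sum.inl 0)) (Sum.inr (Sum.inr ()))).and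
      ((hR.app₂ (P := R) (Sum.inr (Sum.inr ())) (Sum.inr (Sum.inl 1))).and
        (hR.app₂ (P := R) (Sum.inr (Sum.inr ())) (Sum.inr (Sum.inl 2))))
  have hsmall : ∀ {X : Set D}, #X < Order.succ κ → #X ≤ κ := fun h => Order.lt_succ_iff.1 h
  have hfin : ∀ {X : Set D}, X.Finite → #X < ℵ₀ := fun h => lt_aleph0_iff_set_finite.2 h
  -- elements of `P` choosing a given transversal
  have hEP : ∀ X : Set D, #X < Order.succ κ → (∀ x ∈ X, IsQ x) →
      (∀ x ∈ X, ∀ y ∈ X, RelE x y → x = y) → ∃ z, IsP z ∧ ∀ x ∈ X, RelR x z := by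
    intro X hX hXQ hXE
    rcases X.eq_empty_or_nonempty with rfl | ⟨x₀, hx₀⟩
    · exact hDg.exists_isP ∅ (by simpa using aleph0_pos) (by simp) (by simp)
    have harr : ∀ h : Finset (Fin 2 → M), IsChoice (fun d d' => E (d 0) (d' 0)) (h : Set (Fin 2 → M)) →
        ∃ z, ∀ d ∈ h, R (d 0) z := by
      intro h hh
      have hfinX : {x : D | ∃ d ∈ h, d 0 = x}.Finite :=
        ((h.finite_toSet.image fun d => d 0).preimage Subtype.val_injective.injOn).subset (by
          rintro x ⟨d, hd, hdx⟩
          exact ⟨d, hd, hdx⟩)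
      obtain ⟨z, -, hz⟩ := hDg.exists_isP {x : D | ∃ d ∈ h, d 0 = x} (hfin hfinX) (by
        rintro x ⟨d, hd, hdx⟩
        have : E (d 0) (d 0) := hh.1 d hd
        rw [hdx, hE_iff] at this
        exact hD.isQ_of_E this) (by
        rintro x ⟨d, hd, hdx⟩ y ⟨d', hd', hdy⟩ hxy
        have := hh.2 d hd d' hd' (by
          show E (d 0) (d' 0)
          rw [hdx, hdy]
          exact (hE_iff _ _).2 hxy)
        subst this
        exact Subtype.ext (hdx.symm.trans hdy))
      refine ⟨z, fun d hd => ?_⟩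
      obtain ⟨h0, -, -⟩ := hh.1 d hd
      exact (hR_iff ⟨_, h0⟩ z).2 (hz _ ⟨d, hd, rfl⟩)
    have hX' : IsChoice (fun d d' : Fin 2 → M => E (d 0) (d' 0))
        ((fun (x : D) (_ : Fin 2) => (x : M)) '' X) := by
      constructor
      · rintro _ ⟨x, hx, rfl⟩
        exact (hE_iff _ _).2 (hD.refl (hXQ x hx))
      · rintro _ ⟨x, hx, rfl⟩ _ ⟨y, hy, rfl⟩ hxy
        rw [hXE x hx y hy ((hE_iff _ _).1 hxy)]
    obtain ⟨z, hz⟩ := hM (fun z d => R (d 0) z) (fun d d' => E (d 0) (d' 0))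
      (hR.app₂ (P := R) (Sum.inr (Sum.inr 0)) (Sum.inr (Sum.inl ())))
      (hE.app₂ (P := E) (Sum.inr (Sum.inl 0)) (Sum.inr (Sum.inr 0)))
      (fun _ _ => hEsymm _ _) (fun _ _ _ => hEtrans _ _ _) harr _
      (mk_image_le.trans (hsmall hX)) hX'
    obtain ⟨_, hzD, -⟩ := hz _ ⟨x₀, hx₀, rfl⟩
    have hz' : ∀ x ∈ X, RelR x ⟨z, hzD⟩ := fun x hx => (hR_iff x ⟨z, hzD⟩).1 (hz _ ⟨x, hx, rfl⟩)
    exact ⟨⟨z, hzD⟩, hD.isP_of_R (hz' x₀ hx₀), hz'⟩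
  -- classes are large
  have hEC : ∀ c : D, IsQ c → ∀ X : Set D, #X < Order.succ κ → ∃ y, RelE c y ∧ y ∉ X := by
    intro c hc X hX
    have hchoice : ∀ X : Set (Fin 2 → M), IsChoice (fun d d' => d 0 = d' 0 ∧ d 1 = d' 1) X := by
      refine fun X => ⟨fun _ _ => ⟨rfl, rfl⟩, ?_⟩
      rintro d - d' - ⟨h0, h1⟩
      funext i
      fin_cases i
      exacts [h0, h1]
    have harr : ∀ h : Finset (Fin 2 → M), ∃ z, ∀ d ∈ h, E c z ∧ z ≠ d 0 := by
      intro h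
      obtain ⟨y, hy, hyX⟩ := hDg.exists_relE c hc {x : D | ∃ d ∈ h, d 0 = x} (hfin
        (((h.finite_toSet.image fun d => d 0).preimage Subtype.val_injective.injOn).subset (by
          rintro x ⟨d, hd, hdx⟩
          exact ⟨d, hd, hdx⟩)))
      exact ⟨y, fun d hd => ⟨(hE_iff _ _).2 hy, fun h => hyX ⟨d, hd, h.symm⟩⟩⟩
    obtain ⟨z, hz⟩ := hM (fun z d => E c z ∧ z ≠ d 0) (fun d d' => d 0 = d' 0 ∧ d 1 = d' 1)
      ((hE.app₂ (P := E) (Sum.inl c) (Sum.inr (Sum.inl ()))).and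
        (Dfn.eq (Sum.inr (Sum.inl ())) (Sum.inr (Sum.inr 0))).not)
      ((Dfn.eq (Sum.inr (Sum.inl 0)) (Sum.inr (Sum.inr 0))).and
        (Dfn.eq (Sum.inr (Sum.inl 1)) (Sum.inr (Sum.inr 1))))
      (fun _ _ h => ⟨h.1.symm, h.2.symm⟩) (fun _ _ _ h h' => ⟨h.1.trans h'.1, h.2.trans h'.2⟩)
      (fun h _ => harr h) ((fun (x : D) (_ : Fin 2) => (x : M)) '' insert c X)
      (mk_image_le.trans (mk_insert_le.trans (add_le_of_le hκ (hsmall hX)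
        (one_le_aleph0.trans hκ)))) (hchoice _)
    have h1 := hz _ ⟨c, Or.inl rfl, rfl⟩
    obtain ⟨-, hzD, -⟩ := h1.1
    exact ⟨⟨z, hzD⟩, (hE_iff c ⟨z, hzD⟩).1 h1.1, fun hzX => (hz _ ⟨_, Or.inr hzX, rfl⟩).2 rfl⟩
  refine ⟨hEP, hEC, fun A X hA hX hAP r r1 r2 r3 => ?_⟩
  have hA' := hsmall hA
  -- the choices at `x₀` separate `A` from a large set of elements of `P`
  obtain ⟨c, hc, -⟩ := hDg.exists_isQ ∅ ∅ (by simpa using aleph0_pos) (by simpa using aleph0_pos)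
    (by simp) (fun _ _ => True) (by simp) (by simp) (by simp)
  obtain ⟨c', hc', -, hcc'⟩ := hDg.exists_isQ ∅ {c} (by simpa using aleph0_pos)
    (by simp [one_lt_aleph0]) (by simp) (fun _ _ => True) (by simp) (by simp) (by simp)
  have hF : ∀ a : A, ∃ u, RelE c u ∧ RelR u a := fun a => hD.total hc (hAP a a.2)
  choose F hF1 hF2 using hF
  obtain ⟨x₀, hx₀, hx₀F⟩ := hEC c hc (Set.range F) (Order.lt_succ_iff.2 (mk_range_le.trans hA'))
  have hx₀A : ∀ a ∈ A, ¬ RelR x₀ a := fun a ha h =>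
    hx₀F ⟨⟨a, ha⟩, hD.unique (hF2 ⟨a, ha⟩) h (hD.trans (hD.symm (hF1 _)) hx₀)⟩
  have hx₀Q : IsQ x₀ := hD.isQ_of_E (hD.symm hx₀)
  obtain ⟨g⟩ : Nonempty (A ↪ {y : D | RelE c' y}) := by
    refine le_def _ _ |>.1 ?_
    by_contra hlt
    obtain ⟨y, hy, hy'⟩ := hEC c' hc' {y : D | RelE c' y}
      (Order.lt_succ_iff.2 ((not_le.1 hlt).le.trans hA'))
    exact hy' hy
  have hmark : ∀ a : A, ∃ p : D, RelR x₀ p ∧ RelR (g a : D) p := by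
    intro a
    obtain ⟨p, -, hp⟩ := hEP {x₀, (g a : D)} ((hfin (by simp)).trans_le (hκ.trans (Order.le_succ _)))
      (by
        rintro x (rfl | rfl)
        · exact hx₀Q
        · exact hD.isQ_of_E (hD.symm (g a).2)) (by
        have h1 : ¬ RelE x₀ (g a : D) := fun h =>
          hcc' c rfl (hD.trans (g a).2 (hD.symm (hD.trans hx₀ h)))
        rintro x (rfl | rfl) y (rfl | rfl) h
        · rfl
        · exact absurd h h1
        · exact absurd (hD.symm h) h1
        · rfl)
    exact ⟨p, hp _ (by simp), hp _ (by simp)⟩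
  choose mark hmark1 hmark2 using hmark
  have hmark_inj : Function.Injective mark := fun a b h => by
    refine g.injective (Subtype.ext (hD.unique (hmark2 a) (h ▸ hmark2 b) ?_))
    exact hD.trans (hD.symm (g a).2) (g b).2
  let s : Setoid A := ⟨fun a b => r a b, fun a => r1 a a.2, fun h => r2 _ _ h,
    fun h h' => r3 _ _ _ h h'⟩
  let rep : A → D := fun a => mark (Quotient.mk s a).out
  have hrep : ∀ a b : A, rep a = rep b ↔ r a b := by
    intro a b
    rw [hmark_inj.eq_iff, Quotient.out_inj, Quotient.eq]
    exact Iff.rfl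
  have hrepR : ∀ a, RelR x₀ (rep a) := fun a => hmark1 _
  -- the codes: an element outside the large set chooses as the code prescribes, the elements of the
  -- large set choose differently, and given classes are avoided
  let C₁ : (Fin 2 → M) → Prop := fun d => (P (d 0) ∧ ¬ R x₀ (d 0)) ∧ P (d 1) ∧ R x₀ (d 1)
  let C₂ : (Fin 2 → M) → Prop := fun d => R x₀ (d 0) ∧ R x₀ (d 1) ∧ d 0 ≠ d 1
  let C₃ : (Fin 2 → M) → Prop := fun d => E (d 0) (d 0) ∧ d 0 = d 1
  let ρ : M → (Fin 2 → M) → Prop := fun y d => E y y ∧ (C₁ d → S y (d 0) (d 1)) ∧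
    (C₂ d → ¬ S y (d 0) (d 1)) ∧ (C₃ d → ¬ E y (d 0))
  let ε : (Fin 2 → M) → (Fin 2 → M) → Prop := fun d d' => (C₁ d ∧ C₁ d' ∧ d 0 = d' 0) ∨
    ((C₂ d ∨ C₃ d) ∧ d 0 = d' 0 ∧ d 1 = d' 1)
  have hC : ∀ {γ : Type} (f : Fin 2 → γ), Dfn L (fun v : γ → M => C₁ (v ∘ f)) ∧
      Dfn L (fun v : γ → M => C₂ (v ∘ f)) ∧ Dfn L (fun v : γ → M => C₃ (v ∘ f)) := by
    intro γ f
    refine ⟨?_, ?_, ?_⟩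
    · exact ((hP.app₁ (P := P) (Sum.inr (f 0))).and
        (hR.app₂ (P := R) (Sum.inl x₀) (Sum.inr (f 0))).not).and
        ((hP.app₁ (P := P) (Sum.inr (f 1))).and (hR.app₂ (P := R) (Sum.inl x₀) (Sum.inr (f 1))))
    · exact (hR.app₂ (P := R) (Sum.inl x₀) (Sum.inr (f 0))).and
        ((hR.app₂ (P := R) (Sum.inl x₀) (Sum.inr (f 1))).and
        (Dfn.eq (Sum.inr (f 0)) (Sum.inr (f 1))).not)
    · exact (hE.app₂ (P := E) (Sum.inr (f 0)) (Sum.inr (f 0))).and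
        (Dfn.eq (Sum.inr (f 0)) (Sum.inr (f 1)))
  have hρ : Dfn L fun v : Unit ⊕ Fin 2 → M => ρ (v (Sum.inl ())) (v ∘ Sum.inr) := by
    obtain ⟨h1, h2, h3⟩ := hC (Sum.inr : Fin 2 → Unit ⊕ Fin 2)
    have hS' := hS.app₃ (γ := Unit ⊕ Fin 2) (P := S) (Sum.inr (Sum.inl ())) (Sum.inr (Sum.inr 0))
      (Sum.inr (Sum.inr 1))
    exact (hE.app₂ (P := E) (Sum.inr (Sum.inl ())) (Sum.inr (Sum.inl ()))).and
      ((h1.imp hS').and ((h2.imp hS'.not).and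
        (h3.imp (hE.app₂ (P := E) (Sum.inr (Sum.inl ())) (Sum.inr (Sum.inr 0))).not)))
  have hε : Dfn L fun v : Fin 2 ⊕ Fin 2 → M => ε (v ∘ Sum.inl) (v ∘ Sum.inr) := by
    obtain ⟨h1, h2, h3⟩ := hC (Sum.inl : Fin 2 → Fin 2 ⊕ Fin 2)
    obtain ⟨h1', -, -⟩ := hC (Sum.inr : Fin 2 → Fin 2 ⊕ Fin 2)
    have e0 := Dfn.eq (L := L) (M := M) (γ := Fin 2 ⊕ Fin 2) (Sum.inr (Sum.inl 0)) (Sum.inr (Sum.inr 0))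
    have e1 := Dfn.eq (L := L) (M := M) (γ := Fin 2 ⊕ Fin 2) (Sum.inr (Sum.inl 1)) (Sum.inr (Sum.inr 1))
    exact (h1.and (h1'.and e0)).or ((h2.or h3).and (e0.and e1))
  have hext : ∀ {d d' : Fin 2 → M}, d 0 = d' 0 → d 1 = d' 1 → d = d' := fun h0 h1 => by
    funext i
    fin_cases i
    exacts [h0, h1]
  have hRP : ∀ {u a}, R u a → P a := fun ⟨_, h', h⟩ => ⟨h', hD.isP_of_R h⟩
  have hC12 : ∀ {d}, C₁ d → ¬ C₂ d := fun h1 h2 => h1.1.2 h2.1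
  have hC13 : ∀ {d}, C₁ d → ¬ C₃ d := fun ⟨⟨⟨_, h1⟩, _⟩, _⟩ ⟨⟨_, _, h2⟩, _⟩ =>
    hD.not_isP_of_isQ (hD.isQ_of_E h2) h1
  have harr : ∀ h : Finset (Fin 2 → M), IsChoice ε (h : Set (Fin 2 → M)) → ∃ z, ∀ d ∈ h, ρ z d := by
    intro h hh
    -- each element of `P` chooses as its normal form prescribes
    let nf : M → M := fun a => if hex : ∃ d ∈ h, C₁ d ∧ d 0 = a then hex.choose 1 else a
    have hnf1 : ∀ d ∈ h, C₁ d → nf (d 0) = d 1 := by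
      intro d hd h1
      have hex : ∃ d' ∈ h, C₁ d' ∧ d' 0 = d 0 := ⟨d, hd, h1, rfl⟩
      simp only [nf, dif_pos hex]
      obtain ⟨h2, h3, h4⟩ := hex.choose_spec
      rw [hh.2 _ h2 _ hd (Or.inl ⟨h3, h1, h4⟩)]
    have hnf2 : ∀ a, R x₀ a → nf a = a := by
      intro a ha
      refine dif_neg ?_
      rintro ⟨d, -, hd, rfl⟩
      exact hd.1.2 ha
    have hfin' : ∀ i : Fin 2, {a : D | ∃ d ∈ h, d i = a}.Finite := fun i =>
      ((h.finite_toSet.image fun d => d i).preimage Subtype.val_injective.injOn).subset (by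
        rintro x ⟨d, hd, hdx⟩
        exact ⟨d, hd, hdx⟩)
    obtain ⟨y, hy, hyS, hyE⟩ := hDg.exists_isQ
      {a : D | IsP a ∧ ((∃ d ∈ h, d 0 = a) ∨ ∃ d ∈ h, d 1 = a)} {a : D | ∃ d ∈ h, d 0 = a}
      (hfin (((hfin' 0).union (hfin' 1)).subset fun _ h => h.2)) (hfin (hfin' 0)) (fun _ h => h.1)
      (fun a b => nf a = nf b) (fun _ _ => rfl) (fun _ _ h => h.symm) (fun _ _ _ h h' => h.trans h')
    have hyS' : ∀ d ∈ h, P (d 0) → P (d 1) → (S y (d 0) (d 1) ↔ nf (d 0) = nf (d 1)) := by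
      rintro d hd ⟨h0, h0P⟩ ⟨h1, h1P⟩
      exact (hS_iff y ⟨_, h0⟩ ⟨_, h1⟩).trans (hyS ⟨_, h0⟩ ⟨h0P, Or.inl ⟨d, hd, rfl⟩⟩ ⟨_, h1⟩
        ⟨h1P, Or.inr ⟨d, hd, rfl⟩⟩)
    refine ⟨y, fun d hd => ⟨(hE_iff _ _).2 (hD.refl hy), fun h1 => ?_, fun h2 => ?_, fun h3 => ?_⟩⟩
    · exact (hyS' d hd h1.1.1 h1.2.1).2 ((hnf1 d hd h1).trans (hnf2 _ h1.2.2).symm)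
    · rw [hyS' d hd (hRP h2.1) (hRP h2.2.1), hnf2 _ h2.1, hnf2 _ h2.2.1]
      exact h2.2.2
    · rintro ⟨_, h0, h⟩
      exact hyE ⟨_, h0⟩ ⟨d, hd, rfl⟩ h
  have hPD : ∀ a ∈ A, P a := fun a ha => (hP_iff a).2 (hAP a ha)
  have hrepR' : ∀ a, R x₀ (rep a) := fun a => (hR_iff _ _).2 (hrepR a)
  let X' := insert c {x ∈ X | IsQ x}
  let Y : Set (Fin 2 → M) := Set.range (fun a : A => ![(a : M), rep a]) ∪
    ((fun p : A × A => ![(rep p.1 : M), rep p.2]) '' {p | rep p.1 ≠ rep p.2} ∪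
      (fun x : D => ![(x : M), x]) '' X')
  have hY1 : ∀ a : A, C₁ ![(a : M), rep a] := fun a =>
    ⟨⟨hPD a a.2, fun h => hx₀A a a.2 ((hR_iff _ _).1 h)⟩, hRP (hrepR' a), hrepR' a⟩
  have hY2 : ∀ p : A × A, rep p.1 ≠ rep p.2 → C₂ ![(rep p.1 : M), rep p.2] := fun p hp =>
    ⟨hrepR' _, hrepR' _, fun h => hp (Subtype.ext h)⟩
  have hY3 : ∀ x ∈ X', C₃ ![(x : M), x] := fun x hx => ⟨(hE_iff _ _).2 (hD.refl (by
    rcases hx with rfl | hx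
    · exact hc
    · exact hx.2)), rfl⟩
  obtain ⟨y, hy⟩ := hM ρ ε hρ hε
    (by
      rintro d d' (⟨h1, h2, h3⟩ | ⟨h1, h2, h3⟩)
      · exact Or.inl ⟨h2, h1, h3.symm⟩
      · obtain rfl := hext h2 h3
        exact Or.inr ⟨h1, rfl, rfl⟩)
    (by
      rintro d d' d'' (⟨h1, h2, h3⟩ | ⟨h1, h2, h3⟩) hd
      · rcases hd with ⟨h4, h5, h6⟩ | ⟨h4, h5, h6⟩
        · exact Or.inl ⟨h1, h5, h3.trans h6⟩
        · exact (h4.elim (hC12 h2) (hC13 h2)).elim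
      · obtain rfl := hext h2 h3
        exact hd) harr Y (by
      refine (mk_union_le _ _).trans (add_le_of_le hκ (mk_range_le.trans hA')
        ((mk_union_le _ _).trans (add_le_of_le hκ (mk_image_le.trans ((mk_set_le _).trans
          (mk_prod_le_of_le hκ hA' hA'))) (mk_image_le.trans (mk_insert_le.trans
            (add_le_of_le hκ ((mk_le_mk_of_subset fun _ h => h.1).trans (hsmall hX))
              (one_le_aleph0.trans hκ)))))))) ⟨by
      rintro _ (⟨a, rfl⟩ | ⟨p, hp, rfl⟩ | ⟨x, hx, rfl⟩)
      · exact Or.inl ⟨hY1 a, hY1 a, rfl⟩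
      · exact Or.inr ⟨Or.inl (hY2 p hp), rfl, rfl⟩
      · exact Or.inr ⟨Or.inr (hY3 x hx), rfl, rfl⟩, by
      have hcase : ∀ d ∈ Y, C₁ d → ∃ a : A, d = ![(a : M), rep a] := by
        rintro _ (⟨a, rfl⟩ | ⟨p, hp, rfl⟩ | ⟨x, hx, rfl⟩) h1
        · exact ⟨a, rfl⟩
        · exact (hC12 h1 (hY2 p hp)).elim
        · exact (hC13 h1 (hY3 x hx)).elim
      rintro d hd d' hd' (⟨h1, h2, h3⟩ | ⟨h1, h2, h3⟩)
      · obtain ⟨a, rfl⟩ := hcase d hd h1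
        obtain ⟨b, rfl⟩ := hcase d' hd' h2
        obtain rfl : a = b := Subtype.ext (Subtype.ext h3)
        rfl
      · exact hext h2 h3⟩
  obtain ⟨⟨hyD, _, hyy⟩, -⟩ := hy _ (Or.inr (Or.inr ⟨c, Or.inl rfl, rfl⟩))
  have hyQ : IsQ (⟨y, hyD⟩ : D) := hD.isQ_of_E hyy
  have h1 : ∀ a : A, RelS (⟨y, hyD⟩ : D) a (rep a) := fun a =>
    (hS_iff _ _ _).1 ((hy _ (Or.inl ⟨a, rfl⟩)).2.1 (hY1 a))
  refine ⟨⟨y, hyD⟩, hyQ, fun a ha b hb => ?_, fun x hx hyx => ?_⟩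
  · rw [← hrep ⟨a, ha⟩ ⟨b, hb⟩]
    constructor
    · intro hab
      by_contra hne
      refine (hy _ (Or.inr (Or.inl ⟨(⟨a, ha⟩, ⟨b, hb⟩), hne, rfl⟩))).2.2.1
        (hY2 (⟨a, ha⟩, ⟨b, hb⟩) hne) ((hS_iff ⟨y, hyD⟩ _ _).2 ?_)
      exact hD.relS_trans (RelS.symm (h1 ⟨a, ha⟩)) (hD.relS_trans hab (h1 ⟨b, hb⟩))
    · intro hab
      have h2 := h1 ⟨a, ha⟩
      rw [hab] at h2
      exact hD.relS_trans h2 (RelS.symm (h1 ⟨b, hb⟩))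
  · have hxQ : IsQ x := hD.isQ_of_E (hD.symm hyx)
    exact (hy _ (Or.inr (Or.inr ⟨x, Or.inr ⟨hx, hxQ⟩, rfl⟩))).2.2.2 (hY3 x (Or.inr ⟨hx, hxQ⟩))
      ((hE_iff ⟨y, hyD⟩ x).2 hyx)

end Interpreted

/-! ### Saturation of interpreted structures -/

section Saturation

open Cardinal

/-- Saturation in terms of formulas without constants, the parameters being listed by an arbitrary
small family. -/
theorem isSaturated_iff {L : FirstOrder.Language.{u₀, v₀}} {κ : Cardinal.{u}} {M : Type u}
    [L.Structure M] : IsSaturated L κ M ↔ ∀ (I : Type u) (c : I → M), #I < κ →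
      ∀ p : Set (L.Formula (I ⊕ Fin 1)),
        (∀ p₀ : Finset (L.Formula (I ⊕ Fin 1)), (∀ φ ∈ p₀, φ ∈ p) →
          ∃ a : M, ∀ φ ∈ p₀, φ.Realize (Sum.elim c fun _ => a)) →
        ∃ a : M, ∀ φ ∈ p, φ.Realize (Sum.elim c fun _ => a) := by
  classical
  have key : ∀ {A : Set M} (φ : L[[A]].Formula (Fin 1)) (a : M), φ.Realize (fun _ => a) ↔
      Formula.Realize (BoundedFormula.constantsVarsEquiv φ : L.Formula (A ⊕ Fin 1))
        (Sum.elim (fun a : A => (a : M)) fun _ => a) := fun φ a =>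
    (BoundedFormula.realize_constantsVarsEquiv (φ := φ)).symm
  constructor
  · intro h I c hI p hp
    let f : L.Formula (I ⊕ Fin 1) → L[[Set.range c]].Formula (Fin 1) := fun φ =>
      BoundedFormula.constantsVarsEquiv.symm (φ.relabel (Sum.map (Set.rangeFactorization c) id))
    have hf : ∀ φ a, (f φ).Realize (fun _ => a) ↔ φ.Realize (Sum.elim c fun _ => a) := by
      intro φ a
      refine (key (f φ) a).trans ?_
      simp only [f, Equiv.apply_symm_apply]
      refine Formula.realize_relabel.trans (realize_congr ?_)
      rintro (i | i) <;> rfl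
    obtain ⟨a, ha⟩ := h (Set.range c) (mk_range_le.trans_lt hI) (f '' p) (by
      intro p₀ hp₀
      choose g hg hfg using fun φ : p₀ => hp₀ φ φ.2
      obtain ⟨a, ha⟩ := hp (Finset.univ.image g) (by
        intro φ hφ
        obtain ⟨ψ, -, rfl⟩ := Finset.mem_image.1 hφ
        exact hg ψ)
      refine ⟨a, fun φ hφ => ?_⟩
      have := (hf _ a).2 (ha _ (Finset.mem_image_of_mem g (Finset.mem_univ ⟨φ, hφ⟩)))
      rwa [hfg] at this)
    exact ⟨a, fun φ hφ => (hf φ a).1 (ha _ ⟨φ, hφ, rfl⟩)⟩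
  · intro h A hA p hp
    obtain ⟨a, ha⟩ := h A (fun a => a) hA (BoundedFormula.constantsVarsEquiv '' p) (by
      intro p₀ hp₀
      obtain ⟨a, ha⟩ := hp (p₀.image BoundedFormula.constantsVarsEquiv.symm) (by
        intro φ hφ
        obtain ⟨ψ, hψ, rfl⟩ := Finset.mem_image.1 hφ
        obtain ⟨θ, hθ, rfl⟩ := hp₀ ψ hψ
        rwa [Equiv.symm_apply_apply])
      refine ⟨a, fun φ hφ => ?_⟩
      have := (key _ a).1 (ha _ (Finset.mem_image_of_mem _ hφ))
      rwa [Equiv.apply_symm_apply] at this)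
    exact ⟨a, fun φ hφ => (key φ a).2 (ha _ ⟨φ, hφ, rfl⟩)⟩

/-- Realising a type: in an elementary extension by compactness, and then in the generic model by
the one-point extension property. -/
theorem isSaturated_of_isFeqGeneric {κ : Cardinal.{u}} (hκ : ℵ₀ ≤ κ) {B : Type u} [Lfeq.Structure B]
    (hB : B ⊨ TfeqStar) (hg : IsFeqGeneric κ B) : IsSaturated Lfeq κ B := by
  refine isSaturated_iff.2 fun A c hA p hp => ?_
  have hB' := isFeqPlus_of_model_TfeqStar hB
  -- the type together with the elementary diagram of the parameters
  let G : Set (Lfeq.Formula (A ⊕ Fin 1)) := p ∪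
    {χ | ∃ θ : Lfeq.Formula A, θ.Realize c ∧ θ.relabel Sum.inl = χ}
  obtain ⟨K, _, _, x, hx⟩ := exists_realize_of_finite G (fun Θ hΘ => by
    classical
    obtain ⟨b, hb⟩ := hp (Θ.filter (· ∈ p)) fun φ hφ => (Finset.mem_filter.1 hφ).2
    have hBne : Nonempty B := ⟨b⟩
    refine ⟨B, hBne, inferInstance, Sum.elim c fun _ => b, fun χ hχ => ?_⟩
    rcases hΘ χ hχ with hχp | ⟨θ, hθ, rfl⟩
    · exact hb χ (Finset.mem_filter.2 ⟨hχ, hχp⟩)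
    · exact Formula.realize_relabel.2 hθ)
  have hdiag : ∀ θ : Lfeq.Formula A, θ.Realize (fun a => x (Sum.inl a)) ↔
      θ.Realize c := by
    have h1 : ∀ θ : Lfeq.Formula A, θ.Realize c →
        θ.Realize (fun a => x (Sum.inl a)) := fun θ hθ =>
      Formula.realize_relabel.1 (hx _ (Or.inr ⟨θ, hθ, rfl⟩))
    refine fun θ => ⟨fun h => ?_, h1 θ⟩
    by_contra hn
    exact Formula.realize_not.1 (h1 θ.not (Formula.realize_not.2 hn)) h
  have hK : K ⊨ TfeqStar := Theory.model_iff _ |>.2 fun σ hσ => by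
    have := (hdiag (Formula.relabel Empty.elim σ)).2
    rw [Formula.realize_relabel, Formula.realize_relabel] at this
    have e : ∀ {X : Type u} [Lfeq.Structure X] (v : Empty → X), σ.Realize X ↔ Formula.Realize σ v :=
      fun v => by rw [Sentence.Realize, Subsingleton.elim v default]
    exact (e _).2 (this ((e _).1 (Theory.realize_sentence_of_mem TfeqStar hσ)))
  have hK' := isFeqPlus_of_model_TfeqStar hK
  have hsim : FeqSim (fun a : A => x (Sum.inl a)) c := by
    let w : A → K := fun a => x (Sum.inl a)
    refine ⟨fun i j => ?_, fun i => ?_, fun i j => ?_, fun i j => ?_, fun i j k => ?_⟩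
    · exact (realize_vEq (v := w)).symm.trans ((hdiag (vEq i j)).trans realize_vEq)
    · exact (realize_vP (v := w)).symm.trans ((hdiag (vP i)).trans realize_vP)
    · exact (realize_vE (v := w)).symm.trans ((hdiag (vE i j)).trans realize_vE)
    · exact (realize_vR (v := w)).symm.trans ((hdiag (vR i j)).trans realize_vR)
    · have e : ∀ {X : Type u} [Lfeq.Structure X] (v : A → X), Formula.Realize (Formula.iExs Unit
          (vE (Sum.inl i) (Sum.inr ()) ⊓ (vR (Sum.inr ()) (Sum.inl j) ⊓
            vR (Sum.inr ()) (Sum.inl k)) : Lfeq.Formula (A ⊕ Unit))) v ↔ RelS (v i) (v j) (v k) := by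
        intro X _ v
        rw [Formula.realize_iExs]
        simp only [Formula.realize_inf, realize_vE, realize_vR, Sum.elim_inl, Sum.elim_inr]
        exact ⟨fun ⟨w, hw⟩ => ⟨w (), hw⟩, fun ⟨u, hu⟩ => ⟨fun _ => u, hu⟩⟩
      exact (e _).symm.trans ((hdiag _).trans (e _))
  obtain ⟨y, hy⟩ := hsim.exists_option hκ hK' hB' hg (mk_range_le.trans_lt hA) (x (Sum.inr 0))
  have hy' := hy.comp (Sum.elim some fun _ => none : A ⊕ Fin 1 → Option A)
  refine ⟨y, fun φ hφ => ?_⟩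
  have h1 := hx _ (Or.inl hφ)
  refine (realize_congr ?_).1 ((hy'.realize_formula hK' hB' (isFeqGeneric_of_model_TfeqStar hK)
    (isFeqGeneric_of_model_TfeqStar hB) _).1 ((realize_congr ?_).1 h1))
  · rintro (a | i) <;> rfl
  · rintro (a | i)
    · rfl
    · exact congrArg (fun i => x (Sum.inr i)) (Subsingleton.elim i 0)

/-- Saturated dense linear orders have no unfilled cuts. -/
theorem IsSaturated.exists_le_lt {κ : Cardinal.{u}} (hκ : ℵ₀ ≤ κ) {N : Type u}
    [Language.order.Structure N] [LinearOrder N] [Language.order.OrderedStructure N] [NoMinOrder N]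
    [Nonempty N] (hN : IsSaturated Language.order κ N) {I J : Type u} (hI : #I < κ) (hJ : #J < κ)
    {a : I → N} {b : J → N} (hab : ∀ i j, a i < b j) :
    ∃ x, (∀ i, a i ≤ x) ∧ ∀ j, x < b j := by
  classical
  let le : I ⊕ J → Language.order.Formula ((I ⊕ J) ⊕ Fin 1) := fun s =>
    Relations.formula₂ leSymb (Term.var (Sum.inl s)) (Term.var (Sum.inr 0))
  have hle : ∀ s x, (le s).Realize (Sum.elim (Sum.elim a b) fun _ => x) ↔ Sum.elim a b s ≤ x :=
    fun s x => Formula.realize_rel₂.trans (by simp)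
  obtain ⟨x, hx⟩ := isSaturated_iff.1 hN (I ⊕ J) (Sum.elim a b)
    (by rw [mk_sum, lift_id, lift_id]; exact add_lt_of_lt hκ hI hJ)
    (Set.range (fun i => le (Sum.inl i)) ∪ Set.range fun j => (le (Sum.inr j)).not) (by
      intro p₀ hp₀
      -- finitely many indices suffice
      have hex : ∀ φ : p₀, ∃ s : I ⊕ J, ∀ x : N, (∀ i, s = Sum.inl i → a i ≤ x) →
          (∀ j, s = Sum.inr j → x < b j) → φ.1.Realize (Sum.elim (Sum.elim a b) fun _ => x) := by
        rintro ⟨φ, hφ⟩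
        rcases hp₀ φ hφ with ⟨i, rfl⟩ | ⟨j, rfl⟩
        · exact ⟨Sum.inl i, fun x h _ => (hle _ x).2 (h i rfl)⟩
        · exact ⟨Sum.inr j, fun x _ h => Formula.realize_not.2 fun h' =>
            ((hle _ x).1 h').not_gt (h j rfl)⟩
      choose s hs using hex
      have hfin : (Set.range s).Finite := Set.finite_range s
      obtain ⟨x, hx1, hx2⟩ : ∃ x, (∀ i, Sum.inl i ∈ Set.range s → a i ≤ x) ∧
          ∀ j, Sum.inr j ∈ Set.range s → x < b j := by
        by_cases hI' : ∃ i, Sum.inl i ∈ Set.range s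
        · obtain ⟨i₀, hi₀, hmax⟩ := Set.exists_max_image _ a
            (hfin.preimage (f := Sum.inl) Sum.inl_injective.injOn) hI'
          exact ⟨a i₀, hmax, fun j _ => hab i₀ j⟩
        · push Not at hI'
          by_cases hJ' : ∃ j, Sum.inr j ∈ Set.range s
          · obtain ⟨j₀, hj₀, hmin⟩ := Set.exists_min_image _ b
              (hfin.preimage (f := Sum.inr) Sum.inr_injective.injOn) hJ'
            obtain ⟨x, hx⟩ := exists_lt (b j₀)
            exact ⟨x, fun i hi => absurd hi (hI' i), fun j hj => hx.trans_le (hmin j hj)⟩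
          · push Not at hJ'
            exact ⟨Classical.arbitrary N, fun i hi => absurd hi (hI' i),
              fun j hj => absurd hj (hJ' j)⟩
      exact ⟨x, fun φ hφ => hs ⟨φ, hφ⟩ x (fun i hi => hx1 i ⟨_, hi⟩) fun j hj => hx2 j ⟨_, hj⟩⟩)
  refine ⟨x, fun i => (hle (Sum.inl i) x).1 (hx _ (Or.inl ⟨i, rfl⟩)), fun j => ?_⟩
  exact not_le.1 fun h => Formula.realize_not.1 (hx _ (Or.inr ⟨j, rfl⟩)) ((hle (Sum.inr j) x).2 h)

variable {L : FirstOrder.Language.{u, u}} {M : Type u} [L.Structure M]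
  {L' : FirstOrder.Language.{u₁, v₁}} [L'.Structure M]

/-- In a structure that realises arrays, all interpretations of `T*_feq` are saturated. The language
of the interpretation may contain constants for elements of the structure. -/
theorem Interpretation.saturatedIn_of_realizesArrays {κ : Cardinal.{u}} (hκ : ℵ₀ ≤ κ)
    (hM : RealizesArrays L κ M)
    (hL' : ∀ {n : ℕ} (φ : L'.Formula (Fin n)), Dfn L fun v : Fin n → M => φ.Realize v)
    (ψ : Interpretation Lfeq L') (hψ : ψ.ModelIn TfeqStar M) :
    ψ.SaturatedIn (Order.succ κ) M := by
  obtain ⟨h, hmod⟩ := hψ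
  let := ψ.toStructure M h
  have hD : Dfn L fun v : Fin 1 → M => v 0 ∈ ψ.dom M := by
    have := ((hL' ψ.eq).comp (fun _ => 0 : Fin 2 → Fin 1))
    refine this.congr fun v => realize_congr fun i => ?_
    fin_cases i <;> rfl
  have h1 : ∀ S : Lfeq.Relations 1, Dfn L fun v : Fin 1 → M =>
      ∃ h : v 0 ∈ ψ.dom M, Structure.RelMap S ![(⟨v 0, h⟩ : ψ.dom M)] := fun S => by
    refine (hD.and (hL' (ψ.rel S))).congr fun v => ?_
    rw [← exists_prop]
    refine exists_congr fun h => realize_congr fun i => ?_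
    fin_cases i
    rfl
  have h2 : ∀ S : Lfeq.Relations 2, Dfn L fun v : Fin 2 → M =>
      ∃ (h : v 0 ∈ ψ.dom M) (h' : v 1 ∈ ψ.dom M),
        Structure.RelMap S ![(⟨v 0, h⟩ : ψ.dom M), ⟨v 1, h'⟩] := fun S => by
    refine ((hD.comp fun _ => 0).and ((hD.comp fun _ => 1).and (hL' (ψ.rel S)))).congr fun v => ?_
    rw [← exists_prop, ← exists_prop]
    refine exists_congr fun h => exists_congr fun h' => realize_congr fun i => ?_
    fin_cases i <;> rfl
  exact ⟨h, isSaturated_of_isFeqGeneric (hκ.trans (Order.le_succ κ)) hmod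
    (isFeqGeneric_succ_of_realizesArrays hκ hM (h1 relP) (h2 relE) (h2 relR)
      (isFeqPlus_of_model_TfeqStar hmod) (isFeqGeneric_of_model_TfeqStar hmod))⟩

/-- An unfilled cut of the order shows that an interpretation of the theory of dense linear orders is
not saturated. -/
theorem Interpretation.not_saturatedIn_of_cuts {κ : Cardinal.{u}} (hκ : ℵ₀ ≤ κ)
    (hM : ∀ (φ : L.Formula (ℕ ⊕ Fin 2)) (c : ℕ → M), FinBetween (defRel φ c) →
      ∃ a b : κ.ord.ToType → M, (⟨φ, c, a, b⟩ : Cut L κ.ord.ToType M).IsNested ∧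
        (⟨φ, c, a, b⟩ : Cut L κ.ord.ToType M).Unseparated)
    (hL' : ∀ {n : ℕ} (φ : L'.Formula (Fin n)), Dfn L fun v : Fin n → M => φ.Realize v)
    (φ : Interpretation Language.order L') (hφ : φ.ModelIn Tord M) :
    ¬ φ.SaturatedIn (Order.succ κ) M := by
  classical
  rintro ⟨h, hsat⟩
  obtain ⟨_, hmod⟩ := hφ
  let := φ.toStructure M h
  have : φ.dom M ⊨ Language.order.dlo := hmod
  let : LinearOrder (φ.dom M) := Language.order.linearOrderOfModels (φ.dom M)
  have hdense : DenselyOrdered (φ.dom M) := Language.order.denselyOrdered_of_dlo (φ.dom M)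
  have hbot : NoMinOrder (φ.dom M) := by
    have := Language.order.noBotOrder_of_dlo (M := φ.dom M)
    exact noBotOrder_iff_noMinOrder _ |>.1 this
  have htop : NoMaxOrder (φ.dom M) := by
    have := Language.order.noTopOrder_of_dlo (M := φ.dom M)
    exact noTopOrder_iff_noMaxOrder _ |>.1 this
  have hne : Nonempty (φ.dom M) := h.nonempty.to_subtype
  have hMne : Nonempty M := ⟨(Classical.arbitrary (φ.dom M) : M)⟩
  have hJ : #κ.ord.ToType = κ := mk_ord_toType κ
  have hJne : Nonempty κ.ord.ToType := by
    rw [← mk_ne_zero_iff, hJ]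
    exact (aleph0_pos.trans_le hκ).ne'
  let R : M → M → Prop := fun x y => ∃ (hx : x ∈ φ.dom M) (hy : y ∈ φ.dom M),
    (⟨x, hx⟩ : φ.dom M) ≤ ⟨y, hy⟩
  have hRdom : ∀ x, R x x ↔ x ∈ φ.dom M := fun x => ⟨fun ⟨h, _⟩ => h, fun h => ⟨h, h, le_rfl⟩⟩
  have hD : Dfn L fun v : Fin 1 → M => v 0 ∈ φ.dom M := by
    refine ((hL' φ.eq).comp (fun _ => 0 : Fin 2 → Fin 1)).congr fun v => realize_congr fun i => ?_
    fin_cases i <;> rfl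
  have hR : Dfn L fun v : Fin 2 → M => R (v 0) (v 1) := by
    refine ((hD.comp fun _ => 0).and ((hD.comp fun _ => 1).and (hL' (φ.rel leSymb)))).congr fun v => ?_
    rw [← exists_prop, ← exists_prop]
    refine exists_congr fun h => exists_congr fun h' => realize_congr fun i => ?_
    fin_cases i <;> rfl
  obtain ⟨θ, c, hθ⟩ := hR.exists_nat
  have hθR : defRel θ c = R := by
    funext x y
    exact propext (hθ ![x, y])
  obtain ⟨a, b, hnest, hun⟩ := hM θ c (by
    rw [hθR]
    intro lo hi hlo hhi hlt
    have hlift : ∀ s : Finset M, (∀ x ∈ s, R x x) → ∀ x ∈ s, x ∈ φ.dom M := fun s hs x hx =>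
      (hRdom x).1 (hs x hx)
    -- finite sets can be interpolated since the order is dense without end points
    obtain ⟨m, hm1, hm2⟩ := Order.exists_between_finsets (lo.subtype (· ∈ φ.dom M))
      (hi.subtype (· ∈ φ.dom M)) (by
        intro x hx y hy
        rw [Finset.mem_subtype] at hx hy
        obtain ⟨⟨_, _, h1⟩, h2⟩ := hlt x hx y hy
        exact lt_of_le_of_ne h1 fun h => h2 (congrArg Subtype.val h))
    refine ⟨m, (hRdom _).2 m.2, fun x hx => ?_, fun x hx => ?_⟩
    · have := hm1 ⟨x, hlift lo hlo x hx⟩ (Finset.mem_subtype.2 hx)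
      exact ⟨⟨_, _, this.le⟩, fun h => this.ne (Subtype.ext h)⟩
    · have := hm2 ⟨x, hlift hi hhi x hx⟩ (Finset.mem_subtype.2 hx)
      exact ⟨⟨_, _, this.le⟩, fun h => this.ne (Subtype.ext h)⟩)
  have hrel : (⟨θ, c, a, b⟩ : Cut L κ.ord.ToType M).rel = R := hθR
  obtain ⟨-, -, hn3⟩ := hnest
  rw [hrel] at hn3
  have haD : ∀ i, a i ∈ φ.dom M := fun i => (hn3 i (Classical.arbitrary _)).1.1
  have hbD : ∀ j, b j ∈ φ.dom M := fun j => (hn3 (Classical.arbitrary _) j).1.2.1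
  have hab : ∀ i j, (⟨a i, haD i⟩ : φ.dom M) < ⟨b j, hbD j⟩ := by
    intro i j
    obtain ⟨⟨_, _, h⟩, hne⟩ := hn3 i j
    exact lt_of_le_of_ne h fun h => hne (congrArg Subtype.val h)
  have hJ' : #κ.ord.ToType < Order.succ κ := hJ.le.trans_lt (Order.lt_succ κ)
  obtain ⟨x, hxa, hxb⟩ := hsat.exists_le_lt (hκ.trans (Order.le_succ κ)) hJ' hJ' hab
  -- the set of elements below an element filling the cut would separate its sides
  obtain ⟨i, j, hij⟩ := hun (fun y => R y x) ((hR.app₂ (P := R) (Sum.inr ()) (Sum.inl (x : M))))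
  refine hij ⟨fun y z hyz hzx => ?_, ?_, ?_⟩
  · rw [hrel] at hyz
    obtain ⟨h1, h2, h3⟩ := hyz
    obtain ⟨_, h4, h5⟩ := hzx
    exact ⟨h1, h4, h3.trans h5⟩
  · exact ⟨haD i, x.2, hxa i⟩
  · rintro ⟨_, _, h⟩
    exact (hxb j).not_ge h

end Saturation

/-! ### Interpretations given by reducts -/

section Reduct

open Cardinal

theorem IsSaturated.of_equiv {L : FirstOrder.Language.{u₀, v₀}} {κ : Cardinal.{u}} {M N : Type u}
    [L.Structure M] [L.Structure N] (e : M ≃[L] N) (hM : IsSaturated L κ M) : IsSaturated L κ N := by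
  refine isSaturated_iff.2 fun I c hI p hp => ?_
  have key : ∀ (φ : L.Formula (I ⊕ Fin 1)) (a : M), φ.Realize (Sum.elim c fun _ => e a) ↔
      φ.Realize (Sum.elim (e.symm ∘ c) fun _ => a) := by
    intro φ a
    rw [← StrongHomClass.realize_formula e]
    refine realize_congr ?_
    rintro (i | i)
    · exact (e.apply_symm_apply (c i)).symm
    · rfl
  obtain ⟨a, ha⟩ := isSaturated_iff.1 hM I (e.symm ∘ c) hI p (fun p₀ hp₀ => by
    obtain ⟨a, ha⟩ := hp p₀ hp₀
    exact ⟨e.symm a, fun φ hφ => (key φ _).1 (by simpa using ha φ hφ)⟩)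
  exact ⟨e a, fun φ hφ => (key φ a).2 (ha φ hφ)⟩

variable {L₀ : FirstOrder.Language.{u₀, v₀}} {L : FirstOrder.Language.{u₁, v₁}}

/-- The interpretation of the reduct along a map of languages. -/
def reductInterpretation (ι : L₀ →ᴸ L) : Interpretation L₀ L where
  eq := Term.equal (Term.var 0) (Term.var 1)
  rel R := (ι.onRelation R).formula fun i => Term.var i
  func f := Term.equal (Term.func (ι.onFunction f) fun i => Term.var i.castSucc)
    (Term.var (Fin.last _))

variable {M : Type u} [L.Structure M] [L₀.Structure M] (ι : L₀ →ᴸ L) [ι.IsExpansionOn M]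

theorem reductInterpretation_dom {M : Type u} [L.Structure M] (ι : L₀ →ᴸ L) (x : M) :
    x ∈ (reductInterpretation ι).dom M := by
  show Formula.Realize (Term.equal _ _) _
  rw [Formula.realize_equal]
  rfl

theorem realize_reductInterpretation_func {n : ℕ} (f : L₀.Functions n) (a : Fin n → M) (b : M) :
    ((reductInterpretation ι).func f).Realize (Fin.snoc a b : Fin (n + 1) → M) ↔
      Structure.funMap f a = b := by
  show Formula.Realize (Term.equal _ _) _ ↔ _
  rw [Formula.realize_equal]
  simp only [Term.realize_func, Term.realize_var, Fin.snoc_castSucc, Fin.snoc_last,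
    LHom.map_onFunction]

theorem reductInterpretation_definesStructure [Nonempty M] :
    (reductInterpretation ι).DefinesStructure M := by
  refine ⟨⟨Classical.arbitrary M, reductInterpretation_dom ι _⟩, fun f a => ?_⟩
  refine ⟨⟨Structure.funMap f fun i => (a i : M), reductInterpretation_dom ι _⟩,
    (realize_reductInterpretation_func ι f _ _).2 rfl, fun b hb => Subtype.ext ?_⟩
  exact ((realize_reductInterpretation_func ι f _ _).1 hb).symm

/-- The reduct as the interpreted structure. -/
def reductInterpretationEquiv (h : (reductInterpretation ι).DefinesStructure M) :
    letI := (reductInterpretation ι).toStructure M h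
    M ≃[L₀] (reductInterpretation ι).dom M :=
  letI := (reductInterpretation ι).toStructure M h
  { toFun := fun x => ⟨x, reductInterpretation_dom ι x⟩
    invFun := fun x => x
    left_inv := fun _ => rfl
    right_inv := fun _ => rfl
    map_fun' := fun f a => Subtype.ext ((realize_reductInterpretation_func ι f _ _).1
      (h.functional f fun i => ⟨a i, reductInterpretation_dom ι (a i)⟩).choose_spec.1)
    map_rel' := fun R a => by
      show Formula.Realize (Relations.formula _ _) _ ↔ _
      rw [Formula.realize_rel]
      exact iff_of_eq (LHom.map_onRelation ι R a) }

theorem modelIn_reductInterpretation [Nonempty M] {T₀ : L₀.Theory} (hM : M ⊨ T₀) :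
    (reductInterpretation ι).ModelIn T₀ M := by
  have h := reductInterpretation_definesStructure (M := M) ι
  let := (reductInterpretation ι).toStructure M h
  exact ⟨h, (StrongHomClass.theory_model (reductInterpretationEquiv ι h))⟩

theorem saturatedIn_reductInterpretation [Nonempty M] {κ : Cardinal.{u}} :
    (reductInterpretation ι).SaturatedIn κ M ↔ IsSaturated L₀ κ M := by
  constructor
  · rintro ⟨h, hM⟩
    let := (reductInterpretation ι).toStructure M h
    exact hM.of_equiv (reductInterpretationEquiv ι h).symm
  · intro hM
    have h := reductInterpretation_definesStructure (M := M) ι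
    let := (reductInterpretation ι).toStructure M h
    exact ⟨h, hM.of_equiv (reductInterpretationEquiv ι h)⟩

end Reduct

/-! ### Realising types along branches of a tree -/

section CodeTree

open Cardinal

/-- A linearly ordered set, viewed as a tree of height `ℕ`, in a form that makes sense in nonstandard
models. The elements `p` with `lev p` stand for the natural numbers, `agree x y p` says that the
branches `x` and `y` coincide below the level `p`, a condition that holds on a convex set. The entries
of a branch are codes, `rho z c` says that `z` satisfies the code `c`, `sat z x p` that `z` satisfies
all entries of `x` below `p`, and `con x p c` that these entries are consistent with the code `c`. -/
structure IsCodeTree {M : Type*} (le : M → M → Prop) (lev : M → Prop) (rho : M → M → Prop)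
    (agree sat con : M → M → M → Prop) : Prop where
  floor : ∀ r, ∃ p, lev p ∧ (∀ a, lev a → le a r → le a p) ∧ ∀ b, lev b → le r b → le p b
  interval : ∀ x p p', lev p → lev p' → le p p' → p ≠ p' → ∃ lo hi,
    (∀ y, agree x y p' → le lo y ∧ le y hi) ∧ ∀ y, le lo y → le y hi → agree x y p
  agree_refl : ∀ x p, agree x x p
  agree_symm : ∀ x y p, agree x y p → agree y x p
  agree_trans : ∀ x y z p, agree x y p → agree y z p → agree x z p
  agree_mono : ∀ x y p p', lev p → lev p' → le p p' → agree x y p' → agree x y p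
  sat_congr : ∀ z x y p, agree x y p → sat z x p → sat z y p
  sat_mono : ∀ z x p p', lev p → lev p' → le p p' → sat z x p' → sat z x p
  con_iff : ∀ x p c, con x p c ↔ ∃ z, sat z x p ∧ rho z c
  extend : ∀ x p c, lev p → ∃ x' p', lev p' ∧ le p p' ∧ agree x x' p ∧
    ∀ z, sat z x' p' ↔ sat z x p ∧ rho z c
  root : ∃ x p, lev p ∧ ∀ z, sat z x p
  last : ∀ x c p p', lev p → lev p' → con x p c → ¬ con x p' c →
    ∃ q, lev q ∧ con x q c ∧ ∀ p, lev p → con x p c → le p q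

variable {M : Type u} {le : M → M → Prop} {lev : M → Prop} {rho : M → M → Prop}
  {agree sat con : M → M → M → Prop}

/-- If a code tree has no unfilled cuts then any directed family of at most `κ` satisfiable codes is
satisfied by one element: the codes are put one after the other on a branch consistent with all of
them. At limit stages, the order yields a branch through the initial segments already constructed,
and a level up to which it remains consistent. -/
theorem IsCodeTree.exists_rho (h : IsCodeTree le lev rho agree sat con) {κ : Cardinal.{u}}
    (hrefl : ∀ x, le x x) (htrans : ∀ x y z, le x y → le y z → le x z)
    (hfill : ∀ (I J : Type u) (a : I → M) (b : J → M), #I ≤ κ → #J ≤ κ →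
      (∀ i j, le (a i) (b j)) → ∃ x, (∀ i, le (a i) x) ∧ ∀ j, le x (b j))
    {K : Type u} [Nonempty K] (hK : #K ≤ κ) (c : K → M)
    (hdir : ∀ k k', ∃ k'', ∀ z, rho z (c k'') → rho z (c k) ∧ rho z (c k'))
    (hsat : ∀ k, ∃ z, rho z (c k)) : ∃ z, ∀ k, rho z (c k) := by
  classical
  -- the initial segments of branches that are consistent with all codes
  let P := {s : M × M // lev s.2 ∧ ∀ k, con s.1 s.2 (c k)}
  let : Preorder P :=
    { le := fun s t => le s.1.2 t.1.2 ∧ agree s.1.1 t.1.1 s.1.2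
      le_refl := fun s => ⟨hrefl _, h.agree_refl _ _⟩
      le_trans := fun s t r hst htr => ⟨htrans _ _ _ hst.1 htr.1, h.agree_trans _ _ _ _ hst.2
        (h.agree_mono _ _ _ _ s.2.1 t.2.1 hst.1 htr.2)⟩ }
  have hub : ∀ (I : Type u) [LinearOrder I] (f : I → P), #I ≤ κ → Monotone f → ∃ s, ∀ i, f i ≤ s := by
    intro I _ f hI hf
    rcases isEmpty_or_nonempty I with hI' | hI'
    · obtain ⟨x, p, hp, hx⟩ := h.root
      exact ⟨⟨(x, p), hp, fun k => (h.con_iff _ _ _).2 ((hsat k).imp fun z hz => ⟨hx z, hz⟩)⟩,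
        isEmptyElim⟩
    by_cases hmax : ∃ i, ∀ j, f j ≤ f i
    · obtain ⟨i, hi⟩ := hmax
      exact ⟨f i, hi⟩
    push Not at hmax
    choose next hnext using hmax
    have hlt : ∀ i, i < next i := fun i => not_le.1 fun hle => hnext i (hf hle)
    let x : I → M := fun i => (f i).1.1
    let p : I → M := fun i => (f i).1.2
    have hp : ∀ i, lev (p i) := fun i => (f i).2.1
    have hagree : ∀ {i j}, i ≤ j → agree (x i) (x j) (p i) := fun hij => (hf hij).2
    have hint : ∀ i, ∃ lo hi, (∀ y, agree (x (next i)) y (p (next i)) → le lo y ∧ le y hi) ∧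
        ∀ y, le lo y → le y hi → agree (x (next i)) y (p i) := by
      intro i
      refine h.interval _ _ _ (hp i) (hp (next i)) (hf (hlt i).le).1 fun he => hnext i ⟨?_, ?_⟩
      · show le (p (next i)) (p i)
        rw [he]
        exact hrefl _
      · show agree (x (next i)) (x i) (p (next i))
        rw [← he]
        exact h.agree_symm _ _ _ (hagree (hlt i).le)
    choose lo hi hlohi1 hlohi2 using hint
    -- a branch through all initial segments
    obtain ⟨y, hy1, hy2⟩ := hfill I I lo hi hI hI fun i j => by
      have h1 := (hlohi1 i _ (hagree (le_max_left (next i) (next j)))).1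
      have h2 := (hlohi1 j _ (hagree (le_max_right (next i) (next j)))).2
      exact htrans _ _ _ h1 h2
    have hy : ∀ i, agree (x i) y (p i) := fun i =>
      h.agree_trans _ _ _ _ (hagree (hlt i).le) (hlohi2 i y (hy1 i) (hy2 i))
    have hcony : ∀ i k, con y (p i) (c k) := by
      intro i k
      obtain ⟨z, hz1, hz2⟩ := (h.con_iff _ _ _).1 ((f i).2.2 k)
      exact (h.con_iff _ _ _).2 ⟨z, h.sat_congr _ _ _ _ (hy i) hz1, hz2⟩
    -- the last levels at which this branch is consistent with the codes
    let K' := {k : K // ∃ p', lev p' ∧ ¬ con y p' (c k)}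
    have hlast : ∀ k : K', ∃ q, lev q ∧ con y q (c k) ∧ ∀ p, lev p → con y p (c k) → le p q := by
      rintro ⟨k, p', hp', hk⟩
      exact h.last _ _ (p (Classical.arbitrary I)) _ (hp _) hp' (hcony _ k) hk
    choose q hq1 hq2 hq3 using hlast
    -- an element between the old levels and these; by `floor` it may be taken to be a level
    obtain ⟨r, hr1, hr2⟩ := hfill I K' p q hI ((mk_subtype_le _).trans hK) fun i k =>
      hq3 k _ (hp i) (hcony i k)
    obtain ⟨s, hs, hs1, hs2⟩ := h.floor r
    refine ⟨⟨(y, s), hs, fun k => ?_⟩, fun i => ⟨hs1 _ (hp i) (hr1 i), hy i⟩⟩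
    by_cases hk : ∃ p', lev p' ∧ ¬ con y p' (c k)
    · obtain ⟨z, hz1, hz2⟩ := (h.con_iff _ _ _).1 (hq2 ⟨k, hk⟩)
      exact (h.con_iff _ _ _).2 ⟨z, h.sat_mono _ _ _ _ hs (hq1 ⟨k, hk⟩)
        (hs2 _ (hq1 ⟨k, hk⟩) (hr2 ⟨k, hk⟩)) hz1, hz2⟩
    · push Not at hk
      exact hk s hs
  let ι := κ.ord.ToType
  have hι : #ι = κ := mk_ord_toType κ
  obtain ⟨e, he⟩ : ∃ e : ι → K, Function.Surjective e :=
    exists_surjective_of_mk_le (hK.trans hι.ge)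
  obtain ⟨f, hf, hfe⟩ := exists_monotone_meeting (ι := ι) (P := P)
    (fun i f hf => hub _ f ((mk_subtype_le _).trans hι.le) hf)
    (fun i s => ∀ z, sat z s.1.1 s.1.2 → rho z (c (e i))) (fun i s => by
      -- the code `c (e i)` is appended; directedness keeps the other codes consistent
      obtain ⟨x', p', hp', hpp', hx', hz⟩ := h.extend s.1.1 s.1.2 (c (e i)) s.2.1
      refine ⟨⟨(x', p'), hp', fun k => ?_⟩, ⟨hpp', hx'⟩, fun z h' => ((hz z).1 h').2⟩
      obtain ⟨k'', hk''⟩ := hdir (e i) k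
      obtain ⟨z, hz1, hz2⟩ := (h.con_iff _ _ _).1 (s.2.2 k'')
      exact (h.con_iff _ _ _).2 ⟨z, (hz z).2 ⟨hz1, (hk'' z hz2).1⟩, (hk'' z hz2).2⟩)
  obtain ⟨s, hs⟩ := hub ι f hι.le hf
  obtain ⟨z, hz, -⟩ := (h.con_iff _ _ _).1 (s.2.2 (Classical.arbitrary K))
  refine ⟨z, fun k => ?_⟩
  obtain ⟨i, rfl⟩ := he k
  exact hfe i z (h.sat_congr _ _ _ _ (h.agree_symm _ _ _ (hs i).2)
    (h.sat_mono _ _ _ _ (f i).2.1 s.2.1 (hs i).1 hz))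

end CodeTree

/-! ### The tree of finitely supported sequences -/

section Branch

open Cardinal

/-- The finitely supported sequences of integers in the lexicographic order. -/
abbrev Branch : Type u := ULift.{u} (Lex (ℕ →₀ ℤ))

namespace Branch

/-- The entries of a sequence. -/
def co (x : Branch.{u}) (m : ℕ) : ℤ := ofLex x.down m

/-- The sequence `(n, 0, 0, …)`, which stands for the number `n`. -/
noncomputable def num (n : ℕ) : Branch.{u} := ⟨toLex (Finsupp.single 0 (n : ℤ))⟩

variable {x y z : Branch.{u}}

theorem lt_iff : x < y ↔ ∃ m, (∀ k < m, co x k = co y k) ∧ co x m < co y m :=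
  (Finsupp.Lex.lt_iff (a := x.down) (b := y.down))

theorem exists_update (x : Branch.{u}) (n : ℕ) (a : ℤ) :
    ∃ y : Branch.{u}, co y n = a ∧ ∀ m, m ≠ n → co y m = co x m := by
  classical
  refine ⟨⟨toLex ((ofLex x.down).update n a)⟩, ?_, fun m hm => ?_⟩
  · simp [co]
  · simp [co, hm]

theorem co_num_zero (n : ℕ) : co (num.{u} n) 0 = n := by simp [co, num]

theorem co_zero_le (h : x ≤ y) : co x 0 ≤ co y 0 := by
  rcases h.lt_or_eq with h | rfl
  · obtain ⟨m, h1, h2⟩ := lt_iff.1 h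
    rcases m.eq_zero_or_pos with rfl | hm
    · exact h2.le
    · exact (h1 0 hm).le
  · exact le_rfl

theorem num_le_num {n m : ℕ} : num.{u} n ≤ num m ↔ n ≤ m := by
  refine ⟨fun h => ?_, fun h => ?_⟩
  · have := co_zero_le h
    rw [co_num_zero, co_num_zero] at this
    exact_mod_cast this
  · rcases h.lt_or_eq with h | rfl
    · exact (lt_iff.2 ⟨0, by simp, by rw [co_num_zero, co_num_zero]; exact_mod_cast h⟩).le
    · exact le_rfl

/-- Sequences between two sequences that coincide with `x` below `n` do so as well. -/
theorem co_eq_of_le_of_le {lo hi : Branch.{u}} {n : ℕ} (hlo : ∀ m < n, co lo m = co x m)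
    (hhi : ∀ m < n, co hi m = co x m) (h1 : lo ≤ y) (h2 : y ≤ hi) : ∀ m < n, co x m = co y m := by
  classical
  by_contra hcon
  push Not at hcon
  have hmin := Nat.find_spec hcon
  have hlt : ∀ k < Nat.find hcon, co x k = co y k := fun k hk => by
    by_contra hne
    exact Nat.find_min hcon hk ⟨hk.trans hmin.1, hne⟩
  rcases lt_or_gt_of_ne hmin.2 with h | h
  · exact h2.not_gt (lt_iff.2 ⟨_, fun k hk => (hhi k (hk.trans hmin.1)).trans (hlt k hk),
      (hhi _ hmin.1).trans_lt h⟩)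
  · exact h1.not_gt (lt_iff.2 ⟨_, fun k hk => (hlt k hk).symm.trans (hlo k (hk.trans hmin.1)).symm,
      h.trans_eq (hlo _ hmin.1).symm⟩)

instance : NoMaxOrder Branch.{u} := ⟨fun x => by
  obtain ⟨y, h, -⟩ := exists_update x 0 (co x 0 + 1)
  exact ⟨y, lt_iff.2 ⟨0, by simp, by lia⟩⟩⟩

instance : NoMinOrder Branch.{u} := ⟨fun x => by
  obtain ⟨y, h, -⟩ := exists_update x 0 (co x 0 - 1)
  exact ⟨y, lt_iff.2 ⟨0, by simp, by lia⟩⟩⟩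

instance : DenselyOrdered Branch.{u} := ⟨fun x y hxy => by
  obtain ⟨m, h1, h2⟩ := lt_iff.1 hxy
  obtain ⟨z, hz, hz'⟩ := exists_update x (m + 1) (co x (m + 1) + 1)
  refine ⟨z, lt_iff.2 ⟨m + 1, fun k hk => (hz' k hk.ne).symm, by lia⟩,
    lt_iff.2 ⟨m, fun k hk => ?_, ?_⟩⟩
  · rw [hz' k (by lia), h1 k hk]
  · rwa [hz' m (by lia)]⟩

instance : Countable (Lex (ℕ →₀ ℤ)) := inferInstanceAs (Countable (ℕ →₀ ℤ))

instance : Infinite Branch.{u} := NoMaxOrder.infinite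

/-- The number for which the sequence `p` stands. -/
def height (p : Branch.{u}) : ℕ := (co p 0).toNat

theorem height_num (n : ℕ) : height (num.{u} n) = n := by
  rw [height, co_num_zero, Int.toNat_natCast]

/-- The sequences of codes form a code tree, the integers being used as names for the codes. -/
theorem isCodeTree {ent : ℤ → Branch.{u}} (hent : Function.Surjective ent)
    (rho : Branch.{u} → Branch.{u} → Prop) :
    IsCodeTree (· ≤ · : Branch.{u} → Branch.{u} → Prop) (· ∈ Set.range num.{u}) rho
      (fun x y p => ∀ m < height p, co x m = co y m)
      (fun z x p => ∀ m < height p, rho z (ent (co x m)))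
      (fun x p c => ∃ z, (∀ m < height p, rho z (ent (co x m))) ∧ rho z c) := by
  classical
  have hmono : ∀ {p p' : Branch.{u}}, p ∈ Set.range num.{u} → p' ∈ Set.range num.{u} → p ≤ p' →
      height p ≤ height p' := by
    rintro _ _ ⟨n, rfl⟩ ⟨n', rfl⟩ h
    rw [height_num, height_num]
    exact num_le_num.1 h
  refine ⟨fun r => ⟨num (height r), ⟨_, rfl⟩, ?_, ?_⟩, ?_, fun _ _ _ _ => rfl,
    fun x y p h m hm => (h m hm).symm, fun x y z p h h' m hm => (h m hm).trans (h' m hm),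
    fun x y p p' hp hp' hpp h m hm => h m (hm.trans_le (hmono hp hp' hpp)),
    fun z x y p h hs m hm => h m hm ▸ hs m hm,
    fun z x p p' hp hp' hpp h m hm => h m (hm.trans_le (hmono hp hp' hpp)), fun _ _ _ => Iff.rfl,
    ?_, ⟨num 0, num 0, ⟨0, rfl⟩, fun z m hm => ?_⟩, ?_⟩
  · rintro _ ⟨n, rfl⟩ h
    have := co_zero_le h
    rw [co_num_zero] at this
    exact num_le_num.2 (by rw [height]; lia)
  · rintro _ ⟨n, rfl⟩ h
    have := co_zero_le h
    rw [co_num_zero] at this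
    exact num_le_num.2 (by rw [height]; lia)
  · rintro x _ _ ⟨n, rfl⟩ ⟨n', rfl⟩ hle hne
    have hlt : n < n' := lt_of_le_of_ne (num_le_num.1 hle) fun h => hne (congrArg num h)
    simp only [height_num]
    -- the endpoints differ from `x` at the last of the places that count only for `n'`
    obtain ⟨lo, hlo, hlo'⟩ := exists_update x n (co x n - 1)
    obtain ⟨hi, hhi, hhi'⟩ := exists_update x n (co x n + 1)
    refine ⟨lo, hi, fun y hy => ⟨(lt_iff.2 ⟨n, fun k hk => ?_, ?_⟩).le,
      (lt_iff.2 ⟨n, fun k hk => ?_, ?_⟩).le⟩, fun y h1 h2 =>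
        co_eq_of_le_of_le (fun m hm => hlo' m hm.ne) (fun m hm => hhi' m hm.ne) h1 h2⟩
    · rw [hlo' k hk.ne, hy k (hk.trans hlt)]
    · rw [hlo, ← hy n hlt]
      lia
    · rw [hhi' k hk.ne, hy k (hk.trans hlt)]
    · rw [hhi, ← hy n hlt]
      lia
  · rintro x _ c ⟨n, rfl⟩
    obtain ⟨a, rfl⟩ := hent c
    obtain ⟨y, hy, hy'⟩ := exists_update x n a
    simp only [height_num]
    refine ⟨y, num (n + 1), ⟨_, rfl⟩, num_le_num.2 n.le_succ, fun m hm => (hy' m hm.ne).symm, fun z => ?_⟩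
    rw [height_num]
    constructor
    · intro h
      exact ⟨fun m hm => hy' m hm.ne ▸ h m (hm.trans n.lt_succ_self), hy ▸ h n n.lt_succ_self⟩
    · rintro ⟨h1, h2⟩ m hm
      rcases (Nat.lt_succ_iff.1 hm).lt_or_eq with hm' | rfl
      · rw [hy' m hm'.ne]
        exact h1 m hm'
      · rwa [hy]
  · rw [height_num] at hm
    exact absurd hm m.not_lt_zero
  · rintro x c _ _ ⟨n, rfl⟩ ⟨n', rfl⟩ h h'
    simp only [height_num] at h h'
    let C : ℕ → Prop := fun n => ∃ z, (∀ m < n, rho z (ent (co x m))) ∧ rho z c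
    have hC : ∀ {a b}, a ≤ b → C b → C a := fun hab ⟨z, h1, h2⟩ =>
      ⟨z, fun m hm => h1 m (hm.trans_le hab), h2⟩
    have hn : n ≤ n' := by
      by_contra hlt
      exact h' (hC (not_le.1 hlt).le h)
    refine ⟨num (Nat.findGreatest C n'), ⟨_, rfl⟩, ?_, ?_⟩
    · rw [height_num]
      exact Nat.findGreatest_spec (P := C) hn h
    · rintro _ ⟨b, rfl⟩ hb
      rw [height_num] at hb
      refine num_le_num.2 (Nat.le_findGreatest ?_ hb)
      by_contra hlt
      exact h' (hC (not_le.1 hlt).le hb)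

end Branch

end Branch

/-! ### The superior witnessing that `T*_feq` lies below the theory of dense linear orders -/

section Tree

open Cardinal

/-- The symbols of the language of code trees. -/
inductive treeRel : ℕ → Type
  | le : treeRel 2
  | lev : treeRel 1
  | rho : treeRel 2
  | agree : treeRel 3
  | sat : treeRel 3
  | con : treeRel 3

/-- The language of code trees. -/
def Ltree : FirstOrder.Language.{0, 0} := ⟨fun _ => Empty, treeRel⟩

/-- the order of the tree -/
def tLe : Ltree.Relations 2 := treeRel.le
/-- the levels -/
def tLev : Ltree.Relations 1 := treeRel.lev
/-- satisfaction of a code -/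
def tRho : Ltree.Relations 2 := treeRel.rho
/-- agreement of branches -/
def tAgree : Ltree.Relations 3 := treeRel.agree
/-- satisfaction of an initial segment of a branch -/
def tSat : Ltree.Relations 3 := treeRel.sat
/-- consistency of an initial segment of a branch with a code -/
def tCon : Ltree.Relations 3 := treeRel.con

/-- The atomic formula given by a ternary symbol. -/
def treeFormula₃ {n : ℕ} (r : Ltree.Relations 3) (s t w : Ltree.Term (Empty ⊕ Fin n)) :
    Ltree.BoundedFormula Empty n :=
  r.boundedFormula ![s, t, w]

/-- The theory of code trees. -/
def Ttree : Ltree.Theory :=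
  { ∀' ∃' (tLev.boundedFormula₁ &1 ⊓ (∀' (tLev.boundedFormula₁ &2 ⟹ tLe.boundedFormula₂ &2 &0 ⟹ tLe.boundedFormula₂ &2 &1)) ⊓
      ∀' (tLev.boundedFormula₁ &2 ⟹ tLe.boundedFormula₂ &0 &2 ⟹ tLe.boundedFormula₂ &1 &2)),
    ∀' ∀' ∀' (tLev.boundedFormula₁ &1 ⟹ tLev.boundedFormula₁ &2 ⟹ tLe.boundedFormula₂ &1 &2 ⟹ ∼(&1 =' &2) ⟹ ∃' ∃'
      ((∀' (treeFormula₃ tAgree &0 &5 &2 ⟹ tLe.boundedFormula₂ &3 &5 ⊓ tLe.boundedFormula₂ &5 &4)) ⊓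
        ∀' (tLe.boundedFormula₂ &3 &5 ⟹ tLe.boundedFormula₂ &5 &4 ⟹ treeFormula₃ tAgree &0 &5 &1))),
    ∀' ∀' treeFormula₃ tAgree &0 &0 &1,
    ∀' ∀' ∀' (treeFormula₃ tAgree &0 &1 &2 ⟹ treeFormula₃ tAgree &1 &0 &2),
    ∀' ∀' ∀' ∀' (treeFormula₃ tAgree &0 &1 &3 ⟹ treeFormula₃ tAgree &1 &2 &3 ⟹ treeFormula₃ tAgree &0 &2 &3),
    ∀' ∀' ∀' ∀' (tLev.boundedFormula₁ &2 ⟹ tLev.boundedFormula₁ &3 ⟹ tLe.boundedFormula₂ &2 &3 ⟹ treeFormula₃ tAgree &0 &1 &3 ⟹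
      treeFormula₃ tAgree &0 &1 &2),
    ∀' ∀' ∀' ∀' (treeFormula₃ tAgree &1 &2 &3 ⟹ treeFormula₃ tSat &0 &1 &3 ⟹ treeFormula₃ tSat &0 &2 &3),
    ∀' ∀' ∀' ∀' (tLev.boundedFormula₁ &2 ⟹ tLev.boundedFormula₁ &3 ⟹ tLe.boundedFormula₂ &2 &3 ⟹ treeFormula₃ tSat &0 &1 &3 ⟹
      treeFormula₃ tSat &0 &1 &2),
    ∀' ∀' ∀' ((treeFormula₃ tCon &0 &1 &2).iff (∃' (treeFormula₃ tSat &3 &0 &1 ⊓ tRho.boundedFormula₂ &3 &2))),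
    ∀' ∀' ∀' (tLev.boundedFormula₁ &1 ⟹ ∃' ∃' (tLev.boundedFormula₁ &4 ⊓ tLe.boundedFormula₂ &1 &4 ⊓ treeFormula₃ tAgree &0 &3 &1 ⊓
      ∀' ((treeFormula₃ tSat &5 &3 &4).iff (treeFormula₃ tSat &5 &0 &1 ⊓ tRho.boundedFormula₂ &5 &2)))),
    ∃' ∃' (tLev.boundedFormula₁ &1 ⊓ ∀' treeFormula₃ tSat &2 &0 &1),
    ∀' ∀' ∀' ∀' (tLev.boundedFormula₁ &2 ⟹ tLev.boundedFormula₁ &3 ⟹ treeFormula₃ tCon &0 &2 &1 ⟹ ∼(treeFormula₃ tCon &0 &3 &1) ⟹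
      ∃' (tLev.boundedFormula₁ &4 ⊓ treeFormula₃ tCon &0 &4 &1 ⊓
        ∀' (tLev.boundedFormula₁ &5 ⟹ treeFormula₃ tCon &0 &5 &1 ⟹ tLe.boundedFormula₂ &5 &4))) }

theorem model_Ttree_iff {M : Type*} [Ltree.Structure M] : M ⊨ Ttree ↔
    IsCodeTree (M := M) (fun x y => Structure.RelMap tLe ![x, y]) (fun x => Structure.RelMap tLev ![x])
      (fun x y => Structure.RelMap tRho ![x, y]) (fun x y z => Structure.RelMap tAgree ![x, y, z])
      (fun x y z => Structure.RelMap tSat ![x, y, z]) (fun x y z => Structure.RelMap tCon ![x, y, z]) := by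
  have key : ∀ (r : Ltree.Relations 3) (k : ℕ) (v : Fin k → M) (s t w : Ltree.Term (Empty ⊕ Fin k)),
      (treeFormula₃ r s t w).Realize default v ↔ Structure.RelMap r
        ![s.realize (Sum.elim default v), t.realize (Sum.elim default v),
          w.realize (Sum.elim default v)] := by
    intro r k v s t w
    rw [treeFormula₃, BoundedFormula.realize_rel]
    apply iff_of_eq
    congr 1
    funext i
    fin_cases i <;> rfl
  simp only [Ttree, Theory.model_insert_iff,
    Theory.model_singleton_iff, Sentence.Realize, Formula.Realize, BoundedFormula.realize_all,
    BoundedFormula.realize_imp, BoundedFormula.realize_inf, BoundedFormula.realize_iff,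
    BoundedFormula.realize_not, BoundedFormula.realize_ex, key,
    BoundedFormula.realize_rel₁, BoundedFormula.realize_rel₂, BoundedFormula.realize_bdEqual,
    and_assoc]
  exact ⟨fun ⟨h1, h2, h3, h4, h5, h6, h7, h8, h9, h10, h11, h12⟩ =>
      ⟨h1, h2, h3, h4, h5, h6, h7, h8, h9, h10, h11, h12⟩,
    fun ⟨h1, h2, h3, h4, h5, h6, h7, h8, h9, h10, h11, h12⟩ =>
      ⟨h1, h2, h3, h4, h5, h6, h7, h8, h9, h10, h11, h12⟩⟩

/-- The language of code trees whose codes are subsets of a structure for `Lfeq`. -/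
def Lbig : FirstOrder.Language.{u, u} :=
  ⟨fun _ => PEmpty, fun n => ULift.{u} (Lfeq.Relations n ⊕ treeRel n)⟩

instance (n : ℕ) : Countable (feqRel n) := by
  refine Function.Injective.countable (β := ℕ) (f := fun r => match r with
    | .P => 0 | .Q => 1 | .E => 2 | .R => 3 | .F => 4) fun r r' h => ?_
  cases r <;> cases r' <;> first | rfl | cases h

instance (n : ℕ) : Countable (treeRel n) := by
  refine Function.Injective.countable (β := ℕ) (f := fun r => match r with
    | .le => 0 | .lev => 1 | .rho => 2 | .agree => 3 | .sat => 4 | .con => 5) fun r r' h => ?_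
  cases r <;> cases r' <;> first | rfl | cases h

theorem card_Lfeq_le : Lfeq.card ≤ ℵ₀ :=
  mk_le_aleph0_iff.2 (inferInstanceAs (Countable ((Σ _ : ℕ, Empty) ⊕ Σ n, feqRel n)))

theorem card_Lbig_le : Lbig.{u}.card ≤ ℵ₀ :=
  mk_le_aleph0_iff.2 (inferInstanceAs (Countable ((Σ _ : ℕ, PEmpty.{u + 1}) ⊕
    Σ n, ULift.{u} (feqRel n ⊕ treeRel n))))

/-- The symbols of `Lfeq` in `Lbig`. -/
def feqToBig : Lfeq →ᴸ Lbig.{u} := ⟨fun _ f => f.elim, fun _ r => ⟨Sum.inl r⟩⟩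

/-- The symbols of `Ltree` in `Lbig`. -/
def treeToBig : Ltree →ᴸ Lbig.{u} := ⟨fun _ f => f.elim, fun _ r => ⟨Sum.inr r⟩⟩

/-- The symbol `≤` in `Lbig`. -/
def orderToBig : Language.order →ᴸ Lbig.{u} :=
  ⟨fun _ f => f.elim, fun _ r => match r with | .le => ⟨Sum.inr treeRel.le⟩⟩

/-- A formula with arbitrarily many free variables that is valid in `X` is valid in all models of the
theory of `X`. -/
theorem realize_of_model_completeTheory {L : FirstOrder.Language.{u₀, v₀}} {X M : Type u} [Nonempty X]
    [L.Structure X] [L.Structure M] (hM : M ⊨ L.completeTheory X) {α : Type*} (φ : L.Formula α)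
    (h : ∀ v : α → X, φ.Realize v) (v : α → M) : φ.Realize v := by
  classical
  let ψ : L.Formula φ.freeVarFinset := BoundedFormula.restrictFreeVar φ id
  have e : ∀ {Y : Type u} [L.Structure Y] (x : α → Y),
      ψ.Realize (fun a : φ.freeVarFinset => x a) ↔ φ.Realize x :=
    fun x => BoundedFormula.realize_restrictFreeVar (f := id) x (fun _ => rfl)
  let σ : L.Sentence := Formula.iAlls φ.freeVarFinset (ψ.relabel Sum.inr : L.Formula (Empty ⊕ _))
  have hσ : ∀ {Y : Type u} [L.Structure Y], Y ⊨ σ ↔ ∀ w : φ.freeVarFinset → Y, ψ.Realize w := by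
    intro Y _
    rw [Sentence.Realize, Formula.realize_iAlls]
    refine forall_congr' fun w => ?_
    rw [Formula.realize_relabel]
    exact Iff.rfl
  have hX : X ⊨ σ := hσ.2 fun w => by
    obtain ⟨v, rfl⟩ := (Subtype.val_injective (p := (· ∈ φ.freeVarFinset))).surjective_comp_right w
    exact (e v).2 (h v)
  exact (e v).1 (hσ.1 ((L.completeTheory X).realize_sentence_of_mem hX) _)

/-- The formula saying that some code has as its extension the set defined by `θ`. -/
noncomputable def codeFormula {α : Type*} (θ : Lfeq.Formula (α ⊕ Fin 1)) : Lbig.{u}.Formula α :=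
  Formula.iExs Unit (Formula.iAlls (Fin 1)
    (((feqToBig.onFormula θ).relabel (Sum.map Sum.inl id)).iff
      (Relations.formula₂ (treeToBig.onRelation tRho) (Term.var (Sum.inr 0))
        (Term.var (Sum.inl (Sum.inr ()))))))

theorem realize_codeFormula {M : Type*} [Lbig.{u}.Structure M] [Lfeq.Structure M]
    [feqToBig.{u}.IsExpansionOn M] [Ltree.Structure M] [treeToBig.{u}.IsExpansionOn M] {α : Type*}
    (θ : Lfeq.Formula (α ⊕ Fin 1)) (d : α → M) : (codeFormula.{u} θ).Realize d ↔
      ∃ c : M, ∀ z, θ.Realize (Sum.elim d fun _ => z) ↔ Structure.RelMap tRho ![z, c] := by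
  rw [codeFormula, Formula.realize_iExs, (Equiv.funUnique Unit M).exists_congr_left]
  refine exists_congr fun c => ?_
  rw [Formula.realize_iAlls, (Equiv.funUnique (Fin 1) M).forall_congr_left]
  refine forall_congr' fun z => ?_
  rw [Formula.realize_iff, Formula.realize_relabel, LHom.realize_onFormula, Formula.realize_rel₂]
  refine iff_congr (iff_of_eq (congrArg _ ?_)) ?_
  · funext i
    rcases i with a | i
    · rfl
    · rfl
  · exact iff_of_eq (LHom.map_onRelation treeToBig tRho _)

end Tree

section Superior

open Cardinal

theorem IsFeqGeneric.infinite {N : Type u} [Lfeq.Structure N] (h : IsFeqGeneric ℵ₀ N) :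
    Infinite N := by
  by_contra hN
  rw [not_infinite_iff_finite] at hN
  obtain ⟨c, hc, -⟩ := h.exists_isQ ∅ ∅ (by simp [aleph0_pos]) (by simp [aleph0_pos]) (by simp) (fun _ _ => True) (by simp)
    (by simp) (by simp)
  obtain ⟨y, -, hy⟩ := h.exists_relE c hc Set.univ (lt_aleph0_of_finite _)
  exact hy (Set.mem_univ y)

theorem mk_formula_Lfeq_le {κ : Cardinal.{u}} (hκ : ℵ₀ ≤ κ) {Y : Type u} (hY : #Y ≤ κ) :
    #(Lfeq.Formula Y) ≤ κ := by
  have h : #(Lfeq.Formula Y) ≤ #(Σ n, Lfeq.BoundedFormula Y n) :=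
    mk_le_of_injective (f := fun φ => (⟨0, φ⟩ : Σ n, Lfeq.BoundedFormula Y n))
      fun φ ψ h => by simpa using h
  refine h.trans (BoundedFormula.card_le.trans (max_le hκ (add_le_of_le hκ (by simpa using hY) ?_)))
  exact (lift_le.{u}.2 card_Lfeq_le).trans (by simpa using hκ)

theorem exists_structure_model_TfeqStar {X : Type u} (hX : #X = ℵ₀) :
    ∃ _ : Lfeq.Structure X, X ⊨ TfeqStar := by
  obtain ⟨M, _, _, hM⟩ := exists_model_TfeqStar
  have : Infinite M := (isFeqGeneric_of_model_TfeqStar hM).infinite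
  obtain ⟨N, hN⟩ := Theory.exists_model_card_eq (T := TfeqStar) ⟨Theory.ModelType.of _ M, this⟩
    (ℵ₀ : Cardinal.{u}) le_rfl (by simpa using card_Lfeq_le)
  obtain ⟨e⟩ := Cardinal.eq.1 (hN.trans hX.symm)
  let := e.inducedStructure (L := Lfeq)
  exact ⟨inferInstance, StrongHomClass.theory_model (e.inducedStructureEquiv (L := Lfeq))⟩

/-- The structure for `Ltree` with the given relations. -/
abbrev treeStructure {M : Type*} (le : M → M → Prop) (lev : M → Prop) (rho : M → M → Prop)
    (agree sat con : M → M → M → Prop) : Ltree.Structure M where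
  funMap f := f.elim
  RelMap r v := match r, v with
    | .le, v => le (v 0) (v 1)
    | .lev, v => lev (v 0)
    | .rho, v => rho (v 0) (v 1)
    | .agree, v => agree (v 0) (v 1) (v 2)
    | .sat, v => sat (v 0) (v 1) (v 2)
    | .con, v => con (v 0) (v 1) (v 2)

/-- The structure for `Lbig` with the given reducts. -/
abbrev bigStructure (M : Type*) [Lfeq.Structure M] [Ltree.Structure M] : Lbig.{u}.Structure M where
  funMap f := f.elim
  RelMap r v := match r with
    | ⟨.inl r⟩ => Structure.RelMap (L := Lfeq) r v
    | ⟨.inr r⟩ => Structure.RelMap (L := Ltree) r v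

/-- On the tree of sequences of codes for all definable sets of a countable model of `T*_feq`, the
structures combine as desired. -/
theorem exists_codeTree : ∃ (X : Type u) (_ : Nonempty X) (_ : Lbig.{u}.Structure X),
    X ⊨ feqToBig.{u}.onTheory TfeqStar ∧ X ⊨ treeToBig.{u}.onTheory Ttree ∧
    X ⊨ orderToBig.{u}.onTheory Tord ∧
    ∀ (α : Type u) (θ : Lfeq.Formula (α ⊕ Fin 1)) (d : α → X), (codeFormula.{u} θ).Realize d := by
  have hX : #Branch.{u} = ℵ₀ := mk_eq_aleph0 _
  obtain ⟨_, hfeq⟩ := exists_structure_model_TfeqStar hX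
  have hform : #(Lfeq.Formula (Branch.{u} ⊕ Fin 1)) ≤ #Branch.{u} := by
    rw [hX]
    exact mk_formula_Lfeq_le le_rfl (by simp)
  -- `Branch` is countable, so all its definable sets can be coded by its elements, and the integers can
  -- serve as names of the codes
  obtain ⟨dec, hdec⟩ := exists_surjective_of_mk_le hform
  obtain ⟨ent, hent⟩ : ∃ ent : ℤ → Branch.{u}, Function.Surjective ent := by
    obtain ⟨e⟩ := (Cardinal.lift_mk_eq' (α := ℤ) (β := Branch.{u})).1 (by rw [hX]; simp)
    exact ⟨e, e.surjective⟩
  have htree := Branch.isCodeTree hent fun z c => (dec c).Realize (Sum.elim id fun _ => z)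
  let := treeStructure (M := Branch.{u}) (· ≤ ·) (· ∈ Set.range Branch.num.{u})
    (fun z c => (dec c).Realize (Sum.elim id fun _ => z))
    (fun x y p => ∀ m < p.height, x.co m = y.co m)
    (fun z x p => ∀ m < p.height, (dec (ent (x.co m))).Realize (Sum.elim id fun _ => z))
    (fun x p c => ∃ z, (∀ m < p.height, (dec (ent (x.co m))).Realize (Sum.elim id fun _ => z)) ∧
      (dec c).Realize (Sum.elim id fun _ => z))
  let := bigStructure.{u} Branch.{u}
  let := Language.orderStructure (M := Branch.{u})
  have : Language.order.OrderedStructure Branch.{u} := ⟨fun _ => Iff.rfl⟩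
  have h1 : feqToBig.{u}.IsExpansionOn Branch.{u} := ⟨fun f => f.elim, fun _ _ => rfl⟩
  have h2 : treeToBig.{u}.IsExpansionOn Branch.{u} := ⟨fun f => f.elim, fun _ _ => rfl⟩
  have h3 : orderToBig.{u}.IsExpansionOn Branch.{u} := ⟨fun f => f.elim, fun r _ => by cases r; rfl⟩
  refine ⟨Branch.{u}, inferInstance, inferInstance, (LHom.onTheory_model _ _).2 hfeq,
    (LHom.onTheory_model _ _).2 (model_Ttree_iff.2 htree), (LHom.onTheory_model _ _).2
      (Language.order.model_dlo (M := Branch.{u})),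
    fun α θ d => (realize_codeFormula θ d).2 ?_⟩
  obtain ⟨c, hc⟩ := hdec (θ.relabel (Sum.map d id))
  refine ⟨c, fun z => ?_⟩
  show _ ↔ (dec c).Realize (Sum.elim id fun _ => z)
  rw [hc, Formula.realize_relabel, Sum.elim_comp_map]
  rfl

/-- Saturation of the order passes to the structure for `Lfeq`: a type is coded by a directed family
of satisfiable codes, and by `IsCodeTree.exists_rho` some element satisfies all of them. This element
realises the type. -/
theorem isSaturated_of_codeTree {lam : Cardinal.{u}} (hlam : ℵ₀ ≤ lam) {M : Type u} [Nonempty M]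
    [Lbig.{u}.Structure M] [Lfeq.Structure M] [feqToBig.{u}.IsExpansionOn M] [Ltree.Structure M]
    [treeToBig.{u}.IsExpansionOn M] [Language.order.Structure M] [orderToBig.{u}.IsExpansionOn M]
    (htree : M ⊨ Ttree) (hord : M ⊨ Tord)
    (hcode : ∀ (α : Type u) (θ : Lfeq.Formula (α ⊕ Fin 1)) (d : α → M), (codeFormula.{u} θ).Realize d)
    (hsat : IsSaturated Language.order (Order.succ lam) M) :
    IsSaturated Lfeq (Order.succ lam) M := by
  classical
  have : M ⊨ Language.order.dlo := hord
  let : LinearOrder M := Language.order.linearOrderOfModels M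
  have : NoMinOrder M := noBotOrder_iff_noMinOrder _ |>.1 (Language.order.noBotOrder_of_dlo (M := M))
  have hle : ∀ x y : M, Structure.RelMap tLe ![x, y] ↔ x ≤ y := fun x y => by
    show _ ↔ Structure.RelMap (leSymb : Language.order.Relations 2) ![x, y]
    rw [← LHom.map_onRelation treeToBig.{u} tLe, ← LHom.map_onRelation orderToBig.{u} leSymb]
    rfl
  refine isSaturated_iff.2 fun I c hI p hp => ?_
  -- a type is determined by the codes of its finite parts, which form a directed family
  let K := {F : Finset (Lfeq.Formula (I ⊕ Fin 1)) // ∀ φ ∈ F, φ ∈ p}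
  have hK : #K ≤ lam := by
    have hform : #(Lfeq.Formula (I ⊕ Fin 1)) ≤ lam := mk_formula_Lfeq_le hlam (by
      simpa using add_le_of_le hlam (Order.lt_succ_iff.1 hI) (one_le_aleph0.trans hlam))
    exact (mk_subtype_le _).trans ((mk_le_of_surjective List.toFinset_surjective).trans
      ((mk_list_le_max _).trans (max_le hlam hform)))
  choose d hd using fun k : K => (realize_codeFormula (M := M)
    (Formula.iInf fun φ : k.1 => φ.1) c).1 (hcode _ _ c)
  have hd' : ∀ (k : K) z, Structure.RelMap tRho ![z, d k] ↔
      ∀ φ ∈ k.1, φ.Realize (Sum.elim c fun _ => z) := fun k z => by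
    rw [← hd, Formula.realize_iInf, Subtype.forall]
  have : Nonempty K := ⟨⟨∅, by simp⟩⟩
  obtain ⟨z, hz⟩ := (model_Ttree_iff.1 htree).exists_rho (fun x => (hle _ _).2 le_rfl)
    (fun x y z h h' => (hle _ _).2 (((hle _ _).1 h).trans ((hle _ _).1 h')))
    (fun I J a b hI hJ hab => by
      simp only [hle] at hab ⊢
      by_cases heq : ∃ i j, a i = b j
      · obtain ⟨i, j, hij⟩ := heq
        exact ⟨a i, fun i' => (hab i' j).trans hij.ge, hab i⟩
      · push Not at heq
        obtain ⟨x, h1, h2⟩ := hsat.exists_le_lt (hlam.trans (Order.le_succ _))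
          (Order.lt_succ_iff.2 hI) (Order.lt_succ_iff.2 hJ)
          fun i j => lt_of_le_of_ne (hab i j) (heq i j)
        exact ⟨x, h1, fun j => (h2 j).le⟩) hK d
    (fun k k' => ⟨⟨k.1 ∪ k'.1, fun φ hφ => (Finset.mem_union.1 hφ).elim (k.2 φ) (k'.2 φ)⟩, fun z h => by
      rw [hd'] at h
      rw [hd', hd']
      exact ⟨fun φ hφ => h φ (Finset.mem_union_left _ hφ), fun φ hφ => h φ (Finset.mem_union_right _ hφ)⟩⟩)
    fun k => (hp k.1 k.2).imp fun z h => (hd' k z).2 h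
  exact ⟨z, fun φ hφ => (hd' ⟨{φ}, by simpa using hφ⟩ z).1 (hz _) φ (Finset.mem_singleton_self φ)⟩

/-- The complete theory of the code tree, with the reducts to the two languages as interpretations,
witnesses that `T*_feq` lies below the theory of dense linear orders. -/
theorem triangleStar_TfeqStar_Tord {lam : Cardinal.{u}} (hlam : ℵ₀ < lam) :
    TriangleStar (Order.succ lam) TfeqStar Tord := by
  obtain ⟨X, _, _, hfeq, htree, hord, hcode⟩ := exists_codeTree.{u}
  have key : ∀ M : Theory.ModelType.{u, u, u} (Lbig.{u}.completeTheory X),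
      M ⊨ feqToBig.{u}.onTheory TfeqStar ∧ M ⊨ treeToBig.{u}.onTheory Ttree ∧
        M ⊨ orderToBig.{u}.onTheory Tord := by
    intro M
    have h : ∀ {T : Lbig.{u}.Theory}, X ⊨ T → M ⊨ T := fun hT =>
      M.is_model.mono fun σ hσ => Theory.realize_sentence_of_mem _ hσ
    exact ⟨h hfeq, h htree, h hord⟩
  refine ⟨Lbig.{u}, Lbig.{u}.completeTheory X, reductInterpretation feqToBig,
    reductInterpretation orderToBig, ⟨completeTheory.isComplete _ _, fun M => ?_, fun M => ?_⟩, ?_,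
    fun M hM => ?_⟩
  · let := feqToBig.{u}.reduct M
    exact modelIn_reductInterpretation _ ((LHom.onTheory_model feqToBig.{u} _).1 (key M).1)
  · let := orderToBig.{u}.reduct M
    exact modelIn_reductInterpretation _ ((LHom.onTheory_model orderToBig.{u} _).1 (key M).2.2)
  · rw [IsRelevant, min_self]
    exact (max_le card_Lbig_le le_rfl).trans_lt (hlam.trans (Order.lt_succ lam))
  · let := feqToBig.{u}.reduct M
    let := treeToBig.{u}.reduct M
    let := orderToBig.{u}.reduct M
    exact (saturatedIn_reductInterpretation feqToBig.{u}).2 (isSaturated_of_codeTree hlam.le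
      ((LHom.onTheory_model treeToBig.{u} _).1 (key M).2.1)
      ((LHom.onTheory_model orderToBig.{u} _).1 (key M).2.2)
      (fun α θ => realize_of_model_completeTheory M.is_model _ (hcode α θ))
      ((saturatedIn_reductInterpretation orderToBig.{u}).1 hM))

end Superior

/-! ### The conclusions for superiors -/

section Superior

open Cardinal

theorem isRegular_of_powerlt_self {lam : Cardinal.{u}} (h : ℵ₀ < lam) (hpow : lam ^< lam = lam) :
    lam.IsRegular := by
  refine ⟨h.le, ?_⟩
  by_contra hlt
  exact absurd ((lt_power_cof_ord h.le).trans_le ((le_powerlt lam (not_le.1 hlt)).trans hpow.le))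
    (lt_irrefl _)

theorem Interpretation.infinite_of_modelIn_Tord {L : FirstOrder.Language.{u, u}} {M : Type u}
    [L.Structure M] {φ : Interpretation Language.order L} (hφ : φ.ModelIn Tord M) : Infinite M := by
  classical
  obtain ⟨h, hmod⟩ := hφ
  let := φ.toStructure M h
  have : φ.dom M ⊨ Language.order.dlo := hmod
  let : LinearOrder (φ.dom M) := Language.order.linearOrderOfModels (φ.dom M)
  have htop : NoMaxOrder (φ.dom M) := noTopOrder_iff_noMaxOrder _ |>.1
    (Language.order.noTopOrder_of_dlo (M := φ.dom M))
  have hne : Nonempty (φ.dom M) := h.nonempty.to_subtype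
  have : Infinite (φ.dom M) := NoMaxOrder.infinite
  exact Infinite.of_injective (Subtype.val : φ.dom M → M) Subtype.val_injective

/-- The model in which interpretations of `T*_feq` are saturated and those of the theory of dense
linear orders are not. -/
theorem exists_model_saturatedIn {lam : Cardinal.{u}} (hreg : lam.IsRegular) (hlam : ℵ₀ < lam)
    (hgch : (2 : Cardinal.{u}) ^ lam = Order.succ lam) {L : FirstOrder.Language.{u, u}}
    (hL : L.card ≤ lam) {T : L.Theory} (hT : T.IsComplete) {φ : Interpretation Language.order L}
    (hφ : Interprets φ Tord T) :
    ∃ M : Theory.ModelType.{u, u, u} T, #M = Order.succ lam ∧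
      (∀ (L' : FirstOrder.Language.{u, u}) [L'.Structure M],
        (∀ {n : ℕ} (χ : L'.Formula (Fin n)), Dfn L fun v : Fin n → M => χ.Realize v) →
        (∀ φ' : Interpretation Language.order L', φ'.ModelIn Tord M →
          ¬ φ'.SaturatedIn (Order.succ lam) M) ∧
        ∀ ψ' : Interpretation Lfeq L', ψ'.ModelIn TfeqStar M →
          ψ'.SaturatedIn (Order.succ lam) M) := by
  obtain ⟨M₀⟩ : Nonempty (Theory.ModelType.{u, u, u} T) := hT.1
  have := Interpretation.infinite_of_modelIn_Tord (hφ M₀)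
  obtain ⟨M, _, hM, hcard, harr, hcut⟩ := exists_model_arrays_cuts hreg hlam hgch hL M₀.is_model
  have hMne : Nonempty M := by
    rw [← mk_ne_zero_iff, hcard]
    exact (bot_le.trans_lt (Order.lt_succ lam)).ne'
  refine ⟨Theory.ModelType.of T M, hcard, fun L' hS hL' => ?_⟩
  let : L'.Structure M := hS
  exact ⟨fun φ' => φ'.not_saturatedIn_of_cuts hlam.le hcut hL',
    fun ψ' => ψ'.saturatedIn_of_realizesArrays hlam.le (realizesArrays_of_isArray harr) hL'⟩

theorem dfn_formula {L : FirstOrder.Language.{u₀, v₀}} {M : Type*} [L.Structure M] {γ : Type*}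
    (χ : L.Formula γ) : Dfn L fun v : γ → M => χ.Realize v :=
  (Dfn.of_formula (χ.relabel Sum.inr : L.Formula (Empty ⊕ γ)) Empty.elim).congr fun v => by
    rw [Formula.realize_relabel]
    exact Iff.rfl

end Superior

end FeqOrd

theorem mainTheorem1 (lam : Cardinal.{u}) (huncount : ℵ₀ < lam)
    (hpow : lam ^< lam = lam) (hgch : (2 : Cardinal.{u}) ^ lam = Order.succ lam) :
    -- `T*_feq` is indeed the model completion of `T_feq⁺`, and it is complete
    (FeqOrd.IsModelCompletion FeqOrd.TfeqPlus FeqOrd.TfeqStar ∧ FeqOrd.TfeqStar.IsComplete) ∧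
    -- (1) the given interpretations
    (∀ (L : FirstOrder.Language.{u, u}) (T : L.Theory)
      (φ : FeqOrd.Interpretation FirstOrder.Language.order L)
      (ψ : FeqOrd.Interpretation FeqOrd.Lfeq L),
      FeqOrd.IsSuperior FeqOrd.Tord FeqOrd.TfeqStar T φ ψ → FeqOrd.IsRelevant T lam →
      ∃ M : FirstOrder.Language.Theory.ModelType.{u, u, u} T,
        #M = Order.succ lam ∧
        ¬ φ.SaturatedIn (Order.succ lam) M ∧ ψ.SaturatedIn (Order.succ lam) M) ∧
    -- (2) all interpretations with parameters
    (∀ (L : FirstOrder.Language.{u, u}) (T : L.Theory)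
      (φ : FeqOrd.Interpretation FirstOrder.Language.order L)
      (ψ : FeqOrd.Interpretation FeqOrd.Lfeq L),
      FeqOrd.IsSuperior FeqOrd.Tord FeqOrd.TfeqStar T φ ψ → FeqOrd.IsRelevant T lam →
      ∃ M : FirstOrder.Language.Theory.ModelType.{u, u, u} T,
        #M = Order.succ lam ∧
        (∀ φ' : FeqOrd.Interpretation FirstOrder.Language.order (L[[M]]),
          φ'.ModelIn FeqOrd.Tord M → ¬ φ'.SaturatedIn (Order.succ lam) M) ∧
        (∀ ψ' : FeqOrd.Interpretation FeqOrd.Lfeq (L[[M]]),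
          ψ'.ModelIn FeqOrd.TfeqStar M → ψ'.SaturatedIn (Order.succ lam) M)) ∧
    -- the conclusion on the order `◁*`
    FeqOrd.StrictTriangleStar (Order.succ lam) FeqOrd.TfeqStar FeqOrd.Tord := by
  have hreg := FeqOrd.isRegular_of_powerlt_self huncount hpow
  refine ⟨⟨FeqOrd.isModelCompletion_TfeqStar, FeqOrd.isComplete_TfeqStar⟩, ?_, ?_, ?_, ?_⟩
  · rintro L T φ ψ ⟨hT, hφ, hψ⟩ hL
    obtain ⟨M, hM, h⟩ := FeqOrd.exists_model_saturatedIn hreg huncount hgch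
      ((le_max_left _ _).trans hL.le) hT hφ
    obtain ⟨h1, h2⟩ := h L FeqOrd.dfn_formula
    exact ⟨M, hM, h1 φ (hφ M), h2 ψ (hψ M)⟩
  · rintro L T φ ψ ⟨hT, hφ, hψ⟩ hL
    obtain ⟨M, hM, h⟩ := FeqOrd.exists_model_saturatedIn hreg huncount hgch
      ((le_max_left _ _).trans hL.le) hT hφ
    obtain ⟨h1, h2⟩ := h (L[[M]]) FeqOrd.Dfn.of_withConstants
    exact ⟨M, hM, h1, h2⟩
  · exact FeqOrd.triangleStar_TfeqStar_Tord huncount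
  · rintro ⟨L, T, φ, ψ, ⟨hT, hφ, hψ⟩, hL, h⟩
    -- relevance bounds the language by the cardinal itself
    rw [FeqOrd.IsRelevant, min_self] at hL
    obtain ⟨M, -, h'⟩ := FeqOrd.exists_model_saturatedIn hreg huncount hgch
      ((le_max_left _ _).trans (Order.lt_succ_iff.1 hL)) hT hφ
    obtain ⟨h1, h2⟩ := h' L FeqOrd.dfn_formula
    exact h1 φ (hφ M) (h M (h2 ψ (hψ M)))
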